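/- A planar tree $T$ is a locally finite rooted plane tree, given by finite ordered sets $D_r(T)$, $r\ge 0$ (the vertices at height $r$), with $|D_0(T)|=|D_1(T)|=1$, and order preserving parent maps $D_{r}(T)\to D_{r-1}(T)$, $r\ge1$; trees are identified if they are isomorphic through order preserving bijections. Let $|T|\in\mathbb N\cup\{\infty\}$ denote the number of edges of $T$ and $h(T)$ its height (the maximal height of a vertex). Let $\mathcal T$ be the set of all planar trees, $\mathcal T_N$ the set of those with $|T|=N$, and $\mathcal T_\infty$ the set of infinite ones. Let $B_r(T)$ be the subtree of $T$ spanned by the vertices at height at most $r$, and equip $\mathcal T$ with the metric $\mathrm{dist}(T,T')=\inf\{1/r : r\ge 1,\ B_r(T)=B_r(T')\}$ and its Borel $\sigma$-algebra. For $\mu>0$ and $N\ge 1$ let $\nu^{(\mu)}_N$ be the probability measure on $\mathcal T$ that is concentrated on the finite set $\mathcal T_N$ and satisfies $\nu_N^{(\mu)}(\{T\})=e^{-\mu h(T)}/Z_N^{(\mu)}$ for $T\in\mathcal T_N$, where $Z^{(\mu)}_N=\sum_{T\in\mathcal T_N}e^{-\mu h(T)}$. A vertex of $T\in\mathcal T_\infty$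 is of infinite type if it has infinitely many descendants, and the spine $\chi(T)$ is the subtree of $T$ spanned by the vertices of infinite type. Let $\mathcal T^s=\chi(\mathcal T_\infty)$ be the set of spine trees. **Statement.** Let $\mu>0$. The measures $\nu_N^{(\mu)}$ converge weakly, as $N\to\infty$, to a unique Borel probability measure $\nu^{(\mu)}$ on $\mathcal T$. The measure $\tilde\nu^{(\mu)}$ on $\mathcal T^s$ given by $\tilde\nu^{(\mu)}(A)=\nu^{(\mu)}(\chi^{-1}(A))$ for Borel sets $A\subseteq\mathcal T^s$ (the spine measure) is a probability measure. With respect to $\tilde\nu^{(\mu)}$, the random variables $\zeta_r(T^s)=|D_{r+1}(T^s)|-|D_r(T^s)|$, $r=1,2,\dots$, on $\mathcal T^s$ are independent and identically distributed, with the Poisson distribution of mean $\mu$: $$\tilde\nu^{(\mu)}(\zeta_r=n)=e^{-\mu}\,\frac{\mu^n}{n!},\qquad n=0,1,2,\dots$$ In particular, for every $r\ge 2$, $|D_r(T^s)|-1$ is Poisson distributed with mean $(r-1)\mu$ with respect to $\tilde\nu^{(\mu)}$, that is, $$\tilde\nu^{(\mu)}(|D_r(T^s)|=R)=e^{-(r-1)\mu}\,\frac{((r-1)\mu)^{R-1}}{(R-1)!},\qquad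 R\ge 1.$$ -/

import Mathlib

/-- A planar tree, up to order preserving isomorphism.  It is locally finite, but may be infinite.

The vertices at height `r` form a finite ordered set `D_r`, listed from left to right as
`0, 1, …, gen r - 1`, so that a vertex is a pair `(r, i)` with `i < gen r`.  The vertex `(r + 1, i)`
has the parent `(r, parent r i)`.  The parent maps are order preserving, and `D_0` (the root) and
`D_1` are one-point sets.  As the only order preserving bijection between finite initial segments
of `ℕ` is the identity, two trees are isomorphic exactly if they are equal in this encoding; the
field `parent_out` fixes the values of `parent` outside the tree, which carry no information. -/
@[ext]
structure PlanarTree where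
  gen : ℕ → ℕ
  parent : ℕ → ℕ → ℕ
  gen_zero : gen 0 = 1
  gen_one : gen 1 = 1
  parent_lt : ∀ r i, i < gen (r + 1) → parent r i < gen r
  parent_mono : ∀ r i j, i ≤ j → j < gen (r + 1) → parent r i ≤ parent r j
  parent_out : ∀ r i, gen (r + 1) ≤ i → parent r i = 0

namespace PlanarTree

/-- The set of vertices. -/
def vertices (T : PlanarTree) : Set (ℕ × ℕ) := {v | v.2 < T.gen v.1}

/-- The size `|T|`, i.e. the number of edges.  Every edge joins a vertex different from the root to
its parent, so that edges are counted by their upper end points. -/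
noncomputable def size (T : PlanarTree) : ℕ∞ := {v ∈ T.vertices | 1 ≤ v.1}.encard

/-- The height of a finite tree: the maximal height of a vertex.  (Used for finite trees only.) -/
noncomputable def height (T : PlanarTree) : ℕ := sSup {r | T.gen r ≠ 0}

/-- The ball `B_r(T)` of radius `r ≥ 1` around the root: the subtree spanned by the vertices at
height at most `r`. -/
def ball (T : PlanarTree) (r : ℕ) (hr : 1 ≤ r) : PlanarTree where
  gen s := if s ≤ r then T.gen s else 0
  parent s i := if s + 1 ≤ r then T.parent s i else 0
  gen_zero := by simp [T.gen_zero]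
  gen_one := by simp [T.gen_one, hr]
  parent_lt s i h := by
    by_cases hs : s + 1 ≤ r
    · have hs' : s ≤ r := by omega
      simp only [hs, hs', if_true] at h ⊢
      exact T.parent_lt s i h
    · simp [hs] at h
  parent_mono s i j hij h := by
    by_cases hs : s + 1 ≤ r
    · simp only [hs, if_true] at h ⊢
      exact T.parent_mono s i j hij h
    · simp [hs]
  parent_out s i h := by
    by_cases hs : s + 1 ≤ r
    · simp only [hs, if_true] at h ⊢
      exact T.parent_out s i h
    · simp [hs]

theorem ball_eq_iff (T T' : PlanarTree) (r : ℕ) (hr : 1 ≤ r) :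
    T.ball r hr = T'.ball r hr ↔
      (∀ s ≤ r, T.gen s = T'.gen s) ∧ ∀ s < r, ∀ i, T.parent s i = T'.parent s i := by
  constructor
  · intro h
    have h1 := congrArg PlanarTree.gen h
    have h2 := congrArg PlanarTree.parent h
    refine ⟨fun s hs => ?_, fun s hs i => ?_⟩
    · have := congrFun h1 s
      simpa [ball, hs] using this
    · have := congrFun (congrFun h2 s) i
      simpa [ball, hs] using this
  · rintro ⟨h1, h2⟩
    ext s i
    · by_cases hs : s ≤ r
      · simp [ball, hs, h1 s hs]
      · simp [ball, hs]
    · by_cases hs : s < r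
      · simp [ball, h2 s hs i]
      · simp [ball, hs]

theorem ball_eq_of_le {T T' : PlanarTree} {r s : ℕ} (hr : 1 ≤ r) (hs : 1 ≤ s) (h : s ≤ r)
    (he : T.ball r hr = T'.ball r hr) : T.ball s hs = T'.ball s hs := by
  rw [ball_eq_iff] at he ⊢
  exact ⟨fun t ht => he.1 t (ht.trans h), fun t ht => he.2 t (ht.trans_le h)⟩

/-- The numbers `1 / r`, where `r ≥ 1` and the balls of radius `r` in the two trees agree. -/
def agreeSet (T T' : PlanarTree) : Set ℝ :=
  {x | ∃ (r : ℕ) (hr : 1 ≤ r), T.ball r hr = T'.ball r hr ∧ x = 1 / (r : ℝ)}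

theorem agreeSet_bddBelow (T T' : PlanarTree) : BddBelow (agreeSet T T') :=
  ⟨0, by rintro x ⟨r, hr, -, rfl⟩; positivity⟩

theorem agreeSet_nonempty (T T' : PlanarTree) : (agreeSet T T').Nonempty := by
  refine ⟨1 / ((1 : ℕ) : ℝ), 1, le_rfl, ?_, rfl⟩
  rw [ball_eq_iff]
  refine ⟨fun s hs => ?_, fun s hs i => ?_⟩
  · interval_cases s
    · rw [T.gen_zero, T'.gen_zero]
    · rw [T.gen_one, T'.gen_one]
  · obtain rfl : s = 0 := by omega
    have key : ∀ S : PlanarTree, S.parent 0 i = 0 := by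
      intro S
      by_cases hi : i < S.gen 1
      · have := S.parent_lt 0 i hi
        rw [S.gen_zero] at this
        omega
      · exact S.parent_out 0 i (by simpa using hi)
    rw [key, key]

theorem sInf_agreeSet_nonneg (T T' : PlanarTree) : 0 ≤ sInf (agreeSet T T') :=
  Real.sInf_nonneg (by rintro x ⟨r, hr, -, rfl⟩; positivity)

theorem exists_ball_eq_of_sInf_lt {T T' : PlanarTree} {a : ℝ} (h : sInf (agreeSet T T') < a) :
    ∃ (r : ℕ) (hr : 1 ≤ r), T.ball r hr = T'.ball r hr ∧ 1 / (r : ℝ) < a := by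
  obtain ⟨x, ⟨r, hr, he, rfl⟩, hx⟩ := exists_lt_of_csInf_lt (agreeSet_nonempty T T') h
  exact ⟨r, hr, he, hx⟩

theorem sInf_agreeSet_le {T T' : PlanarTree} {r : ℕ} (hr : 1 ≤ r)
    (he : T.ball r hr = T'.ball r hr) : sInf (agreeSet T T') ≤ 1 / (r : ℝ) :=
  csInf_le (agreeSet_bddBelow T T') ⟨r, hr, he, rfl⟩

theorem sInf_agreeSet_triangle (T T' T'' : PlanarTree) :
    sInf (agreeSet T T'') ≤ max (sInf (agreeSet T T')) (sInf (agreeSet T' T'')) := by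
  refine le_of_forall_gt fun a ha => ?_
  obtain ⟨r, hr, he, hra⟩ := exists_ball_eq_of_sInf_lt ((le_max_left _ _).trans_lt ha)
  obtain ⟨s, hs, he', hsa⟩ := exists_ball_eq_of_sInf_lt ((le_max_right _ _).trans_lt ha)
  rcases le_total r s with h | h
  · exact (sInf_agreeSet_le hr (he.trans (ball_eq_of_le hs hr h he'))).trans_lt hra
  · exact (sInf_agreeSet_le hs ((ball_eq_of_le hr hs h he).trans he')).trans_lt hsa

theorem eq_of_sInf_agreeSet {T T' : PlanarTree} (h : sInf (agreeSet T T') = 0) : T = T' := by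
  have key : ∀ n : ℕ, ∃ (r : ℕ) (hr : 1 ≤ r), T.ball r hr = T'.ball r hr ∧ n < r := by
    intro n
    have hpos : sInf (agreeSet T T') < 1 / ((n : ℝ) + 1) := by rw [h]; positivity
    obtain ⟨r, hr, he, hlt⟩ := exists_ball_eq_of_sInf_lt hpos
    refine ⟨r, hr, he, ?_⟩
    have hr0 : (0 : ℝ) < r := by exact_mod_cast hr
    have := (one_div_lt_one_div hr0 (by positivity)).1 hlt
    have h2 : n + 1 < r := by exact_mod_cast this
    omega
  ext s i
  · obtain ⟨r, hr, he, hlt⟩ := key s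
    exact ((ball_eq_iff T T' r hr).1 he).1 s hlt.le
  · obtain ⟨r, hr, he, hlt⟩ := key s
    exact ((ball_eq_iff T T' r hr).1 he).2 s hlt i

/-- The metric `dist(T, T') = inf {1 / r | r ≥ 1, B_r(T) = B_r(T')}`. -/
noncomputable instance : MetricSpace PlanarTree where
  dist T T' := sInf (agreeSet T T')
  dist_self T := by
    refine le_antisymm (le_of_forall_gt fun a ha => ?_) (sInf_agreeSet_nonneg T T)
    obtain ⟨n, hn⟩ := exists_nat_one_div_lt ha
    refine (sInf_agreeSet_le (r := n + 1) (by omega) rfl).trans_lt ?_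
    exact_mod_cast hn
  dist_comm T T' := by
    congr 1
    ext x
    constructor
    · rintro ⟨r, hr, he, rfl⟩
      exact ⟨r, hr, he.symm, rfl⟩
    · rintro ⟨r, hr, he, rfl⟩
      exact ⟨r, hr, he.symm, rfl⟩
  dist_triangle T T' T'' :=
    (sInf_agreeSet_triangle T T' T'').trans
      (max_le_add_of_nonneg (sInf_agreeSet_nonneg _ _) (sInf_agreeSet_nonneg _ _))
  eq_of_dist_eq_zero := eq_of_sInf_agreeSet

noncomputable instance : MeasurableSpace PlanarTree := borel PlanarTree

instance : BorelSpace PlanarTree := ⟨rfl⟩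

/-! ### The finite size measures and their local limit -/

open scoped BoundedContinuousFunction

/-- The partition function `Z_N = ∑ exp (-μ h(T))`, summed over the (finitely many) trees `T` with
`N` edges. -/
noncomputable def partitionFunction (μ : ℝ) (N : ℕ) : ENNReal :=
  ∑' T : {T : PlanarTree // T.size = N}, ENNReal.ofReal (Real.exp (-μ * T.1.height))

/-- The measure on the space of trees that is concentrated on the trees with `N` edges and gives
to each such tree `T` the mass `exp (-μ h(T)) / Z_N`. -/
noncomputable def finiteSizeMeasure (μ : ℝ) (N : ℕ) : MeasureTheory.Measure PlanarTree :=
  MeasureTheory.Measure.sum fun T : {T : PlanarTree // T.size = N} =>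
    (ENNReal.ofReal (Real.exp (-μ * T.1.height)) / partitionFunction μ N) •
      MeasureTheory.Measure.dirac T.1

/-- `ν` is the local limit of the finite size measures: it is a Borel probability measure, and the
finite size measures converge to it weakly as the size tends to infinity. -/
def IsLocalLimit (μ : ℝ) (ν : MeasureTheory.Measure PlanarTree) : Prop :=
  MeasureTheory.IsProbabilityMeasure ν ∧
    ∀ F : PlanarTree →ᵇ ℝ,
      Filter.Tendsto (fun N : ℕ => ∫ T, F T ∂(finiteSizeMeasure μ N)) Filter.atTop
        (nhds (∫ T, F T ∂ν))

/-! ### The spine -/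

/-- The type of infinite trees. -/
abbrev InfiniteTree : Type := {T : PlanarTree // T.size = ⊤}

/-- `T.ancestor r k j` is the position in `D_r` of the ancestor at height `r` of the vertex
`(r + k, j)`. -/
def ancestor (T : PlanarTree) (r : ℕ) : ℕ → ℕ → ℕ
  | 0, j => j
  | k + 1, j => T.ancestor r k (T.parent (r + k) j)

/-- The vertex `(r, i)` is of infinite type: it has infinitely many descendants `(r + k, j)`. -/
def InfiniteType (T : PlanarTree) (r i : ℕ) : Prop :=
  i < T.gen r ∧ {p : ℕ × ℕ | p.2 < T.gen (r + p.1) ∧ T.ancestor r p.1 p.2 = i}.Infinite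

theorem ancestor_succ' (T : PlanarTree) (r k j : ℕ) :
    T.ancestor r (k + 1) j = T.parent r (T.ancestor (r + 1) k j) := by
  induction k generalizing j with
  | zero => rfl
  | succ k ih =>
    change T.ancestor r (k + 1) (T.parent (r + (k + 1)) j) =
      T.parent r (T.ancestor (r + 1) k (T.parent (r + 1 + k) j))
    rw [ih, show r + (k + 1) = r + 1 + k by omega]

theorem InfiniteType.parent {T : PlanarTree} {r i : ℕ} (h : T.InfiniteType (r + 1) i) :
    T.InfiniteType r (T.parent r i) := by
  refine ⟨T.parent_lt r i h.1, ?_⟩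
  refine (h.2.image (f := fun p : ℕ × ℕ => (p.1 + 1, p.2)) ?_).mono ?_
  · rintro ⟨a, b⟩ - ⟨c, d⟩ - he
    simpa using he
  · rintro _ ⟨⟨k, j⟩, ⟨h1, h2⟩, rfl⟩
    refine ⟨?_, ?_⟩
    · simpa only [show r + (k + 1) = r + 1 + k by omega] using h1
    · exact (ancestor_succ' T r k j).trans (congrArg _ h2)

theorem vertices_infinite (T : InfiniteTree) : T.1.vertices.Infinite := by
  have h := T.2
  rw [size, Set.encard_eq_top_iff] at h
  exact h.mono fun v hv => hv.1

theorem ancestor_lt (T : PlanarTree) (r k j : ℕ) (h : j < T.gen (r + k)) :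
    T.ancestor r k j < T.gen r := by
  induction k generalizing j with
  | zero => exact h
  | succ k ih => exact ih _ (T.parent_lt _ _ h)

theorem infiniteType_zero (T : InfiniteTree) : T.1.InfiniteType 0 0 := by
  refine ⟨by rw [T.1.gen_zero]; omega, (vertices_infinite T).mono ?_⟩
  rintro ⟨k, j⟩ hv
  have hv' : j < T.1.gen (0 + k) := by simpa [vertices] using hv
  refine ⟨hv', ?_⟩
  have := ancestor_lt T.1 0 k j hv'
  rw [T.1.gen_zero] at this
  exact Nat.lt_one_iff.1 this

theorem infiniteType_one (T : InfiniteTree) : T.1.InfiniteType 1 0 := by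
  refine ⟨by rw [T.1.gen_one]; omega, ?_⟩
  have h := T.2
  rw [size, Set.encard_eq_top_iff] at h
  refine (h.image (f := fun v : ℕ × ℕ => (v.1 - 1, v.2)) ?_).mono ?_
  · rintro ⟨a, b⟩ ⟨-, ha⟩ ⟨c, d⟩ ⟨-, hc⟩ he
    simp only [Prod.mk.injEq] at he ha hc ⊢
    omega
  · rintro _ ⟨⟨k, j⟩, ⟨h1, h2⟩, rfl⟩
    have h2' : 1 ≤ k := h2
    have h1' : j < T.1.gen (1 + (k - 1)) := by
      rw [show 1 + (k - 1) = k by omega]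
      exact h1
    refine ⟨h1', ?_⟩
    have := ancestor_lt T.1 1 (k - 1) j h1'
    rw [T.1.gen_one] at this
    exact Nat.lt_one_iff.1 this

open Classical in
theorem nth_infiniteType {T : PlanarTree} {r j : ℕ}
    (h : j < Nat.count (T.InfiniteType r) (T.gen r)) :
    T.InfiniteType r (Nat.nth (T.InfiniteType r) j) :=
  Nat.nth_mem j fun hf => h.trans_le (Nat.count_le_card hf _)

open Classical in
/-- The spine map `χ`, which sends an infinite tree to its subtree spanned by the vertices of
infinite type.  The vertices of infinite type at height `r` are renumbered from left to right: the
`j`-th of them has the position `Nat.nth (T.InfiniteType r) j` in `D_r(T)`, and conversely a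
vertex `(r, i)` of infinite type gets the number `Nat.count (T.InfiniteType r) i` of vertices of
infinite type to the left of it. -/
noncomputable def spine (T : InfiniteTree) : PlanarTree where
  gen r := Nat.count (T.1.InfiniteType r) (T.1.gen r)
  parent r j :=
    if j < Nat.count (T.1.InfiniteType (r + 1)) (T.1.gen (r + 1)) then
      Nat.count (T.1.InfiniteType r) (T.1.parent r (Nat.nth (T.1.InfiniteType (r + 1)) j))
    else 0
  gen_zero := by
    rw [T.1.gen_zero, Nat.count_one, if_pos (infiniteType_zero T)]
  gen_one := by
    rw [T.1.gen_one, Nat.count_one, if_pos (infiniteType_one T)]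
  parent_lt r j h := by
    rw [if_pos h]
    have h' := (nth_infiniteType h).parent
    exact Nat.count_strict_mono h' h'.1
  parent_mono r i j hij h := by
    rw [if_pos h, if_pos (hij.trans_lt h)]
    refine Nat.count_monotone _ (T.1.parent_mono r _ _ ?_ (nth_infiniteType h).1)
    exact Nat.nth_le_nth' hij fun hf => h.trans_le (Nat.count_le_card hf _)
  parent_out r j h := if_neg (not_lt.2 h)

/-- The set `χ(𝒯_∞)` of spine trees. -/
abbrev SpineTree : Type := Set.range spine

/-- The measure induced by `ν` on the set of spine trees: the pushforward under the spine map of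
the restriction of `ν` to the (Borel) set of infinite trees. -/
noncomputable def spineMeasure (ν : MeasureTheory.Measure PlanarTree) :
    MeasureTheory.Measure SpineTree :=
  MeasureTheory.Measure.map (Set.rangeFactorization spine)
    (MeasureTheory.Measure.comap (Subtype.val : InfiniteTree → PlanarTree) ν)

/-- The increment `ζ_r = |D_{r+1}| - |D_r|` of the generation size of a spine tree. -/
def increment (r : ℕ) (T : SpineTree) : ℤ := (T.1.gen (r + 1) : ℤ) - (T.1.gen r : ℤ)

end PlanarTree

/-!
Put `q = exp (-μ)`, so that a tree of height `h` has weight `q ^ h`. The trees with `N` edges and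
a prescribed shape up to some height, with `K` vertices there, correspond to the forests of `K`
trees attached at these vertices, so the limits of the `ν_N` rest on the asymptotics in `N` of the
weights `w_K(N)` of the forests of `K` trees with `N` edges.

For `0 < b ≤ 1` the sum `∑ b ^ K * w_{K+1}(N)` is log-convex in `N`, because the renewal sequence
of a log-convex sequence is log-convex. Hence its successive ratios converge, to a growth rate
`L ≤ 4` which does not depend on `b`. Removing the roots of a forest expresses `w_k(N + k)` through
the weights `w_j(N)`, so every limit point `F_k` of `w_{k+1}(N) / w_1(N)` along an ultrafilter
solves the branching equation `L ^ (k + 1) * F_k = q * ∑ C(j + k + 1, k) * F_j`. In terms of the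
generating function of `F` it is a functional equation for the Möbius map `b ↦ L / (L - b)`. It
forces `L = 4`, where the map is parabolic and becomes a translation by `1` in a suitable
coordinate. After division by an explicit solution there remains a periodic function of this
coordinate, which is log-convex by the Cauchy–Schwarz inequality, hence constant. So `F` is
determined: it is a binomial mixture of the weights `(μ / 2) ^ (s - 1) / (s - 1)!` of the forests
with `s ≥ 1` infinite trees.

The limiting masses of the cylinders make the generations a Markov chain, whose law is the limit
measure. The vertices of infinite type at height `r` all lie in a given set if and only if the
trees attached at the other vertices die out; the limit of the probabilities of dying out before
height `n` and Möbius inversion give the law of the set of vertices of infinite type jointly with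
the first generations. The increment of its cardinality is then Poisson distributed, independently
of the past.
-/

section RealSeries

open Filter Topology Finset

theorem hasSum_comm_of_nonneg {ι κ : Type*} {a : ι → κ → ℝ} {f : ι → ℝ} {g : κ → ℝ} {s : ℝ}
    (ha : ∀ i j, 0 ≤ a i j) (hf : ∀ i, HasSum (a i) (f i)) (hg : ∀ j, HasSum (fun i => a i j) (g j))
    (hs : HasSum f s) : HasSum g s := by
  have hsum : Summable (Function.uncurry a) := by
    refine (summable_prod_of_nonneg fun p => ha p.1 p.2).2 ⟨fun i => (hf i).summable, ?_⟩
    simpa only [Function.uncurry, (hf _).tsum_eq] using hs.summable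
  have htotal : HasSum (Function.uncurry a) s := by
    rw [hs.unique (hsum.hasSum.prod_fiberwise hf)]
    exact hsum.hasSum
  exact ((Equiv.prodComm κ ι).hasSum_iff.2 htotal).prod_fiberwise hg

theorem sq_le_mul_of_hasSum {ι : Type*} {f g h : ι → ℝ} {A B C : ℝ} (hf : HasSum f A)
    (hg : HasSum g B) (hh : HasSum h C) (hf0 : ∀ i, 0 ≤ f i) (hh0 : ∀ i, 0 ≤ h i)
    (hle : ∀ i, g i ^ 2 ≤ f i * h i) : B ^ 2 ≤ A * C :=
  le_of_tendsto_of_tendsto' (Tendsto.pow hg 2) (Tendsto.mul hf hh) fun s =>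
    sum_sq_le_sum_mul_sum_of_sq_le_mul s (fun i _ => hf0 i) (fun i _ => hh0 i) fun i _ => hle i

theorem hasSum_mul_range_of_nonneg {f g : ℕ → ℝ} {a b : ℝ} (hf : HasSum f a) (hg : HasSum g b)
    (hf0 : ∀ n, 0 ≤ f n) (hg0 : ∀ n, 0 ≤ g n) :
    HasSum (fun n => ∑ k ∈ range (n + 1), f k * g (n - k)) (a * b) := by
  have hprod := hf.summable.mul_of_nonneg hg.summable hf0 hg0
  rw [← hf.tsum_eq, ← hg.tsum_eq,
    hf.summable.tsum_mul_tsum_eq_tsum_sum_range hg.summable hprod]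
  exact (summable_sum_mul_range_of_summable_mul hprod).hasSum

theorem tsum_natCast_mul_ofReal {ι : Type*} {c : ι → ℕ} {f : ι → ℝ} {s : ℝ} (hf : ∀ i, 0 ≤ f i)
    (hs : HasSum (fun i => c i * f i) s) :
    ∑' i, (c i : ENNReal) * ENNReal.ofReal (f i) = ENNReal.ofReal s := by
  simp_rw [← hs.tsum_eq, ENNReal.ofReal_tsum_of_nonneg
    (fun i => mul_nonneg (Nat.cast_nonneg _) (hf i)) hs.summable,
    ENNReal.ofReal_mul (Nat.cast_nonneg _), ENNReal.ofReal_natCast]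

theorem multichoose_succ_left (k j : ℕ) : (k + 1).multichoose j = (j + k).choose k := by
  rw [Nat.multichoose_eq, show k + 1 + j - 1 = j + k by omega, ← Nat.choose_symm_add]

theorem multichoose_add_mul_choose (K s i : ℕ) :
    K.multichoose (s + i) * (s + i).choose s = K.multichoose s * (K + s).multichoose i := by
  rcases K with _ | K
  · rcases s with _ | s
    · simp
    · rw [Nat.succ_add]
      simp
  · rw [Nat.add_right_comm, multichoose_succ_left, multichoose_succ_left, multichoose_succ_left,
      mul_comm ((s + K).choose K), add_comm s K, show i + (K + s) = s + i + K by omega,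
      Nat.choose_mul (by omega), Nat.add_sub_cancel, Nat.add_sub_cancel_left]

theorem hasSum_multichoose_mul_pow (k : ℕ) {x : ℝ} (hx : |x| < 1) :
    HasSum (fun j => (k.multichoose j : ℝ) * x ^ j) (1 / (1 - x) ^ k) := by
  rcases k with _ | k
  · convert hasSum_ite_eq 0 (1 : ℝ) using 2 with j
    · rcases j with _ | j <;> simp
    · simp
  · simpa only [multichoose_succ_left] using
      hasSum_choose_mul_geometric_of_norm_lt_one (𝕜 := ℝ) k (r := x) hx

theorem hasSum_multichoose_mul_choose (K s : ℕ) :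
    HasSum (fun J => (K.multichoose J : ℝ) * (J.choose s * 2 ^ s / 2 ^ J))
      (K.multichoose s * 2 ^ (K + s)) := by
  have hbinomial := (hasSum_multichoose_mul_pow (K + s) (x := 1 / 2)
    (by norm_num [abs_of_pos])).mul_left (K.multichoose s : ℝ)
  rw [show (1 - 1 / 2 : ℝ) = 1 / 2 by norm_num, div_pow, one_pow, one_div_one_div] at hbinomial
  have hinit : ∑ J ∈ range s, (K.multichoose J : ℝ) * (J.choose s * 2 ^ s / 2 ^ J) = 0 :=
    sum_eq_zero fun J hJ => by rw [Nat.choose_eq_zero_of_lt (mem_range.1 hJ)]; simp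
  rw [← hasSum_nat_add_iff' s, hinit, sub_zero]
  refine hbinomial.congr_fun fun i => ?_
  have hchoose : (K.multichoose (s + i) * (s + i).choose s : ℝ) =
      K.multichoose s * (K + s).multichoose i := mod_cast multichoose_add_mul_choose K s i
  rw [add_comm i s, pow_add, ← mul_div_assoc, ← mul_assoc, hchoose, div_pow, one_pow]
  field_simp

theorem multichoose_succ_right_eq_sum (K t : ℕ) :
    K.multichoose (t + 1) = ∑ i ∈ range (t + 1), K.choose (i + 1) * t.choose i := by
  rw [Nat.multichoose_eq, show K + (t + 1) - 1 = K + t by omega, Nat.add_choose_eq,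
    Nat.sum_antidiagonal_succ, Nat.sum_antidiagonal_eq_sum_range_succ_mk, Nat.choose_succ_self,
    mul_zero, zero_add]
  exact sum_congr rfl fun i hi => by rw [Nat.choose_symm (Nat.lt_succ_iff.1 (mem_range.1 hi))]

end RealSeries

section LogConvex

open Finset

/-- A positive sequence which is log-convex: the ratios `u (n + 1) / u n` are nondecreasing. -/
structure IsLogConvex (u : ℕ → ℝ) : Prop where
  pos : ∀ n, 0 < u n
  sq_le : ∀ n, u (n + 1) ^ 2 ≤ u n * u (n + 2)

theorem mul_le_mul_succ_of_sq_le {u : ℕ → ℝ} (hpos : ∀ n, 0 < u n) {k n : ℕ} (hkn : k ≤ n)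
    (hsq : ∀ i < n, u (i + 1) ^ 2 ≤ u i * u (i + 2)) : u (k + 1) * u n ≤ u k * u (n + 1) := by
  induction n, hkn using Nat.le_induction with
  | base => exact (mul_comm _ _).le
  | succ n _ ih =>
    have hprev := ih fun i hi => hsq i (by omega)
    refine le_of_mul_le_mul_right ?_ (hpos n)
    calc u (k + 1) * u (n + 1) * u n = u (k + 1) * u n * u (n + 1) := by ring
      _ ≤ u k * u (n + 1) * u (n + 1) := by gcongr; exact (hpos _).le
      _ = u k * u (n + 1) ^ 2 := by ring
      _ ≤ u k * (u n * u (n + 2)) := by gcongr; exacts [(hpos _).le, hsq n (by omega)]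
      _ = u k * u (n + 2) * u n := by ring

theorem renewal_discrim {f u : ℕ → ℝ} (hu : ∀ n, u (n + 1) = ∑ i ∈ range (n + 1), f i * u (n - i))
    (n : ℕ) :
    u n * u (n + 2) - u (n + 1) ^ 2 = f (n + 1) * (u 0 * u n) +
      ∑ j ∈ range n, f (j + 1) * (u (n - 1 - j + 1) * u n - u (n - 1 - j) * u (n + 1)) := by
  have hsucc : u (n + 1) = f 0 * u n + ∑ j ∈ range n, f (j + 1) * u (n - 1 - j) := by
    rw [hu, sum_range_succ', add_comm]
    simp only [Nat.sub_zero, Nat.sub_sub, Nat.add_comm 1]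
  have hsucc_succ : u (n + 2) = f (n + 1) * u 0 + f 0 * u (n + 1) +
      ∑ j ∈ range n, f (j + 1) * u (n - 1 - j + 1) := by
    have hreindex : ∑ j ∈ range n, f (j + 1) * u (n + 1 - (j + 1)) =
        ∑ j ∈ range n, f (j + 1) * u (n - 1 - j + 1) := sum_congr rfl fun j hj => by
      rw [show n + 1 - (j + 1) = n - 1 - j + 1 by have := mem_range.1 hj; omega]
    rw [hu, sum_range_succ, sum_range_succ', hreindex, Nat.sub_self, Nat.sub_zero]
    ring
  simp only [mul_sub, sum_sub_distrib, ← mul_assoc, ← sum_mul]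
  linear_combination u n * hsucc_succ - u (n + 1) * hsucc

-- The de Bruijn–Erdős theorem. The brackets in `renewal_discrim` are nonpositive by induction, so
-- log-convexity of `f` allows replacing `f (j + 1) * f n` by `f j * f (n + 1)` there, which leaves
-- `f (n + 1)` times a difference of two renewal sums.
theorem IsLogConvex.renewal {f u : ℕ → ℝ} (hf : IsLogConvex f) (h0 : 0 < u 0)
    (hu : ∀ n, u (n + 1) = ∑ i ∈ range (n + 1), f i * u (n - i)) : IsLogConvex u := by
  have hpos : ∀ n, 0 < u n := by
    intro n
    induction n using Nat.strong_induction_on with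
    | _ n ih =>
      rcases n with _ | n
      · exact h0
      · rw [hu]
        exact sum_pos (fun i _ => mul_pos (hf.pos i) (ih _ (by omega))) nonempty_range_add_one
  refine ⟨hpos, fun n => ?_⟩
  induction n using Nat.strong_induction_on with
  | _ n ih =>
    rw [← sub_nonneg, renewal_discrim hu]
    rcases n with _ | n
    · simpa using (mul_pos (hf.pos 1) (mul_pos h0 h0)).le
    rw [Nat.add_sub_cancel]
    have hbracket : ∀ j ∈ range (n + 1), u (n - j + 1) * u (n + 1) - u (n - j) * u (n + 2) ≤ 0 :=
      fun j _ => sub_nonpos.2 (mul_le_mul_succ_of_sq_le hpos (by omega) ih)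
    have hcancel : f (n + 1) * (u 0 * u (n + 1)) +
        ∑ j ∈ range (n + 1), f j * (u (n - j + 1) * u (n + 1) - u (n - j) * u (n + 2)) = 0 := by
      have hsum : ∑ j ∈ range (n + 1), f j * u (n - j + 1) = u (n + 2) - f (n + 1) * u 0 := by
        rw [hu, sum_range_succ _ (n + 1), Nat.sub_self, add_sub_cancel_right]
        refine sum_congr rfl fun j hj => ?_
        rw [Nat.sub_add_comm (Nat.lt_succ_iff.1 (mem_range.1 hj))]
      simp only [mul_sub, sum_sub_distrib, ← mul_assoc, ← sum_mul]
      rw [hsum, ← hu]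
      ring
    refine nonneg_of_mul_nonneg_right ?_ (hf.pos (n + 1))
    calc (0 : ℝ) = f (n + 2) * (f (n + 1) * (u 0 * u (n + 1)) +
          ∑ j ∈ range (n + 1), f j * (u (n - j + 1) * u (n + 1) - u (n - j) * u (n + 2))) := by
          rw [hcancel, mul_zero]
      _ ≤ _ := by
          rw [mul_add, mul_add, mul_sum, mul_sum]
          refine add_le_add (by linarith) (sum_le_sum fun j hj => ?_)
          have hratio := mul_le_mul_succ_of_sq_le hf.pos (mem_range.1 hj).le fun i _ => hf.sq_le i
          linarith [mul_le_mul_of_nonpos_right hratio (hbracket j hj)]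

end LogConvex

section PowerSeriesExpansion

open Finset PowerSeries

theorem coeff_pow_eq_zero_of_lt {R : Type*} [CommSemiring R] {Y : R⟦X⟧} (hY : constantCoeff Y = 0)
    {n j : ℕ} (h : n < j) : coeff n (Y ^ j) = 0 :=
  X_pow_dvd_iff.1 (pow_dvd_pow_of_dvd (X_dvd_iff.2 hY) j) n h

theorem coeff_invOneSubPow (R : Type*) [CommRing R] (k n : ℕ) :
    coeff n (invOneSubPow R k).val = k.multichoose n := by
  rcases k with _ | k
  · rcases n with _ | n <;> simp [invOneSubPow_zero, coeff_one]
  · rw [invOneSubPow_val_succ_eq_mk_add_choose, coeff_mk, multichoose_succ_left, add_comm]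

theorem coeff_inv_one_sub_pow {k : Type*} [Field k] {Y : k⟦X⟧} (hY : constantCoeff Y = 0)
    (K n : ℕ) :
    coeff n ((1 - Y)⁻¹ ^ K) = ∑ j ∈ range (n + 1), (K.multichoose j : k) * coeff n (Y ^ j) := by
  have hsubst : HasSubst Y := HasSubst.of_constantCoeff_zero' hY
  have hinv : (1 - Y)⁻¹ ^ K = (invOneSubPow k K).val.subst Y := by
    have hone : (1 - X : k⟦X⟧) ^ K * (invOneSubPow k K).val = 1 := by
      rw [← invOneSubPow_inv_eq_one_sub_pow, Units.inv_val]
    have hmul := congrArg (substAlgHom hsubst) hone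
    rw [map_mul, map_pow, map_sub, map_one, substAlgHom_X, coe_substAlgHom] at hmul
    exact left_inv_eq_right_inv
      (by rw [← mul_pow, PowerSeries.inv_mul_cancel _ (by simp [hY]), one_pow]) hmul
  rw [hinv, coeff_subst' hsubst, finsum_eq_sum_of_support_subset]
  · exact sum_congr rfl fun j _ => by rw [coeff_invOneSubPow, smul_eq_mul]
  · intro j hj
    by_contra hnot
    rw [coe_range, Set.mem_Iio, not_lt] at hnot
    exact hj (by simp only [coeff_pow_eq_zero_of_lt hY (Nat.lt_of_succ_le hnot), smul_zero])

end PowerSeriesExpansion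

namespace PlanarTree

section ForestWeight

open Finset PowerSeries

/-- The generating series, by number of edges, of the planar trees of height at most `m`. -/
noncomputable def heightSeries : ℕ → ℝ⟦X⟧
  | 0 => 0
  | m + 1 => X * (1 - heightSeries m)⁻¹

theorem constantCoeff_heightSeries (m : ℕ) : constantCoeff (heightSeries m) = 0 := by
  cases m <;> simp [heightSeries]

/-- The number of ordered forests of `K` planar trees of height at most `m` with `N` edges. -/
noncomputable def forestCount (m K N : ℕ) : ℝ := coeff N (heightSeries m ^ K)

theorem forestCount_zero_left (K N : ℕ) :
    forestCount 0 K N = if K = 0 ∧ N = 0 then 1 else 0 := by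
  rcases K with _ | K
  · simp [forestCount, coeff_one]
  · simp [forestCount, heightSeries]

theorem forestCount_zero_mid (m N : ℕ) : forestCount m 0 N = if N = 0 then 1 else 0 := by
  simp [forestCount, coeff_one]

theorem forestCount_succ (m K N : ℕ) :
    forestCount (m + 1) K (N + K) =
      ∑ J ∈ range (N + 1), (K.multichoose J : ℝ) * forestCount m J N := by
  rw [forestCount, heightSeries, mul_pow, coeff_X_pow_mul,
    coeff_inv_one_sub_pow (constantCoeff_heightSeries m)]
  rfl

theorem forestCount_of_lt (m : ℕ) {K N : ℕ} (h : N < K) : forestCount m K N = 0 :=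
  coeff_pow_eq_zero_of_lt (constantCoeff_heightSeries m) h

theorem forestCount_nonneg (m K N : ℕ) : 0 ≤ forestCount m K N := by
  induction m generalizing K N with
  | zero =>
    rw [forestCount_zero_left]
    positivity
  | succ m ih =>
    rcases lt_or_ge N K with h | h
    · rw [forestCount_of_lt _ h]
    · obtain ⟨M, rfl⟩ := Nat.exists_eq_add_of_le' h
      rw [forestCount_succ]
      exact sum_nonneg fun J _ => mul_nonneg (Nat.cast_nonneg _) (ih _ _)

theorem forestCount_le (m K N : ℕ) : forestCount m K N ≤ 4 ^ N / 2 ^ K := by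
  induction m generalizing K N with
  | zero =>
    rw [forestCount_zero_left]
    split_ifs with h
    · simp [h.1, h.2]
    · positivity
  | succ m ih =>
    rcases lt_or_ge N K with h | h
    · rw [forestCount_of_lt _ h]
      positivity
    obtain ⟨M, rfl⟩ := Nat.exists_eq_add_of_le' h
    have hbinomial := hasSum_multichoose_mul_pow K (x := 1 / 2) (by norm_num [abs_of_pos])
    calc forestCount (m + 1) K (M + K)
        ≤ ∑ J ∈ range (M + 1), 4 ^ M * ((K.multichoose J : ℝ) * (1 / 2) ^ J) := by
          rw [forestCount_succ]
          refine sum_le_sum fun J _ => ?_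
          calc (K.multichoose J : ℝ) * forestCount m J M
              ≤ K.multichoose J * (4 ^ M / 2 ^ J) := by gcongr; exact ih _ _
            _ = 4 ^ M * (K.multichoose J * (1 / 2) ^ J) := by rw [one_div, inv_pow]; ring
      _ ≤ 4 ^ M * (1 / (1 - 1 / 2) ^ K) := by
          rw [← mul_sum]
          gcongr
          exact sum_le_hasSum _ (fun _ _ => by positivity) hbinomial
      _ = 4 ^ (M + K) / 2 ^ K := by
          rw [show (1 - 1 / 2 : ℝ) = 2⁻¹ by norm_num, inv_pow, one_div, inv_inv, pow_add,
            show (4 : ℝ) ^ K = 2 ^ K * 2 ^ K by rw [← mul_pow]; norm_num,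
            ← mul_assoc, mul_div_assoc, div_self (by positivity), mul_one]

/-- The sum of `q ^ h` over the ordered forests of `K ≥ 1` planar trees with `N` edges, where `h` is
the height of the forest, the roots being at height `0`. It is computed by summation by parts from
the numbers of forests of height at most `m`. -/
noncomputable def forestWeight (q : ℝ) (K N : ℕ) : ℝ :=
  ∑' m, (1 - q) * q ^ m * forestCount m K N

variable {q : ℝ}

theorem one_sub_mul_pow_nonneg (hq : q ∈ Set.Ioo (0 : ℝ) 1) (m : ℕ) : 0 ≤ (1 - q) * q ^ m :=
  mul_nonneg (sub_nonneg.2 hq.2.le) (pow_nonneg hq.1.le m)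

theorem hasSum_one_sub_mul_pow (hq : q ∈ Set.Ioo (0 : ℝ) 1) :
    HasSum (fun m : ℕ => (1 - q) * q ^ m) 1 := by
  simpa only [mul_inv_cancel₀ (sub_pos.2 hq.2).ne'] using
    (hasSum_geometric_of_lt_one hq.1.le hq.2).mul_left (1 - q)

theorem summable_forestWeight (hq : q ∈ Set.Ioo (0 : ℝ) 1) (K N : ℕ) :
    Summable fun m => (1 - q) * q ^ m * forestCount m K N :=
  Summable.of_nonneg_of_le
    (fun m => mul_nonneg (one_sub_mul_pow_nonneg hq m) (forestCount_nonneg _ _ _))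
    (fun m => mul_le_mul_of_nonneg_left (forestCount_le _ _ _) (one_sub_mul_pow_nonneg hq m))
    ((hasSum_one_sub_mul_pow hq).summable.mul_right (4 ^ N / 2 ^ K))

theorem forestWeight_nonneg (hq : q ∈ Set.Ioo (0 : ℝ) 1) (K N : ℕ) : 0 ≤ forestWeight q K N :=
  tsum_nonneg fun m => mul_nonneg (one_sub_mul_pow_nonneg hq m) (forestCount_nonneg _ _ _)

theorem forestWeight_zero_left (hq : q ∈ Set.Ioo (0 : ℝ) 1) (N : ℕ) :
    forestWeight q 0 N = if N = 0 then 1 else 0 := by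
  simp only [forestWeight, forestCount_zero_mid]
  rw [tsum_mul_right, (hasSum_one_sub_mul_pow hq).tsum_eq, one_mul]

theorem forestWeight_of_lt (q : ℝ) {K N : ℕ} (h : N < K) : forestWeight q K N = 0 := by
  simp only [forestWeight, forestCount_of_lt _ h, mul_zero, tsum_zero]

theorem forestWeight_add_self (hq : q ∈ Set.Ioo (0 : ℝ) 1) {K : ℕ} (hK : 1 ≤ K) (N : ℕ) :
    forestWeight q K (N + K) =
      q * ∑ J ∈ range (N + 1), (K.multichoose J : ℝ) * forestWeight q J N := by
  rw [forestWeight, (summable_forestWeight hq K (N + K)).tsum_eq_zero_add,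
    forestCount_zero_left, if_neg (by omega), mul_zero, zero_add]
  simp only [forestCount_succ, forestWeight, ← tsum_mul_left]
  rw [← Summable.tsum_finsetSum fun J _ =>
    (summable_forestWeight hq J N).mul_left (K.multichoose J : ℝ), ← tsum_mul_left]
  refine tsum_congr fun m => ?_
  rw [mul_sum, mul_sum]
  exact sum_congr rfl fun J _ => by ring

theorem forestWeight_le (hq : q ∈ Set.Ioo (0 : ℝ) 1) (K N : ℕ) :
    forestWeight q K N ≤ 4 ^ N / 2 ^ K := by
  have hbound := (hasSum_one_sub_mul_pow hq).mul_right (4 ^ N / 2 ^ K : ℝ)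
  rw [one_mul] at hbound
  exact hasSum_le (fun m => mul_le_mul_of_nonneg_left (forestCount_le _ _ _)
    (one_sub_mul_pow_nonneg hq m)) (summable_forestWeight hq K N).hasSum hbound

/-- The sum of `b ^ J` over the ordered forests of planar trees of height at most `m` with `n`
edges, where `J` is the number of trees: the coefficients of `1 / (1 - b X_m)`. -/
noncomputable def geomCoeff (b : ℝ) (m n : ℕ) : ℝ := coeff n ((1 - C b * heightSeries m)⁻¹)

theorem constantCoeff_C_mul_heightSeries (b : ℝ) (m : ℕ) :
    constantCoeff (C b * heightSeries m) = 0 := by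
  rw [map_mul, constantCoeff_heightSeries, mul_zero]

theorem geomCoeff_zero (b : ℝ) (m : ℕ) : geomCoeff b m 0 = 1 := by
  simp [geomCoeff, constantCoeff_heightSeries]

theorem geomCoeff_zero_mid (b : ℝ) (n : ℕ) : geomCoeff b 0 n = if n = 0 then 1 else 0 := by
  simp [geomCoeff, heightSeries, coeff_one]

theorem geomCoeff_eq_sum (b : ℝ) (m n : ℕ) :
    geomCoeff b m n = ∑ J ∈ range (n + 1), b ^ J * forestCount m J n := by
  rw [geomCoeff, ← pow_one (_ ⁻¹), coeff_inv_one_sub_pow (constantCoeff_C_mul_heightSeries b m)]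
  refine sum_congr rfl fun J _ => ?_
  rw [mul_pow, ← map_pow, coeff_C_mul, Nat.multichoose_one, Nat.cast_one, one_mul, forestCount]

theorem geomCoeff_succ_succ (b : ℝ) (m n : ℕ) :
    geomCoeff b (m + 1) (n + 1) =
      ∑ i ∈ range (n + 1), b * geomCoeff 1 m i * geomCoeff b (m + 1) (n - i) := by
  have hunfold : (1 - C b * heightSeries (m + 1))⁻¹ =
      1 + C b * (X * ((1 - C 1 * heightSeries m)⁻¹ * (1 - C b * heightSeries (m + 1))⁻¹)) := by
    have hinv := PowerSeries.mul_inv_cancel (1 - C b * heightSeries (m + 1))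
      (by simp [constantCoeff_heightSeries])
    rw [sub_mul, one_mul, sub_eq_iff_eq_add] at hinv
    nth_rewrite 1 [hinv]
    rw [heightSeries, map_one, one_mul]
    ring
  rw [geomCoeff, hunfold, map_add, coeff_C_mul, coeff_succ_X_mul, coeff_mul, coeff_one,
    if_neg (Nat.succ_ne_zero n), zero_add, Nat.sum_antidiagonal_eq_sum_range_succ_mk, mul_sum]
  simp only [mul_assoc, geomCoeff]

theorem isLogConvex_geomCoeff_succ {b : ℝ} (hb : 0 < b) (m : ℕ) :
    IsLogConvex (geomCoeff b (m + 1)) := by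
  induction m generalizing b with
  | zero =>
    have hpow : geomCoeff b 1 = fun n => b ^ n := by
      funext n
      induction n with
      | zero => rw [geomCoeff_zero, pow_zero]
      | succ n ih =>
        rw [geomCoeff_succ_succ, sum_eq_single_of_mem 0 (by simp), Nat.sub_zero, ih,
          geomCoeff_zero, mul_one, pow_succ']
        intro i _ hi
        rw [geomCoeff_zero_mid, if_neg hi, mul_zero, zero_mul]
    rw [hpow]
    exact ⟨pow_pos hb, fun n => le_of_eq (by ring)⟩
  | succ m ih =>
    have hf : IsLogConvex fun n => b * geomCoeff 1 (m + 1) n :=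
      ⟨fun n => mul_pos hb ((ih one_pos).pos n), fun n => by
        nlinarith [mul_le_mul_of_nonneg_left ((ih one_pos).sq_le n) (sq_nonneg b)]⟩
    exact hf.renewal (by rw [geomCoeff_zero]; exact one_pos) (geomCoeff_succ_succ b (m + 1))

theorem geomCoeff_nonneg {b : ℝ} (hb : 0 ≤ b) (m n : ℕ) : 0 ≤ geomCoeff b m n := by
  rw [geomCoeff_eq_sum]
  exact sum_nonneg fun J _ => mul_nonneg (pow_nonneg hb J) (forestCount_nonneg _ _ _)

theorem sq_geomCoeff_le {b : ℝ} (hb : 0 < b) (m n : ℕ) :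
    geomCoeff b m (n + 1) ^ 2 ≤ geomCoeff b m n * geomCoeff b m (n + 2) := by
  rcases m with _ | m
  · simp [geomCoeff_zero_mid]
  · exact (isLogConvex_geomCoeff_succ hb m).sq_le n

/-- The sum of `b ^ J * q ^ h` over the ordered forests with `N ≥ 1` edges, where `J + 1` is the
number of trees and `h` the height. -/
noncomputable def branchWeight (q b : ℝ) (N : ℕ) : ℝ :=
  ∑ J ∈ range N, b ^ J * forestWeight q (J + 1) N

theorem hasSum_branchWeight (hq : q ∈ Set.Ioo (0 : ℝ) 1) (b : ℝ) {N : ℕ} (hN : N ≠ 0) :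
    HasSum (fun m => (1 - q) * q ^ m * geomCoeff b m N) (b * branchWeight q b N) := by
  have hforests : HasSum
      (fun m => ∑ J ∈ range (N + 1), b ^ J * ((1 - q) * q ^ m * forestCount m J N))
      (∑ J ∈ range (N + 1), b ^ J * forestWeight q J N) :=
    hasSum_sum fun J _ => (summable_forestWeight hq J N).hasSum.mul_left _
  convert hforests using 1
  · funext m
    rw [geomCoeff_eq_sum, mul_sum]
    exact sum_congr rfl fun J _ => by ring
  · rw [sum_range_succ', forestWeight_zero_left hq, if_neg hN, mul_zero, add_zero, branchWeight,
      mul_sum]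
    exact sum_congr rfl fun J _ => by ring

theorem sq_branchWeight_le (hq : q ∈ Set.Ioo (0 : ℝ) 1) {b : ℝ} (hb : 0 < b) {N : ℕ}
    (hN : N ≠ 0) :
    branchWeight q b (N + 1) ^ 2 ≤ branchWeight q b N * branchWeight q b (N + 2) := by
  have hterm : ∀ m n, 0 ≤ (1 - q) * q ^ m * geomCoeff b m n := fun m n =>
    mul_nonneg (one_sub_mul_pow_nonneg hq m) (geomCoeff_nonneg hb.le m n)
  have hsq := sq_le_mul_of_hasSum (hasSum_branchWeight hq b hN)
    (hasSum_branchWeight hq b N.succ_ne_zero) (hasSum_branchWeight hq b (N + 1).succ_ne_zero)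
    (fun m => hterm m N) (fun m => hterm m (N + 2)) fun m => by
      rw [mul_pow, mul_mul_mul_comm, ← sq]
      exact mul_le_mul_of_nonneg_left (sq_geomCoeff_le hb m N) (sq_nonneg _)
  rw [mul_pow, mul_mul_mul_comm, ← sq] at hsq
  exact le_of_mul_le_mul_left hsq (by positivity)

theorem mul_branchWeight_one (hq : q ∈ Set.Ioo (0 : ℝ) 1) {N : ℕ} (hN : N ≠ 0) :
    q * branchWeight q 1 N = forestWeight q 1 (N + 1) := by
  rw [forestWeight_add_self hq le_rfl, sum_range_succ', forestWeight_zero_left hq, if_neg hN,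
    branchWeight]
  simp only [one_pow, one_mul, Nat.multichoose_one, Nat.cast_one, mul_zero, add_zero]

end ForestWeight

end PlanarTree

namespace PlanarTree

section LimitWeight

open Finset

variable {μ : ℝ}

/-- The limiting weight of a forest with `s` infinite trees, relative to the weight of a forest with
one infinite tree. -/
noncomputable def infiniteWeight (μ : ℝ) : ℕ → ℝ
  | 0 => 0
  | s + 1 => (μ / 2) ^ s / s.factorial

/-- The limiting weight of a forest with `K` trees, relative to the weight of a single tree. The
index of summation is the number of infinite trees of the forest. -/
noncomputable def limitWeight (μ : ℝ) (K : ℕ) : ℝ :=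
  ∑ s ∈ range (K + 1), K.choose s * 2 ^ s / 2 ^ K * infiniteWeight μ s

theorem infiniteWeight_nonneg (hμ : 0 ≤ μ) (s : ℕ) : 0 ≤ infiniteWeight μ s := by
  cases s <;> simp only [infiniteWeight] <;> positivity

theorem limitWeight_nonneg (hμ : 0 ≤ μ) (K : ℕ) : 0 ≤ limitWeight μ K :=
  sum_nonneg fun s _ => mul_nonneg (by positivity) (infiniteWeight_nonneg hμ s)

theorem limitWeight_zero (μ : ℝ) : limitWeight μ 0 = 0 := by
  simp [limitWeight, infiniteWeight]

theorem limitWeight_one (μ : ℝ) : limitWeight μ 1 = 1 := by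
  simp [limitWeight, infiniteWeight, sum_range_succ]

theorem limitWeight_pos (hμ : 0 ≤ μ) {K : ℕ} (hK : K ≠ 0) : 0 < limitWeight μ K := by
  refine sum_pos' (fun s _ => mul_nonneg (by positivity) (infiniteWeight_nonneg hμ s))
    ⟨1, by simp; omega, ?_⟩
  simp only [infiniteWeight, Nat.choose_one_right]
  positivity

theorem hasSum_limitWeight (μ : ℝ) (K : ℕ) :
    HasSum (fun s => K.choose s * 2 ^ s / 2 ^ K * infiniteWeight μ s) (limitWeight μ K) :=
  hasSum_sum_of_ne_finset_zero fun s hs => by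
    rw [Nat.choose_eq_zero_of_lt (by simpa using hs)]
    simp

theorem multichoose_mul_infiniteWeight (μ : ℝ) (K s : ℕ) :
    K.multichoose s * 2 ^ (K + s) * infiniteWeight μ s =
      4 ^ K * ∑ i ∈ range (s + 1), K.choose i * 2 ^ i / 2 ^ K * infiniteWeight μ i *
        (μ ^ (s - i) / (s - i).factorial) := by
  rcases s with _ | t
  · simp [infiniteWeight]
  · rw [sum_range_succ', multichoose_succ_right_eq_sum]
    simp only [infiniteWeight, mul_zero, zero_mul, add_zero, Nat.add_sub_add_right]
    push_cast
    rw [sum_mul, sum_mul, mul_sum]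
    refine sum_congr rfl fun i hi => ?_
    obtain ⟨n, rfl⟩ := Nat.exists_eq_add_of_le (Nat.lt_succ_iff.1 (mem_range.1 hi))
    rw [Nat.cast_choose ℝ (Nat.le_add_right i n), Nat.add_sub_cancel_left,
      show (4 : ℝ) ^ K = 2 ^ K * 2 ^ K by rw [← mul_pow]; norm_num]
    simp only [div_pow, pow_add, pow_one]
    field_simp [Nat.factorial_ne_zero]

theorem hasSum_multichoose_mul_limitWeight (hμ : 0 ≤ μ) (K : ℕ) :
    HasSum (fun J => (K.multichoose J : ℝ) * limitWeight μ J)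
      (Real.exp μ * 4 ^ K * limitWeight μ K) := by
  have hexp : HasSum (fun n : ℕ => μ ^ n / n.factorial) (Real.exp μ) := by
    rw [Real.exp_eq_exp_ℝ]
    exact NormedSpace.expSeries_div_hasSum_exp μ
  have htotal := (hasSum_mul_range_of_nonneg (hasSum_limitWeight μ K) hexp
    (fun i => mul_nonneg (by positivity) (infiniteWeight_nonneg hμ i))
    fun n => by positivity).mul_left (4 ^ K)
  simp_rw [← multichoose_mul_infiniteWeight] at htotal
  rw [show Real.exp μ * 4 ^ K * limitWeight μ K = 4 ^ K * (limitWeight μ K * Real.exp μ) by ring]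
  refine hasSum_comm_of_nonneg
    (a := fun s J => K.multichoose J * (J.choose s * 2 ^ s / 2 ^ J * infiniteWeight μ s))
    (fun s J => ?_) (fun s => ?_) (fun J => (hasSum_limitWeight μ J).mul_left _) htotal
  · exact mul_nonneg (Nat.cast_nonneg _)
      (mul_nonneg (by positivity) (infiniteWeight_nonneg hμ s))
  · simpa only [mul_assoc] using (hasSum_multichoose_mul_choose K s).mul_right (infiniteWeight μ s)

theorem tsum_multichoose_mul_choose (hμ : 0 ≤ μ) (K s : ℕ) :
    ∑' J, (K.multichoose J : ENNReal) *
        ENNReal.ofReal (J.choose s * 2 ^ s / 2 ^ J * infiniteWeight μ s) =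
      ENNReal.ofReal (K.multichoose s * 2 ^ (K + s) * infiniteWeight μ s) :=
  tsum_natCast_mul_ofReal (fun J => mul_nonneg (by positivity) (infiniteWeight_nonneg hμ s)) <| by
    simpa only [mul_assoc] using (hasSum_multichoose_mul_choose K s).mul_right (infiniteWeight μ s)

theorem tsum_multichoose_mul_limitWeight (hμ : 0 ≤ μ) (K : ℕ) :
    ∑' J, (K.multichoose J : ENNReal) * ENNReal.ofReal (limitWeight μ J) =
      ENNReal.ofReal (Real.exp μ * 4 ^ K * limitWeight μ K) :=
  tsum_natCast_mul_ofReal (limitWeight_nonneg hμ) (hasSum_multichoose_mul_limitWeight hμ K)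

end LimitWeight

end PlanarTree

section RealFunctions

open Filter Topology

theorem eq_zero_of_tsum_pow_mul_eq_zero {d : ℕ → ℝ} (hd : Summable d)
    (hzero : ∀ b ∈ Set.Ioo (0 : ℝ) 1, ∑' k, b ^ k * d k = 0) : d = 0 := by
  have hbound : ∀ (k : ℕ) (n : ℕ), ∀ b ∈ Set.Icc (0 : ℝ) 1, ‖b ^ n * d (n + k)‖ ≤ |d (n + k)| :=
    fun k n b hb => by
      rw [norm_mul, norm_pow, Real.norm_of_nonneg hb.1]
      exact mul_le_of_le_one_left (abs_nonneg _) (pow_le_one₀ hb.1 hb.2)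
  have hshift : ∀ k, Summable fun n => |d (n + k)| := fun k => (summable_nat_add_iff k).2 hd.abs
  funext k
  induction k using Nat.strong_induction_on with
  | _ k ih =>
    have hcont : ContinuousOn (fun b : ℝ => ∑' n, b ^ n * d (n + k)) (Set.Icc 0 1) :=
      continuousOn_tsum (fun n => by fun_prop) (hshift k) (hbound k)
    have hlim : Tendsto (fun b : ℝ => ∑' n, b ^ n * d (n + k)) (𝓝[>] 0) (𝓝 (d k)) := by
      have hval : ∑' n, (0 : ℝ) ^ n * d (n + k) = d k := by
        rw [tsum_eq_single 0 fun n hn => by rw [zero_pow hn, zero_mul], pow_zero, one_mul,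
          Nat.zero_add]
      rw [← hval]
      exact (hcont 0 (Set.left_mem_Icc.2 zero_le_one)).mono_left
        ((nhdsWithin_Ioo_eq_nhdsGT zero_lt_one).symm.le.trans
          (nhdsWithin_mono _ Set.Ioo_subset_Icc_self))
    refine tendsto_nhds_unique hlim (tendsto_const_nhds.congr' ?_)
    filter_upwards [Ioo_mem_nhdsGT zero_lt_one] with b hb
    have hsum : Summable fun n => b ^ n * d n :=
      Summable.of_norm_bounded (hshift 0) fun n => hbound 0 n b (Set.Ioo_subset_Icc_self hb)
    have htail := hsum.sum_add_tsum_nat_add k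
    rw [hzero b hb, Finset.sum_eq_zero fun n hn => by
      rw [ih n (Finset.mem_range.1 hn), Pi.zero_apply, mul_zero], zero_add] at htail
    simp only [pow_add, mul_right_comm _ (b ^ k), tsum_mul_right] at htail
    exact ((mul_eq_zero.1 htail).resolve_right (pow_pos hb.1 k).ne').symm

theorem eq_of_periodic_of_sq_le {P : ℝ → ℝ} (hcont : ContinuousOn P (Set.Ici 0))
    (hpos : ∀ c, 0 ≤ c → 0 < P c) (hper : ∀ c, 0 ≤ c → P (c + 1) = P c)
    (hsq : ∀ c d, 1 ≤ c → 0 ≤ d → d ≤ 1 → P c ^ 2 ≤ P (c - d) * P (c + d)) {c : ℝ}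
    (hc : 0 ≤ c) : P c = P 0 := by
  have hadd : ∀ c, 0 ≤ c → ∀ n : ℕ, P (c + n) = P c := fun c hc n => by
    induction n with
    | zero => rw [Nat.cast_zero, add_zero]
    | succ n ih => rw [Nat.cast_succ, ← add_assoc, hper _ (by positivity), ih]
  obtain ⟨x, hx, hmax⟩ := isCompact_Icc.exists_isMaxOn (Set.nonempty_Icc.2 zero_le_one)
    (hcont.mono Set.Icc_subset_Ici_self)
  have hle : ∀ y, 0 ≤ y → P y ≤ P x := by
    intro y hy
    have hfract : 0 ≤ y - ⌊y⌋₊ := sub_nonneg.2 (Nat.floor_le hy)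
    rw [← sub_add_cancel y ⌊y⌋₊, hadd _ hfract]
    exact hmax ⟨hfract, by linarith [Nat.lt_floor_add_one y]⟩
  have hright : ∀ d, 0 ≤ d → d ≤ 1 → P (x + 1 + d) = P x := by
    intro d hd0 hd1
    have hsq_max := hsq (x + 1) d (by linarith [hx.1]) hd0 hd1
    rw [hper x hx.1, sq] at hsq_max
    have hright0 := hpos (x + 1 + d) (by linarith [hx.1])
    refine (hle _ (by linarith [hx.1])).antisymm
      (le_of_mul_le_mul_left (hsq_max.trans ?_) (hpos x hx.1))
    exact mul_le_mul_of_nonneg_right (hle _ (by linarith [hx.1])) hright0.le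
  have hconst : ∀ c, 0 ≤ c → P c = P x := by
    intro c hc
    have hfloor : 0 ≤ c + 1 - x := by linarith [hx.2]
    have hfract0 := Nat.floor_le hfloor
    have hfract1 := Nat.lt_floor_add_one (c + 1 - x)
    calc P c = P (c + (2 : ℕ)) := (hadd c hc 2).symm
      _ = P (x + 1 + (c + 1 - x - ⌊c + 1 - x⌋₊) + ⌊c + 1 - x⌋₊) := by
        congr 1
        push_cast
        ring
      _ = P (x + 1 + (c + 1 - x - ⌊c + 1 - x⌋₊)) := hadd _ (by linarith [hx.1]) _
      _ = P x := hright _ (by linarith) (by linarith)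
  rw [hconst c hc, hconst 0 le_rfl]

end RealFunctions

namespace PlanarTree

section BranchingSolution

open Filter Topology

/-- The solutions `F k` of the branching equation with growth rate `L`, where `F k` stands for the
limiting weight of a forest with `k + 1` trees and `q` is the weight of one unit of height. -/
structure IsBranchingSolution (q L : ℝ) (F : ℕ → ℝ) : Prop where
  q_pos : 0 < q
  L_pos : 0 < L
  nonneg : ∀ k, 0 ≤ F k
  zero : F 0 = 1
  hasSum : ∀ k, HasSum (fun j => ((j + k + 1).choose k : ℝ) * F j) (L ^ (k + 1) / q * F k)

theorem summable_zero_pow_mul (F : ℕ → ℝ) : Summable fun k => (0 : ℝ) ^ k * F k :=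
  summable_of_ne_finset_zero (s := {0}) fun k hk => by
    rw [zero_pow (by simpa using hk), zero_mul]

/-- A coordinate on `[0, 2)` in which the Möbius map `b ↦ 4 / (4 - b)`, with its double fixed point
`2`, becomes the translation by `1`. -/
noncomputable def branchCoord (c : ℝ) : ℝ :=
  2 * c / (1 + c)

theorem branchCoord_zero : branchCoord 0 = 0 := by
  simp [branchCoord]

theorem branchCoord_nonneg {c : ℝ} (hc : 0 ≤ c) : 0 ≤ branchCoord c := by
  unfold branchCoord
  positivity

theorem branchCoord_lt_two {c : ℝ} (hc : 0 ≤ c) : branchCoord c < 2 := by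
  rw [branchCoord, div_lt_iff₀ (by positivity)]
  linarith

theorem four_sub_branchCoord {c : ℝ} (hc : 0 ≤ c) :
    4 - branchCoord c = 2 * (1 + (c + 1)) / (1 + c) := by
  rw [branchCoord]
  field_simp
  ring

theorem four_div_four_sub_branchCoord {c : ℝ} (hc : 0 ≤ c) :
    4 / (4 - branchCoord c) = branchCoord (c + 1) := by
  rw [four_sub_branchCoord hc, branchCoord]
  field_simp
  ring

theorem branchCoord_div_two_sub {b : ℝ} (hb : b < 2) : branchCoord (b / (2 - b)) = b := by
  have hne : 2 - b ≠ 0 := by linarith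
  rw [branchCoord]
  field_simp
  ring

theorem sq_branchCoord_sub_two_div_le {m d : ℝ} (hm : 2 ≤ m) (hd0 : 0 ≤ d) (hd1 : d ≤ 1) :
    branchCoord (m - 2 / m) ^ 2 ≤ branchCoord (m - d) * branchCoord (m + d) := by
  have hη0 : 0 ≤ 2 / m := by positivity
  have hη1 : 2 / m ≤ 1 := (div_le_one (by linarith)).2 hm
  have hmη : m * (2 / m) = 2 := by field_simp
  set η := 2 / m
  have hx : 0 ≤ m - d := by linarith
  have hz : 0 ≤ m - η := by linarith
  have hd2 : 0 ≤ 1 - d ^ 2 := by nlinarith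
  rw [branchCoord, branchCoord, branchCoord, div_pow, div_mul_div_comm,
    div_le_div_iff₀ (by positivity) (by positivity)]
  have hone : (m - η) ^ 2 * (m ^ 2 + 2 * m) ≤ (m ^ 2 - 1) * (1 + (m - η)) ^ 2 := by
    have hexpand : (m ^ 2 - 1) * (1 + (m - η)) ^ 2 - (m - η) ^ 2 * (m ^ 2 + 2 * m) =
        2 * m + 3 - 2 * η - η ^ 2 := by
      linear_combination (2 * m + 2 - 2 * η) * hmη
    nlinarith
  have hmono : 0 ≤ (1 - d ^ 2) * ((1 + (m - η)) ^ 2 - (m - η) ^ 2) :=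
    mul_nonneg hd2 (by nlinarith)
  linear_combination 4 * hone + 4 * hmono

/-- The generating function of `F` in the coordinate `branchCoord`, divided by the solution
`(1 + c) ^ 2 * q ^ (-c)` of the functional equation which it satisfies. -/
noncomputable def profile (q : ℝ) (F : ℕ → ℝ) (c : ℝ) : ℝ :=
  (∑' k, branchCoord c ^ k * F k) / (1 + c) ^ 2 * q ^ c

namespace IsBranchingSolution

variable {q L : ℝ} {F : ℕ → ℝ}

theorem div_le (h : IsBranchingSolution q L F) (k : ℕ) : q / L ^ (k + 1) ≤ F k := by
  have hfirst := le_hasSum (h.hasSum k) 0 fun j _ => mul_nonneg (by positivity) (h.nonneg j)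
  have hq := h.q_pos
  have hL := h.L_pos
  have hchoose : (1 : ℝ) ≤ ((0 + k + 1).choose k : ℝ) := by
    exact_mod_cast Nat.choose_pos (by omega)
  rw [h.zero, mul_one] at hfirst
  have hone := hchoose.trans hfirst
  rw [div_mul_eq_mul_div, le_div_iff₀ hq, one_mul] at hone
  rwa [div_le_iff₀' (by positivity)]

theorem lt_of_summable (h : IsBranchingSolution q L F) {b : ℝ}
    (hs : Summable fun k => b ^ k * F k) : b < L := by
  by_contra! hb
  have hq := h.q_pos
  have hL := h.L_pos
  have hterm : ∀ k, q / L ≤ b ^ k * F k := by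
    intro k
    calc q / L = L ^ k * (q / L ^ (k + 1)) := by rw [pow_succ]; field_simp
      _ ≤ b ^ k * F k := mul_le_mul (pow_le_pow_left₀ hL.le hb k) (h.div_le k) (by positivity)
          (pow_nonneg (hL.le.trans hb) k)
  exact (div_pos hq hL).not_ge (ge_of_tendsto' hs.tendsto_atTop_zero hterm)

theorem hasSum_step (h : IsBranchingSolution q L F) {b : ℝ} (hb0 : 0 ≤ b)
    (hs : Summable fun k => b ^ k * F k) :
    HasSum (fun j => (L / (L - b)) ^ j * F j)
      ((L - b) ^ 2 / (q * L) * ∑' k, b ^ k * F k) := by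
  have hq := h.q_pos
  have hL := h.L_pos
  have hb := h.lt_of_summable hs
  have hLb : 0 < L - b := sub_pos.2 hb
  have hx : |b / L| < 1 := by rwa [abs_of_nonneg (by positivity), div_lt_one hL]
  have hrow : ∀ k, HasSum (fun j => b ^ k * (q / L ^ (k + 1)) * (((j + k + 1).choose k : ℝ) * F j))
      (b ^ k * F k) := fun k => by
    convert! (h.hasSum k).mul_left (b ^ k * (q / L ^ (k + 1))) using 1
    field_simp
  have hcol : ∀ j, HasSum (fun k => b ^ k * (q / L ^ (k + 1)) * (((j + k + 1).choose k : ℝ) * F j))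
      (q * L / (L - b) ^ 2 * ((L / (L - b)) ^ j * F j)) := fun j => by
    convert! ((hasSum_multichoose_mul_pow (j + 2) hx).mul_left (q / L)).mul_right (F j) using 1
    · funext k
      rw [Nat.multichoose_eq, show j + 2 + k - 1 = j + k + 1 by omega, pow_succ, div_pow]
      field_simp
    · rw [show 1 - b / L = (L - b) / L by field_simp, div_pow, div_pow, pow_add, pow_add]
      field_simp
  have hswap := (hasSum_comm_of_nonneg (fun k j => mul_nonneg (by positivity)
    (mul_nonneg (Nat.cast_nonneg _) (h.nonneg j))) hrow hcol hs.hasSum).mul_left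
      ((L - b) ^ 2 / (q * L))
  convert! hswap using 1
  funext j
  field_simp

theorem four_le (h : IsBranchingSolution q L F) : 4 ≤ L := by
  by_contra! hL4
  have hL := h.L_pos
  have hgrow : ∀ n : ℕ, ∃ b : ℝ, 0 ≤ b ∧ (Summable fun k => b ^ k * F k) ∧
      n * (1 - L / 4) ≤ b := by
    intro n
    induction n with
    | zero => exact ⟨0, le_rfl, summable_zero_pow_mul F, by simp⟩
    | succ n ih =>
      obtain ⟨b, hb0, hs, hn⟩ := ih
      have hLb : 0 < L - b := sub_pos.2 (h.lt_of_summable hs)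
      refine ⟨L / (L - b), by positivity, (h.hasSum_step hb0 hs).summable, ?_⟩
      have hincr : b + (1 - L / 4) ≤ L / (L - b) := by
        rw [le_div_iff₀ hLb]
        nlinarith [sq_nonneg (2 * b - L)]
      push_cast
      linarith
  obtain ⟨n, hn⟩ := exists_nat_gt (L / (1 - L / 4))
  obtain ⟨b, -, hs, hb⟩ := hgrow n
  rw [div_lt_iff₀ (by linarith)] at hn
  linarith [h.lt_of_summable hs]

theorem summable_branchCoord_natCast (h : IsBranchingSolution q 4 F) (n : ℕ) :
    Summable fun k => branchCoord n ^ k * F k := by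
  induction n with
  | zero => simpa only [Nat.cast_zero, branchCoord_zero] using summable_zero_pow_mul F
  | succ n ih =>
    have hstep := (h.hasSum_step (branchCoord_nonneg n.cast_nonneg) ih).summable
    rwa [four_div_four_sub_branchCoord n.cast_nonneg, ← Nat.cast_succ] at hstep

theorem summable_of_abs_lt_two (h : IsBranchingSolution q 4 F) {b : ℝ} (hb : |b| < 2) :
    Summable fun k => b ^ k * F k := by
  obtain ⟨n, hn⟩ := exists_nat_gt (2 / (2 - |b|))
  refine Summable.of_norm_bounded (h.summable_branchCoord_natCast n) fun k => ?_
  rw [norm_mul, norm_pow, Real.norm_of_nonneg (h.nonneg k), Real.norm_eq_abs]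
  refine mul_le_mul_of_nonneg_right (pow_le_pow_left₀ (abs_nonneg _) ?_ k) (h.nonneg k)
  rw [div_lt_iff₀ (by linarith)] at hn
  rw [branchCoord, le_div_iff₀ (by positivity)]
  nlinarith

theorem summable_branchCoord (h : IsBranchingSolution q 4 F) {c : ℝ} (hc : 0 ≤ c) :
    Summable fun k => branchCoord c ^ k * F k :=
  h.summable_of_abs_lt_two (by
    rw [abs_of_nonneg (branchCoord_nonneg hc)]
    exact branchCoord_lt_two hc)

theorem continuousOn_tsum (h : IsBranchingSolution q 4 F) :
    ContinuousOn (fun b : ℝ => ∑' k, b ^ k * F k) (Set.Ioo (-2) 2) := by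
  intro b hb
  obtain ⟨ρ, hbρ, hρ2⟩ := exists_between (abs_lt.2 hb)
  have hρ0 : 0 ≤ ρ := (abs_nonneg b).trans hbρ.le
  have hcont : ContinuousOn (fun b : ℝ => ∑' k, b ^ k * F k) (Set.Ioo (-ρ) ρ) := by
    refine _root_.continuousOn_tsum (u := fun k => ρ ^ k * F k) (fun k => by fun_prop)
      (h.summable_of_abs_lt_two (by rwa [abs_of_nonneg hρ0])) fun k x hx => ?_
    rw [norm_mul, norm_pow, Real.norm_of_nonneg (h.nonneg k), Real.norm_eq_abs]
    exact mul_le_mul_of_nonneg_right (pow_le_pow_left₀ (abs_nonneg _) (abs_lt.2 hx).le k)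
      (h.nonneg k)
  exact (hcont.continuousAt
    (Ioo_mem_nhds (abs_lt.1 hbρ).1 (abs_lt.1 hbρ).2)).continuousWithinAt

theorem tsum_branchCoord_eq (h : IsBranchingSolution q 4 F) {c : ℝ} (hc : 0 ≤ c) :
    ∑' k, branchCoord c ^ k * F k = profile q F c * (1 + c) ^ 2 / q ^ c := by
  have hqc := Real.rpow_pos_of_pos h.q_pos c
  rw [profile]
  field_simp

theorem profile_pos (h : IsBranchingSolution q 4 F) {c : ℝ} (hc : 0 ≤ c) : 0 < profile q F c := by
  have hsum : 0 < ∑' k, branchCoord c ^ k * F k :=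
    (h.summable_branchCoord hc).tsum_pos
      (fun k => mul_nonneg (pow_nonneg (branchCoord_nonneg hc) k) (h.nonneg k)) 0
      (by rw [pow_zero, one_mul, h.zero]; exact one_pos)
  have hqc := Real.rpow_pos_of_pos h.q_pos c
  rw [profile]
  positivity

theorem profile_zero (h : IsBranchingSolution q 4 F) : profile q F 0 = 1 := by
  rw [profile, branchCoord_zero, tsum_eq_single 0 fun k hk => by rw [zero_pow hk, zero_mul], h.zero]
  simp

theorem profile_add_one (h : IsBranchingSolution q 4 F) {c : ℝ} (hc : 0 ≤ c) :
    profile q F (c + 1) = profile q F c := by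
  have hq := h.q_pos
  have hstep := (h.hasSum_step (branchCoord_nonneg hc) (h.summable_branchCoord hc)).tsum_eq
  rw [four_div_four_sub_branchCoord hc, four_sub_branchCoord hc] at hstep
  rw [profile, profile, hstep, Real.rpow_add_one hq.ne']
  field_simp
  ring

theorem profile_add_nat (h : IsBranchingSolution q 4 F) {c : ℝ} (hc : 0 ≤ c) (n : ℕ) :
    profile q F (c + n) = profile q F c := by
  induction n with
  | zero => rw [Nat.cast_zero, add_zero]
  | succ n ih => rw [Nat.cast_succ, ← add_assoc, h.profile_add_one (by positivity), ih]

theorem continuousAt_profile (h : IsBranchingSolution q 4 F) {c : ℝ} (hc : 0 ≤ c) :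
    ContinuousAt (profile q F) c := by
  have hc1 : 1 + c ≠ 0 := by positivity
  have hcoord : ContinuousAt branchCoord c := by
    unfold branchCoord
    fun_prop (disch := assumption)
  have htsum : ContinuousAt (fun b : ℝ => ∑' k, b ^ k * F k) (branchCoord c) :=
    h.continuousOn_tsum.continuousAt
      (Ioo_mem_nhds (by linarith [branchCoord_nonneg hc]) (branchCoord_lt_two hc))
  exact ((htsum.comp hcoord).div (by fun_prop) (by positivity)).mul
    (Real.continuousAt_const_rpow h.q_pos.ne')

theorem sq_profile_mul_le (h : IsBranchingSolution q 4 F) {x y z : ℝ} (hx : 0 ≤ x) (hy : 0 ≤ y)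
    (hz : 0 ≤ z) (hle : branchCoord z ^ 2 ≤ branchCoord x * branchCoord y) :
    profile q F z ^ 2 * (1 + z) ^ 4 * q ^ (x + y - 2 * z) ≤
      profile q F x * profile q F y * ((1 + x) * (1 + y)) ^ 2 := by
  have hq := h.q_pos
  have hcauchy := sq_le_mul_of_hasSum (h.summable_branchCoord hx).hasSum
    (h.summable_branchCoord hz).hasSum (h.summable_branchCoord hy).hasSum
    (fun k => mul_nonneg (pow_nonneg (branchCoord_nonneg hx) k) (h.nonneg k))
    (fun k => mul_nonneg (pow_nonneg (branchCoord_nonneg hy) k) (h.nonneg k)) fun k => by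
      calc (branchCoord z ^ k * F k) ^ 2 = (branchCoord z ^ 2) ^ k * F k ^ 2 := by ring
        _ ≤ (branchCoord x * branchCoord y) ^ k * F k ^ 2 := by gcongr
        _ = _ := by ring
  rw [h.tsum_branchCoord_eq hx, h.tsum_branchCoord_eq hy, h.tsum_branchCoord_eq hz] at hcauchy
  have hqx := Real.rpow_pos_of_pos hq x
  have hqy := Real.rpow_pos_of_pos hq y
  have hqz := Real.rpow_pos_of_pos hq z
  rw [Real.rpow_sub hq, Real.rpow_add hq, two_mul, Real.rpow_add hq]
  rw [div_pow, div_mul_div_comm, div_le_div_iff₀ (by positivity) (by positivity)] at hcauchy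
  rw [← mul_div_assoc, div_le_iff₀ (by positivity)]
  linear_combination hcauchy

theorem sq_profile_sub_two_div_le (h : IsBranchingSolution q 4 F) {m d : ℝ} (hm : 2 ≤ m)
    (hd0 : 0 ≤ d) (hd1 : d ≤ 1) :
    profile q F (m - 2 / m) ^ 2 * (1 - 2 / m * (1 / (1 + m))) ^ 4 * q ^ (4 / m) ≤
      profile q F (m - d) * profile q F (m + d) := by
  have hx : 0 ≤ m - d := by linarith
  have hy : 0 ≤ m + d := by linarith
  have hz : 0 ≤ m - 2 / m := by linarith [(div_le_one (by linarith)).2 hm]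
  have hP := mul_nonneg (h.profile_pos hx).le (h.profile_pos hy).le
  have hmiddle : ((1 + (m - d)) * (1 + (m + d))) ^ 2 ≤ (1 + m) ^ 4 := by
    rw [show (1 + m) ^ 4 = ((1 + m) ^ 2) ^ 2 by ring]
    exact pow_le_pow_left₀ (by positivity) (by nlinarith) 2
  have hbound := (h.sq_profile_mul_le hx hy hz (sq_branchCoord_sub_two_div_le hm hd0 hd1)).trans
    (mul_le_mul_of_nonneg_left hmiddle hP)
  rw [show m - d + (m + d) - 2 * (m - 2 / m) = 4 / m by ring,
    show 1 + (m - 2 / m) = (1 - 2 / m * (1 / (1 + m))) * (1 + m) by field_simp; ring] at hbound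
  exact le_of_mul_le_mul_right (by linear_combination hbound) (by positivity : 0 < (1 + m) ^ 4)

-- By periodicity the three points may be moved far out, where `sq_branchCoord_sub_two_div_le` lets
-- the middle point be `m` itself up to an error which tends to `0`.
theorem sq_profile_le (h : IsBranchingSolution q 4 F) {c d : ℝ} (hc : 1 ≤ c) (hd0 : 0 ≤ d)
    (hd1 : d ≤ 1) : profile q F c ^ 2 ≤ profile q F (c - d) * profile q F (c + d) := by
  have hq := h.q_pos
  have hm : Tendsto (fun n : ℕ => c + n) atTop atTop :=
    tendsto_atTop_add_const_left _ _ tendsto_natCast_atTop_atTop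
  have hη : Tendsto (fun n : ℕ => 2 / (c + n)) atTop (𝓝 0) := hm.const_div_atTop 2
  have hprofile : Tendsto (fun n : ℕ => profile q F (c - 2 / (c + n))) atTop
      (𝓝 (profile q F c)) := by
    refine (h.continuousAt_profile (by linarith)).tendsto.comp ?_
    simpa only [sub_zero] using tendsto_const_nhds.sub hη
  have hratio : Tendsto (fun n : ℕ => 1 - 2 / (c + n) * (1 / (1 + (c + n)))) atTop (𝓝 1) := by
    simpa only [mul_zero, sub_zero] using tendsto_const_nhds.sub
      (hη.mul ((tendsto_atTop_add_const_left _ _ hm).const_div_atTop (1 : ℝ)))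
  have hpow : Tendsto (fun n : ℕ => q ^ (4 / (c + n))) atTop (𝓝 1) := by
    rw [← Real.rpow_zero q]
    exact (Real.continuousAt_const_rpow hq.ne').tendsto.comp (hm.const_div_atTop 4)
  have hlim := ((hprofile.pow 2).mul (hratio.pow 4)).mul hpow
  rw [one_pow, mul_one, mul_one] at hlim
  refine le_of_tendsto hlim ?_
  filter_upwards [eventually_ge_atTop 1] with n hn
  have hn1 : (1 : ℝ) ≤ n := by exact_mod_cast hn
  have hη1 : 2 / (c + n) ≤ 1 := by rw [div_le_one (by linarith)]; linarith
  have hbound := h.sq_profile_sub_two_div_le (m := c + n) (by linarith) hd0 hd1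
  rwa [add_sub_right_comm, h.profile_add_nat (by linarith), add_sub_right_comm,
    h.profile_add_nat (by linarith), add_right_comm, h.profile_add_nat (by linarith)] at hbound

theorem profile_eq_one (h : IsBranchingSolution q 4 F) {c : ℝ} (hc : 0 ≤ c) :
    profile q F c = 1 :=
  h.profile_zero ▸ eq_of_periodic_of_sq_le
    (fun _ hc => (h.continuousAt_profile hc).continuousWithinAt) (fun _ => h.profile_pos)
    (fun _ => h.profile_add_one) (fun _ _ => h.sq_profile_le) hc

theorem unique {F' : ℕ → ℝ} (h : IsBranchingSolution q 4 F) (h' : IsBranchingSolution q 4 F') :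
    F = F' := by
  have hs : ∀ {F}, IsBranchingSolution q 4 F → Summable F := fun h => by
    simpa only [one_pow, one_mul] using h.summable_of_abs_lt_two (b := 1) (by norm_num)
  refine sub_eq_zero.1 (eq_zero_of_tsum_pow_mul_eq_zero ((hs h).sub (hs h')) fun b hb => ?_)
  have hc : 0 ≤ b / (2 - b) := div_nonneg hb.1.le (by linarith [hb.2])
  have hdiff := ((h.summable_branchCoord hc).hasSum.sub (h'.summable_branchCoord hc).hasSum).tsum_eq
  rw [h.tsum_branchCoord_eq hc, h'.tsum_branchCoord_eq hc, h.profile_eq_one hc,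
    h'.profile_eq_one hc, sub_self, branchCoord_div_two_sub (by linarith [hb.2])] at hdiff
  simpa only [Pi.sub_apply, mul_sub] using hdiff

end IsBranchingSolution

theorem isBranchingSolution_limitWeight {μ : ℝ} (hμ : 0 ≤ μ) :
    IsBranchingSolution (Real.exp (-μ)) 4 fun k => limitWeight μ (k + 1) where
  q_pos := Real.exp_pos _
  L_pos := by norm_num
  nonneg k := limitWeight_nonneg hμ _
  zero := limitWeight_one μ
  hasSum k := by
    have h := hasSum_multichoose_mul_limitWeight hμ (k + 1)
    rw [← hasSum_nat_add_iff' 1, Finset.sum_range_one, limitWeight_zero, mul_zero, sub_zero] at h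
    convert! h using 1
    · funext j
      rw [multichoose_succ_left, show j + 1 + k = j + k + 1 by ring]
    · rw [Real.exp_neg, div_inv_eq_mul]
      ring

end BranchingSolution

end PlanarTree

section GrowthRate

open Filter Topology

/-- The exponential growth rate of a log-convex sequence, whose successive ratios increase to it. It
is `0` if these ratios are unbounded. -/
noncomputable def growthRate (x : ℕ → ℝ) : ℝ :=
  ⨆ n, x (n + 1) / x n

namespace IsLogConvex

variable {x : ℕ → ℝ} {M B : ℝ}

theorem monotone_ratio (hx : IsLogConvex x) : Monotone fun n => x (n + 1) / x n :=
  monotone_nat_of_le_succ fun n => by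
    rw [div_le_div_iff₀ (hx.pos _) (hx.pos _), ← sq, mul_comm]
    exact hx.sq_le n

theorem ratio_le_of_le_mul_pow (hx : IsLogConvex x) (hB : 0 < B) (hM : ∀ n, x n ≤ M * B ^ n)
    (n : ℕ) : x (n + 1) / x n ≤ B := by
  by_contra! hlt
  set r := x (n + 1) / x n
  have hr : 0 < r := hB.trans hlt
  have hgeom : ∀ k, r ^ k * x n ≤ x (n + k) := fun k =>
    geom_le (u := fun k => x (n + k)) hr.le k fun i _ =>
      (le_div_iff₀ (hx.pos _)).1 (hx.monotone_ratio (Nat.le_add_right n i))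
  have hbound : ∀ k, (r / B) ^ k ≤ M * B ^ n / x n := fun k => by
    rw [div_pow, div_le_div_iff₀ (by positivity) (hx.pos _), mul_assoc, ← pow_add]
    exact (hgeom k).trans (hM _)
  obtain ⟨k, hk⟩ := ((tendsto_pow_atTop_atTop_of_one_lt
    ((one_lt_div hB).2 hlt)).eventually (eventually_gt_atTop (M * B ^ n / x n))).exists
  exact hk.not_ge (hbound k)

theorem growthRate_le (hx : IsLogConvex x) (hB : 0 < B) (hM : ∀ n, x n ≤ M * B ^ n) :
    growthRate x ≤ B :=
  ciSup_le (hx.ratio_le_of_le_mul_pow hB hM)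

theorem bddAbove_ratio (hx : IsLogConvex x) (hB : 0 < B) (hM : ∀ n, x n ≤ M * B ^ n) :
    BddAbove (Set.range fun n => x (n + 1) / x n) :=
  ⟨B, Set.forall_mem_range.2 (hx.ratio_le_of_le_mul_pow hB hM)⟩

theorem growthRate_pos (hx : IsLogConvex x)
    (hbdd : BddAbove (Set.range fun n => x (n + 1) / x n)) : 0 < growthRate x :=
  (div_pos (hx.pos 1) (hx.pos 0)).trans_le (le_ciSup hbdd 0)

theorem tendsto_ratio (hx : IsLogConvex x)
    (hbdd : BddAbove (Set.range fun n => x (n + 1) / x n)) :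
    Tendsto (fun n => x (n + 1) / x n) atTop (𝓝 (growthRate x)) :=
  tendsto_atTop_ciSup hx.monotone_ratio hbdd

theorem succ_le_growthRate_mul (hx : IsLogConvex x)
    (hbdd : BddAbove (Set.range fun n => x (n + 1) / x n)) (n : ℕ) :
    x (n + 1) ≤ growthRate x * x n :=
  (div_le_iff₀ (hx.pos n)).1 (le_ciSup hbdd n)

theorem le_mul_growthRate_pow (hx : IsLogConvex x)
    (hbdd : BddAbove (Set.range fun n => x (n + 1) / x n)) (n : ℕ) :
    x n ≤ x 0 * growthRate x ^ n :=
  (le_geom (hx.growthRate_pos hbdd).le n fun k _ => hx.succ_le_growthRate_mul hbdd k).trans_eq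
    (mul_comm _ _)

end IsLogConvex

theorem tendsto_ratio_add {x : ℕ → ℝ} {L : ℝ} (hx : ∀ᶠ n in atTop, 0 < x n)
    (h : Tendsto (fun n => x (n + 1) / x n) atTop (𝓝 L)) (k : ℕ) :
    Tendsto (fun n => x (n + k) / x n) atTop (𝓝 (L ^ k)) := by
  induction k with
  | zero =>
    refine tendsto_const_nhds.congr' ?_
    filter_upwards [hx] with n hn
    rw [pow_zero, add_zero, div_self hn.ne']
  | succ k ih =>
    rw [pow_succ']
    refine (((tendsto_add_atTop_iff_nat k).2 h).mul ih).congr' ?_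
    filter_upwards [(tendsto_add_atTop_nat k).eventually hx] with n hn
    rw [← add_assoc, div_mul_div_cancel₀ hn.ne']

theorem exists_tendsto_ultrafilter (U : Ultrafilter ℕ) {x : ℕ → ℝ} {M : ℝ}
    (h : ∀ᶠ n in (U : Filter ℕ), x n ∈ Set.Icc 0 M) : ∃ l, Tendsto x U (𝓝 l) := by
  obtain ⟨l, -, hl⟩ := (isCompact_Icc (a := (0 : ℝ)) (b := M)).ultrafilter_le_nhds (U.map x)
    (by rw [Ultrafilter.coe_map, le_principal_iff]; exact h)
  exact ⟨l, hl⟩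

theorem summable_pow_mul {b : ℝ} (hb : b ∈ Set.Icc (0 : ℝ) 1) {d : ℕ → ℝ} (hd : Summable d) :
    Summable fun k => b ^ k * d k :=
  Summable.of_norm_bounded hd.abs fun k => by
    rw [norm_mul, norm_pow, Real.norm_of_nonneg hb.1]
    exact mul_le_of_le_one_left (abs_nonneg _) (pow_le_one₀ hb.1 hb.2)

theorem choose_mul_succ_sq_le (j k : ℕ) :
    (j + k + 1).choose k * (j + 1) ^ 2 ≤ (j + k + 3).choose (k + 2) * ((k + 1) * (k + 2)) := by
  have hlower := Nat.add_one_mul_choose_eq (j + k + 1) k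
  have hupper := Nat.add_one_mul_choose_eq (j + k + 2) (k + 1)
  calc (j + k + 1).choose k * (j + 1) ^ 2
      ≤ (j + k + 1).choose k * ((j + k + 2) * (j + k + 3)) := by gcongr; nlinarith
    _ = (j + k + 3) * ((j + k + 1 + 1) * (j + k + 1).choose k) := by ring
    _ = ((j + k + 2 + 1) * (j + k + 2).choose (k + 1)) * (k + 1) := by rw [hlower]; ring
    _ = _ := by rw [hupper]; ring

end GrowthRate

namespace PlanarTree

section Asymptotics

open Filter Topology Finset

variable {q b : ℝ}

theorem mul_forestWeight_le (hq : q ∈ Set.Ioo (0 : ℝ) 1) (K N : ℕ) :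
    q * forestWeight q K N ≤ forestWeight q 1 (N + 1) := by
  rw [forestWeight_add_self hq le_rfl]
  refine mul_le_mul_of_nonneg_left ?_ hq.1.le
  simp only [Nat.multichoose_one, Nat.cast_one, one_mul]
  rcases lt_or_ge N K with h | h
  · rw [forestWeight_of_lt _ h]
    exact sum_nonneg fun J _ => forestWeight_nonneg hq _ _
  · exact single_le_sum (f := fun J => forestWeight q J N) (fun J _ => forestWeight_nonneg hq _ _)
      (mem_range.2 (Nat.lt_succ_of_le h))

theorem forestWeight_one_pos (hq : q ∈ Set.Ioo (0 : ℝ) 1) {N : ℕ} (hN : 1 ≤ N) :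
    0 < forestWeight q 1 N := by
  induction N, hN using Nat.le_induction with
  | base =>
    rw [← zero_add 1, forestWeight_add_self hq le_rfl]
    simpa [forestWeight_zero_left hq] using hq.1
  | succ N _ ih => exact (mul_pos hq.1 ih).trans_le (mul_forestWeight_le hq 1 N)

theorem forestWeight_one_le_branchWeight (hq : q ∈ Set.Ioo (0 : ℝ) 1) (hb : 0 ≤ b) {N : ℕ}
    (hN : 1 ≤ N) : forestWeight q 1 N ≤ branchWeight q b N := by
  simpa only [pow_zero, one_mul, zero_add, branchWeight] using
    single_le_sum (f := fun J => b ^ J * forestWeight q (J + 1) N)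
      (fun J _ => mul_nonneg (pow_nonneg hb J) (forestWeight_nonneg hq _ _)) (mem_range.2 hN)

theorem branchWeight_le_branchWeight_one (hq : q ∈ Set.Ioo (0 : ℝ) 1) (hb : b ∈ Set.Icc (0 : ℝ) 1)
    (N : ℕ) : branchWeight q b N ≤ branchWeight q 1 N :=
  sum_le_sum fun J _ =>
    mul_le_mul_of_nonneg_right (pow_le_pow_left₀ hb.1 hb.2 J) (forestWeight_nonneg hq _ _)

theorem isLogConvex_branchWeight_succ (hq : q ∈ Set.Ioo (0 : ℝ) 1) (hb : 0 < b) :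
    IsLogConvex fun n => branchWeight q b (n + 1) where
  pos n := (forestWeight_one_pos hq (by omega)).trans_le
    (forestWeight_one_le_branchWeight hq hb.le (by omega))
  sq_le n := sq_branchWeight_le hq hb n.succ_ne_zero

theorem branchWeight_succ_le_mul_pow (hq : q ∈ Set.Ioo (0 : ℝ) 1) (hb : b ∈ Set.Icc (0 : ℝ) 1)
    (n : ℕ) : branchWeight q b (n + 1) ≤ 8 / q * 4 ^ n := by
  rw [div_mul_eq_mul_div, le_div_iff₀' hq.1]
  calc q * branchWeight q b (n + 1) ≤ q * branchWeight q 1 (n + 1) :=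
        mul_le_mul_of_nonneg_left (branchWeight_le_branchWeight_one hq hb _) hq.1.le
    _ = forestWeight q 1 (n + 1 + 1) := mul_branchWeight_one hq n.succ_ne_zero
    _ ≤ 4 ^ (n + 1 + 1) / 2 ^ 1 := forestWeight_le hq 1 _
    _ = 8 * 4 ^ n := by ring

theorem bddAbove_branchWeight_ratio (hq : q ∈ Set.Ioo (0 : ℝ) 1) (hb : b ∈ Set.Ioc (0 : ℝ) 1) :
    BddAbove (Set.range fun n => branchWeight q b (n + 1 + 1) / branchWeight q b (n + 1)) :=
  (isLogConvex_branchWeight_succ hq hb.1).bddAbove_ratio four_pos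
    (branchWeight_succ_le_mul_pow hq (Set.Ioc_subset_Icc_self hb))

/-- The growth rate, in the number of edges, of the weights of forests with a fixed number of
trees. -/
noncomputable def forestGrowth (q : ℝ) : ℝ :=
  growthRate fun n => branchWeight q 1 (n + 1)

theorem forestGrowth_pos (hq : q ∈ Set.Ioo (0 : ℝ) 1) : 0 < forestGrowth q :=
  (isLogConvex_branchWeight_succ hq one_pos).growthRate_pos
    (bddAbove_branchWeight_ratio hq ⟨one_pos, le_rfl⟩)

theorem forestGrowth_le_four (hq : q ∈ Set.Ioo (0 : ℝ) 1) : forestGrowth q ≤ 4 :=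
  (isLogConvex_branchWeight_succ hq one_pos).growthRate_le four_pos
    (branchWeight_succ_le_mul_pow hq ⟨zero_le_one, le_rfl⟩)

theorem tendsto_forestWeight_one_ratio (hq : q ∈ Set.Ioo (0 : ℝ) 1) :
    Tendsto (fun N => forestWeight q 1 (N + 1) / forestWeight q 1 N) atTop
      (𝓝 (forestGrowth q)) := by
  rw [← tendsto_add_atTop_iff_nat 2]
  refine ((isLogConvex_branchWeight_succ hq one_pos).tendsto_ratio
    (bddAbove_branchWeight_ratio hq ⟨one_pos, le_rfl⟩)).congr fun n => ?_
  rw [← mul_branchWeight_one hq n.succ_ne_zero, ← mul_branchWeight_one hq (n + 1).succ_ne_zero,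
    mul_div_mul_left _ _ hq.1.ne']

theorem forestWeight_one_succ_le (hq : q ∈ Set.Ioo (0 : ℝ) 1) {N : ℕ} (hN : 2 ≤ N) :
    forestWeight q 1 (N + 1) ≤ forestGrowth q * forestWeight q 1 N := by
  obtain ⟨n, rfl⟩ := Nat.exists_eq_add_of_le' hN
  rw [← mul_branchWeight_one hq n.succ_ne_zero, ← mul_branchWeight_one hq (n + 1).succ_ne_zero,
    mul_left_comm]
  exact mul_le_mul_of_nonneg_left ((isLogConvex_branchWeight_succ hq one_pos).succ_le_growthRate_mul
    (bddAbove_branchWeight_ratio hq ⟨one_pos, le_rfl⟩) n) hq.1.le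

theorem forestWeight_one_add_le (hq : q ∈ Set.Ioo (0 : ℝ) 1) {N : ℕ} (hN : 2 ≤ N) (i : ℕ) :
    forestWeight q 1 (N + i) ≤ forestGrowth q ^ i * forestWeight q 1 N :=
  le_geom (u := fun i => forestWeight q 1 (N + i)) (forestGrowth_pos hq).le i fun k _ =>
    forestWeight_one_succ_le hq (N := N + k) (by omega)

theorem growthRate_branchWeight (hq : q ∈ Set.Ioo (0 : ℝ) 1) (hb : b ∈ Set.Ioc (0 : ℝ) 1) :
    growthRate (fun n => branchWeight q b (n + 1)) = forestGrowth q := by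
  have hconvex := isLogConvex_branchWeight_succ hq hb.1
  have hbdd := bddAbove_branchWeight_ratio hq hb
  set A := growthRate fun n => branchWeight q b (n + 1)
  refine le_antisymm ?_ ?_
  · exact hconvex.growthRate_le (forestGrowth_pos hq) fun n =>
      (branchWeight_le_branchWeight_one hq (Set.Ioc_subset_Icc_self hb) _).trans
        ((isLogConvex_branchWeight_succ hq one_pos).le_mul_growthRate_pow
          (bddAbove_branchWeight_ratio hq ⟨one_pos, le_rfl⟩) n)
  · refine (isLogConvex_branchWeight_succ hq one_pos).growthRate_le
      (M := branchWeight q b 1 * A / q) (hconvex.growthRate_pos hbdd) fun n => ?_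
    rw [div_mul_eq_mul_div, le_div_iff₀' hq.1]
    calc q * branchWeight q 1 (n + 1) = forestWeight q 1 (n + 1 + 1) :=
          mul_branchWeight_one hq n.succ_ne_zero
      _ ≤ branchWeight q b (n + 1 + 1) := forestWeight_one_le_branchWeight hq hb.1.le (by omega)
      _ ≤ branchWeight q b 1 * A ^ (n + 1) := hconvex.le_mul_growthRate_pow hbdd (n + 1)
      _ = branchWeight q b 1 * A * A ^ n := by ring

theorem tendsto_branchWeight_ratio (hq : q ∈ Set.Ioo (0 : ℝ) 1) (hb : b ∈ Set.Ioc (0 : ℝ) 1) :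
    Tendsto (fun N => branchWeight q b (N + 1) / branchWeight q b N) atTop
      (𝓝 (forestGrowth q)) := by
  rw [← tendsto_add_atTop_iff_nat 1, ← growthRate_branchWeight hq hb]
  exact (isLogConvex_branchWeight_succ hq hb.1).tendsto_ratio (bddAbove_branchWeight_ratio hq hb)

/-- The weight of the forests of `K` trees with `N` edges, relative to the trees with `N` edges. -/
noncomputable def forestRatio (q : ℝ) (K N : ℕ) : ℝ :=
  forestWeight q K N / forestWeight q 1 N

theorem forestRatio_nonneg (hq : q ∈ Set.Ioo (0 : ℝ) 1) (K N : ℕ) : 0 ≤ forestRatio q K N :=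
  div_nonneg (forestWeight_nonneg hq _ _) (forestWeight_nonneg hq _ _)

theorem forestRatio_one (hq : q ∈ Set.Ioo (0 : ℝ) 1) {N : ℕ} (hN : 1 ≤ N) :
    forestRatio q 1 N = 1 :=
  div_self (forestWeight_one_pos hq hN).ne'

theorem hasSum_choose_mul_forestRatio (hq : q ∈ Set.Ioo (0 : ℝ) 1) (k : ℕ) {N : ℕ} (hN : N ≠ 0) :
    HasSum (fun j => ((j + k + 1).choose k : ℝ) * forestRatio q (j + 1) N)
      (forestWeight q (k + 1) (N + (k + 1)) / (q * forestWeight q 1 N)) := by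
  rw [forestWeight_add_self hq (by omega), mul_div_mul_left _ _ hq.1.ne', sum_range_succ',
    forestWeight_zero_left hq, if_neg hN, mul_zero, add_zero, sum_div]
  have hterm : ∀ j, ((j + k + 1).choose k : ℝ) * forestRatio q (j + 1) N =
      (Nat.multichoose (k + 1) (j + 1) : ℝ) * forestWeight q (j + 1) N / forestWeight q 1 N := by
    intro j
    rw [multichoose_succ_left, show j + 1 + k = j + k + 1 by ring, forestRatio, mul_div_assoc]
  simp_rw [hterm]
  exact hasSum_sum_of_ne_finset_zero fun j hj => by
    rw [forestWeight_of_lt _ (by simpa using hj), mul_zero, zero_div]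

theorem hasSum_pow_mul_forestRatio (q b : ℝ) (N : ℕ) :
    HasSum (fun j => b ^ j * forestRatio q (j + 1) N)
      (branchWeight q b N / forestWeight q 1 N) := by
  rw [branchWeight, sum_div]
  simp_rw [mul_div_assoc]
  exact hasSum_sum_of_ne_finset_zero fun j hj => by
    rw [forestRatio, forestWeight_of_lt _ (by simp at hj; omega), zero_div, mul_zero]

theorem choose_mul_forestRatio_le (hq : q ∈ Set.Ioo (0 : ℝ) 1) {N : ℕ} (hN : 2 ≤ N) (j k : ℕ) :
    ((j + k + 1).choose k : ℝ) * forestRatio q (j + 1) N ≤ forestGrowth q ^ (k + 2) / q ^ 2 := by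
  have hterm := le_hasSum (hasSum_choose_mul_forestRatio hq k (N := N) (by omega)) j fun i _ =>
    mul_nonneg (Nat.cast_nonneg _) (forestRatio_nonneg hq _ _)
  have hpos := forestWeight_one_pos hq (N := N) (by omega)
  have hq0 := hq.1
  refine hterm.trans ?_
  rw [div_le_div_iff₀ (by positivity) (by positivity)]
  calc forestWeight q (k + 1) (N + (k + 1)) * q ^ 2
      = q * forestWeight q (k + 1) (N + (k + 1)) * q := by ring
    _ ≤ forestWeight q 1 (N + (k + 2)) * q :=
      mul_le_mul_of_nonneg_right (mul_forestWeight_le hq _ _) hq0.le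
    _ ≤ forestGrowth q ^ (k + 2) * forestWeight q 1 N * q :=
      mul_le_mul_of_nonneg_right (forestWeight_one_add_le hq hN _) hq0.le
    _ = _ := by ring

theorem exists_summable_choose_mul_forestRatio_le (hq : q ∈ Set.Ioo (0 : ℝ) 1) (k : ℕ) :
    ∃ B : ℕ → ℝ, Summable B ∧
      ∀ N ≥ 2, ∀ j, ((j + k + 1).choose k : ℝ) * forestRatio q (j + 1) N ≤ B j := by
  refine ⟨fun j => forestGrowth q ^ (k + 4) / q ^ 2 * ((k + 1) * (k + 2)) *
    (1 / ((j + 1 : ℕ) : ℝ) ^ 2),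
    ((summable_nat_add_iff 1).2 (Real.summable_one_div_nat_pow.2 one_lt_two)).mul_left _,
    fun N hN j => ?_⟩
  have hchoose : ((j + k + 1).choose k : ℝ) * ((j + 1 : ℕ) : ℝ) ^ 2 ≤
      ((j + (k + 2) + 1).choose (k + 2) : ℝ) * ((k + 1) * (k + 2)) := by
    exact_mod_cast choose_mul_succ_sq_le j k
  beta_reduce
  rw [mul_one_div, le_div_iff₀ (by positivity)]
  calc _ = ((j + k + 1).choose k : ℝ) * ((j + 1 : ℕ) : ℝ) ^ 2 * forestRatio q (j + 1) N := by ring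
    _ ≤ ((j + (k + 2) + 1).choose (k + 2) : ℝ) * ((k + 1) * (k + 2)) * forestRatio q (j + 1) N :=
      mul_le_mul_of_nonneg_right hchoose (forestRatio_nonneg hq _ _)
    _ = ((j + (k + 2) + 1).choose (k + 2) : ℝ) * forestRatio q (j + 1) N *
        ((k + 1) * (k + 2)) := by ring
    _ ≤ _ := mul_le_mul_of_nonneg_right (choose_mul_forestRatio_le hq hN j (k + 2)) (by positivity)

theorem exists_tendsto_forestRatio (hq : q ∈ Set.Ioo (0 : ℝ) 1) {U : Ultrafilter ℕ}
    (hU : (U : Filter ℕ) ≤ atTop) :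
    ∃ F : ℕ → ℝ, ∀ j, Tendsto (forestRatio q (j + 1)) U (𝓝 (F j)) := by
  obtain ⟨B, -, hB⟩ := exists_summable_choose_mul_forestRatio_le hq 0
  refine Classical.skolem.1 fun j => exists_tendsto_ultrafilter U (M := B j) (hU ?_)
  filter_upwards [eventually_ge_atTop 2] with N hN
  have hle := hB N hN j
  rw [Nat.choose_zero_right, Nat.cast_one, one_mul] at hle
  exact ⟨forestRatio_nonneg hq _ _, hle⟩

section Limit

variable {l : Filter ℕ} {F : ℕ → ℝ}

theorem summable_choose_mul_of_tendsto_forestRatio [l.NeBot] (hq : q ∈ Set.Ioo (0 : ℝ) 1)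
    (hl : l ≤ atTop) (hF : ∀ j, Tendsto (forestRatio q (j + 1)) l (𝓝 (F j))) (k : ℕ) :
    Summable fun j => ((j + k + 1).choose k : ℝ) * F j := by
  obtain ⟨B, hBsum, hB⟩ := exists_summable_choose_mul_forestRatio_le hq k
  have hF0 : ∀ j, 0 ≤ F j := fun j => ge_of_tendsto' (hF j) fun N => forestRatio_nonneg hq _ _
  exact Summable.of_nonneg_of_le (fun j => mul_nonneg (Nat.cast_nonneg _) (hF0 j))
    (fun j => le_of_tendsto ((hF j).const_mul _) (hl <| by
      filter_upwards [eventually_ge_atTop 2] with N hN using hB N hN j)) hBsum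

theorem tendsto_tsum_mul_forestRatio (hq : q ∈ Set.Ioo (0 : ℝ) 1) (hl : l ≤ atTop)
    (hF : ∀ j, Tendsto (forestRatio q (j + 1)) l (𝓝 (F j))) {w : ℕ → ℝ} (k : ℕ)
    (hw0 : ∀ j, 0 ≤ w j) (hw : ∀ j, w j ≤ (j + k + 1).choose k) :
    Tendsto (fun N => ∑' j, w j * forestRatio q (j + 1) N) l (𝓝 (∑' j, w j * F j)) := by
  obtain ⟨B, hBsum, hB⟩ := exists_summable_choose_mul_forestRatio_le hq k
  refine tendsto_tsum_of_dominated_convergence hBsum (fun j => (hF j).const_mul _) (hl ?_)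
  filter_upwards [eventually_ge_atTop 2] with N hN j
  rw [Real.norm_of_nonneg (mul_nonneg (hw0 j) (forestRatio_nonneg hq _ _))]
  exact (mul_le_mul_of_nonneg_right (hw j) (forestRatio_nonneg hq _ _)).trans (hB N hN j)

theorem tendsto_branchWeight_div_forestWeight (hq : q ∈ Set.Ioo (0 : ℝ) 1) (hl : l ≤ atTop)
    (hF : ∀ j, Tendsto (forestRatio q (j + 1)) l (𝓝 (F j))) (hb : b ∈ Set.Icc (0 : ℝ) 1) :
    Tendsto (fun N => branchWeight q b N / forestWeight q 1 N) l (𝓝 (∑' j, b ^ j * F j)) := by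
  simp_rw [← fun N => (hasSum_pow_mul_forestRatio q b N).tsum_eq]
  exact tendsto_tsum_mul_forestRatio hq hl hF 0 (fun j => pow_nonneg hb.1 j)
    fun j => by simpa using pow_le_one₀ hb.1 hb.2

end Limit

variable {U : Ultrafilter ℕ} {F : ℕ → ℝ}

-- Both `branchWeight q b` and `forestWeight q 1` gain the factor `forestGrowth q` per edge, so the
-- shift does not change the generating function of the limits.
theorem tendsto_forestRatio_map_succ (hq : q ∈ Set.Ioo (0 : ℝ) 1) (hU : (U : Filter ℕ) ≤ atTop)
    (hF : ∀ j, Tendsto (forestRatio q (j + 1)) U (𝓝 (F j))) (j : ℕ) :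
    Tendsto (forestRatio q (j + 1)) (U.map Nat.succ) (𝓝 (F j)) := by
  have hV : ((U.map Nat.succ : Ultrafilter ℕ) : Filter ℕ) ≤ atTop :=
    (map_mono hU).trans (tendsto_add_atTop_nat 1)
  obtain ⟨G, hG⟩ := exists_tendsto_forestRatio hq hV
  have hsummable : ∀ {V : Ultrafilter ℕ} {F : ℕ → ℝ}, (V : Filter ℕ) ≤ atTop →
      (∀ j, Tendsto (forestRatio q (j + 1)) V (𝓝 (F j))) → Summable F := fun hV hF => by
    simpa using summable_choose_mul_of_tendsto_forestRatio hq hV hF 0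
  have hFs := hsummable hU hF
  have hGs := hsummable hV hG
  suffices hGF : G - F = 0 by
    rw [← sub_eq_zero.1 hGF]
    exact hG j
  refine eq_zero_of_tsum_pow_mul_eq_zero (hGs.sub hFs) fun b hb => ?_
  have hb' := Set.Ioo_subset_Icc_self hb
  have hL := (forestGrowth_pos hq).ne'
  have hlimF := tendsto_branchWeight_div_forestWeight hq hU hF hb'
  have hlimG : Tendsto (fun N => branchWeight q b (N + 1) / forestWeight q 1 (N + 1)) U
      (𝓝 (∑' j, b ^ j * G j)) := tendsto_map'_iff.1
        (tendsto_branchWeight_div_forestWeight hq hV hG hb')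
  have hratio := (((tendsto_branchWeight_ratio hq (Set.Ioo_subset_Ioc_self hb)).div
    (tendsto_forestWeight_one_ratio hq) hL).mono_left hU).mul hlimF
  rw [div_self hL, one_mul] at hratio
  have hshift : Tendsto (fun N => branchWeight q b (N + 1) / forestWeight q 1 (N + 1)) U
      (𝓝 (∑' j, b ^ j * F j)) := by
    refine hratio.congr' (hU ?_)
    filter_upwards [eventually_ge_atTop 1] with N hN
    have hpos := forestWeight_one_pos hq hN
    have hbranch := hpos.trans_le (forestWeight_one_le_branchWeight hq hb.1.le hN)
    simp only [Pi.div_apply]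
    field_simp
  simp only [Pi.sub_apply, mul_sub]
  rw [Summable.tsum_sub, tendsto_nhds_unique hlimG hshift, sub_self]
  · exact summable_pow_mul hb' hGs
  · exact summable_pow_mul hb' hFs

theorem tendsto_forestRatio_add (hq : q ∈ Set.Ioo (0 : ℝ) 1) (hU : (U : Filter ℕ) ≤ atTop)
    (hF : ∀ j, Tendsto (forestRatio q (j + 1)) U (𝓝 (F j))) (j i : ℕ) :
    Tendsto (fun N => forestRatio q (j + 1) (N + i)) U (𝓝 (F j)) := by
  induction i generalizing U with
  | zero => exact hF j
  | succ i ih =>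
    have hshift := ih (U := U.map Nat.succ) ((map_mono hU).trans (tendsto_add_atTop_nat 1))
      (tendsto_forestRatio_map_succ hq hU hF)
    rw [Ultrafilter.coe_map, tendsto_map'_iff] at hshift
    exact hshift.congr fun N => by rw [Function.comp_apply, Nat.succ_add_eq_add_succ]

theorem isBranchingSolution_of_tendsto (hq : q ∈ Set.Ioo (0 : ℝ) 1) (hU : (U : Filter ℕ) ≤ atTop)
    (hF : ∀ j, Tendsto (forestRatio q (j + 1)) U (𝓝 (F j))) :
    IsBranchingSolution q (forestGrowth q) F where
  q_pos := hq.1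
  L_pos := forestGrowth_pos hq
  nonneg j := ge_of_tendsto' (hF j) fun _ => forestRatio_nonneg hq _ _
  zero := by
    refine tendsto_nhds_unique (hF 0) (tendsto_const_nhds.congr' (hU ?_))
    filter_upwards [eventually_ge_atTop 1] with N hN using (forestRatio_one hq hN).symm
  hasSum k := by
    have hpos : ∀ᶠ N in atTop, 0 < forestWeight q 1 N := by
      filter_upwards [eventually_ge_atTop 1] with N hN using forestWeight_one_pos hq hN
    have hsum := tendsto_tsum_mul_forestRatio hq hU hF k
      (w := fun j => ((j + k + 1).choose k : ℝ)) (fun _ => Nat.cast_nonneg _) fun _ => le_rfl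
    have hvalue : Tendsto (fun N => ∑' j, ((j + k + 1).choose k : ℝ) * forestRatio q (j + 1) N) U
        (𝓝 (forestGrowth q ^ (k + 1) / q * F k)) := by
      refine (((tendsto_ratio_add hpos (tendsto_forestWeight_one_ratio hq) (k + 1)).mono_left
        hU).div_const q |>.mul (tendsto_forestRatio_add hq hU hF k (k + 1))).congr' (hU ?_)
      filter_upwards [eventually_ge_atTop 1] with N hN
      have hden := forestWeight_one_pos hq (N := N + (k + 1)) (by omega)
      rw [(hasSum_choose_mul_forestRatio hq k (by omega)).tsum_eq, forestRatio]
      field_simp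
    rw [← tendsto_nhds_unique hsum hvalue]
    exact (summable_choose_mul_of_tendsto_forestRatio hq hU hF k).hasSum

theorem forestGrowth_eq_four (hq : q ∈ Set.Ioo (0 : ℝ) 1) : forestGrowth q = 4 := by
  have hU : ((Ultrafilter.of atTop : Ultrafilter ℕ) : Filter ℕ) ≤ atTop := Ultrafilter.of_le atTop
  obtain ⟨F, hF⟩ := exists_tendsto_forestRatio hq hU
  exact (forestGrowth_le_four hq).antisymm (isBranchingSolution_of_tendsto hq hU hF).four_le

variable {μ : ℝ}

theorem exp_neg_mem_Ioo (hμ : 0 < μ) : Real.exp (-μ) ∈ Set.Ioo (0 : ℝ) 1 :=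
  ⟨Real.exp_pos _, Real.exp_lt_one_iff.2 (neg_neg_of_pos hμ)⟩

theorem tendsto_forestRatio (hμ : 0 < μ) (K : ℕ) :
    Tendsto (forestRatio (Real.exp (-μ)) K) atTop (𝓝 (limitWeight μ K)) := by
  have hq := exp_neg_mem_Ioo hμ
  rcases K with _ | K
  · rw [limitWeight_zero]
    refine tendsto_const_nhds.congr' ?_
    filter_upwards [eventually_ne_atTop 0] with N hN
    rw [forestRatio, forestWeight_zero_left hq, if_neg hN, zero_div]
  · rw [tendsto_iff_ultrafilter]
    intro U hU
    obtain ⟨F, hF⟩ := exists_tendsto_forestRatio hq hU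
    have hsol := isBranchingSolution_of_tendsto hq hU hF
    rw [forestGrowth_eq_four hq] at hsol
    have hlim := hF K
    rwa [hsol.unique (isBranchingSolution_limitWeight hμ.le)] at hlim

theorem tendsto_forestWeight_div (hμ : 0 < μ) (K a c : ℕ) :
    Tendsto (fun N => forestWeight (Real.exp (-μ)) K (N + a) /
      forestWeight (Real.exp (-μ)) 1 (N + c)) atTop (𝓝 (limitWeight μ K * 4 ^ a / 4 ^ c)) := by
  have hq := exp_neg_mem_Ioo hμ
  have hpos : ∀ᶠ N in atTop, 0 < forestWeight (Real.exp (-μ)) 1 N := by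
    filter_upwards [eventually_ge_atTop 1] with N hN using forestWeight_one_pos hq hN
  have hratio := tendsto_forestWeight_one_ratio hq
  rw [forestGrowth_eq_four hq] at hratio
  refine ((((tendsto_add_atTop_iff_nat a).2 (tendsto_forestRatio hμ K)).mul
    (tendsto_ratio_add hpos hratio a)).div (tendsto_ratio_add hpos hratio c)
      (by positivity)).congr' ?_
  filter_upwards [eventually_ge_atTop 1] with N hN
  have hN0 := forestWeight_one_pos hq hN
  have hNa := forestWeight_one_pos hq (N := N + a) (by omega)
  have hNc := forestWeight_one_pos hq (N := N + c) (by omega)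
  simp only [forestRatio, Pi.div_apply]
  field_simp

end Asymptotics

end PlanarTree

section MultisetSum

variable {α : Type*}

theorem tsum_multiset_card [Fintype α] (φ : ℕ → ENNReal) :
    ∑' m : Multiset α, φ m.card = ∑' J, ((Fintype.card α).multichoose J : ENNReal) * φ J := by
  classical
  rw [← (Equiv.sigmaFiberEquiv (Multiset.card : Multiset α → ℕ)).tsum_eq, ENNReal.tsum_sigma']
  refine tsum_congr fun J => ?_
  calc ∑' m : {m : Multiset α // m.card = J}, φ m.1.card = ∑' _ : Sym α J, φ J :=
        tsum_congr fun m => congrArg φ m.2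
    _ = ((Fintype.card α).multichoose J : ENNReal) * φ J := by
        rw [tsum_fintype, Finset.sum_const, Finset.card_univ, Sym.card_sym_eq_multichoose,
          nsmul_eq_mul]

/-- A multiset is determined by its elements with a given property and those without it. -/
def multisetSubtypeProdEquiv (p : α → Prop) [DecidablePred p] :
    Multiset {x // p x} × Multiset {x // ¬ p x} ≃ Multiset α where
  toFun ab := ab.1.map Subtype.val + ab.2.map Subtype.val
  invFun m := (m.filterMap fun x => if h : p x then some ⟨x, h⟩ else none,
    m.filterMap fun x => if h : p x then none else some ⟨x, h⟩)
  left_inv := by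
    rintro ⟨a, b⟩
    induction a using Multiset.induction with
    | empty =>
      induction b using Multiset.induction with
      | empty => simp
      | cons y b ih => simpa [y.2] using ih
    | cons x a ih => simpa [x.2] using ih
  right_inv m := by
    induction m using Multiset.induction with
    | empty => simp
    | cons x m ih =>
      by_cases h : p x
      · simpa [h] using ih
      · simpa [h] using ih

theorem tsum_multiset_countP [Fintype α] (p : α → Prop) [DecidablePred p]
    (φ : ℕ → ℕ → ENNReal) :
    ∑' m : Multiset α, φ (m.countP p) (m.countP fun x => ¬ p x) =
      ∑' J, ((Fintype.card {x // p x}).multichoose J : ENNReal) *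
        ∑' J', ((Fintype.card {x // ¬ p x}).multichoose J' : ENNReal) * φ J J' := by
  rw [← (multisetSubtypeProdEquiv p).tsum_eq, ENNReal.tsum_prod', ← tsum_multiset_card]
  refine tsum_congr fun a => ?_
  rw [← tsum_multiset_card]
  refine tsum_congr fun b => ?_
  have ha : (a.map Subtype.val).countP p = a.card := by
    rw [Multiset.countP_map, Multiset.filter_eq_self.2 fun x _ => x.2]
  have ha' : (a.map Subtype.val).countP (fun x => ¬ p x) = 0 := by
    rw [Multiset.countP_map, Multiset.filter_eq_nil.2 fun x _ => not_not.2 x.2, Multiset.card_zero]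
  have hb : (b.map Subtype.val).countP p = 0 := by
    rw [Multiset.countP_map, Multiset.filter_eq_nil.2 fun x _ => x.2, Multiset.card_zero]
  have hb' : (b.map Subtype.val).countP (fun x => ¬ p x) = b.card := by
    rw [Multiset.countP_map, Multiset.filter_eq_self.2 fun x _ => x.2]
  simp only [multisetSubtypeProdEquiv, Equiv.coe_fn_mk, Multiset.countP_add, ha, ha', hb, hb',
    add_zero, zero_add]

end MultisetSum

namespace PlanarTree

section Parents

open Finset

variable {S T : PlanarTree} {r s : ℕ}

theorem gen_eq_zero_of_le (h : r ≤ s) (hr : T.gen r = 0) : T.gen s = 0 := by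
  induction s, h using Nat.le_induction with
  | base => exact hr
  | succ s _ ih =>
    by_contra hs
    exact (T.parent_lt s 0 (Nat.pos_of_ne_zero hs)).ne_bot ih

/-- The parents, with multiplicities, of the vertices at height `r + 1`. As parent maps are order
preserving, a tree is determined by its multisets of parents. -/
def parents (T : PlanarTree) (r : ℕ) : Multiset ℕ :=
  (Multiset.range (T.gen (r + 1))).map (T.parent r)

theorem card_parents (T : PlanarTree) (r : ℕ) : (T.parents r).card = T.gen (r + 1) := by
  rw [parents, Multiset.card_map, Multiset.card_range]

theorem lt_of_mem_parents {x : ℕ} (h : x ∈ T.parents r) : x < T.gen r := by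
  obtain ⟨i, hi, rfl⟩ := Multiset.mem_map.1 h
  exact T.parent_lt r i (Multiset.mem_range.1 hi)

theorem parents_zero (T : PlanarTree) : T.parents 0 = {0} := by
  obtain ⟨x, hx⟩ := Multiset.card_eq_one.1 ((T.card_parents 0).trans T.gen_one)
  have hlt := lt_of_mem_parents (hx ▸ Multiset.mem_singleton_self x)
  rw [T.gen_zero, Nat.lt_one_iff] at hlt
  rw [hx, hlt]

theorem sort_parents (T : PlanarTree) (r : ℕ) :
    (T.parents r).sort = (List.range (T.gen (r + 1))).map (T.parent r) := by
  have hsorted : ((List.range (T.gen (r + 1))).map (T.parent r)).Pairwise (· ≤ ·) := by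
    rw [List.pairwise_map]
    exact List.pairwise_lt_range.imp_of_mem fun {i j} _ hj hij =>
      T.parent_mono r i j hij.le (List.mem_range.1 hj)
  calc (T.parents r).sort (· ≤ ·)
      = ((List.range (T.gen (r + 1))).map (T.parent r)).mergeSort (· ≤ ·) :=
        Multiset.coe_sort ((List.range (T.gen (r + 1))).map (T.parent r)) (· ≤ ·)
    _ = _ := List.mergeSort_of_pairwise (by simpa using hsorted)

theorem parent_eq_getD (T : PlanarTree) (r i : ℕ) :
    T.parent r i = ((T.parents r).sort).getD i 0 := by
  rw [sort_parents]
  rcases lt_or_ge i (T.gen (r + 1)) with h | h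
  · rw [List.getD_eq_getElem _ _ (by simpa using h), List.getElem_map, List.getElem_range]
  · rw [List.getD_eq_default _ _ (by simpa using h), T.parent_out r i h]

theorem ext_parents (h : ∀ r, S.parents r = T.parents r) : S = T := by
  ext r i
  · rcases r with _ | r
    · rw [S.gen_zero, T.gen_zero]
    · rw [← card_parents, ← card_parents, h]
  · rw [parent_eq_getD, parent_eq_getD, h]

/-- The multisets left of `M` after the first one is replaced by `{0}` and then, inductively, the
numbers which are not positions of vertices of the previous generation are discarded. -/
def admissible (M : ℕ → Multiset ℕ) : ℕ → Multiset ℕ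
  | 0 => {0}
  | s + 1 => (M (s + 1)).filter (· < (admissible M s).card)

/-- The tree whose multisets of parents are given by `M`, as far as they are `admissible`. -/
def ofParents (M : ℕ → Multiset ℕ) : PlanarTree where
  gen
    | 0 => 1
    | s + 1 => (admissible M s).card
  parent s i := ((admissible M s).sort).getD i 0
  gen_zero := rfl
  gen_one := rfl
  parent_lt s i h := by
    have hi : i < ((admissible M s).sort).length := by simpa using h
    rw [List.getD_eq_getElem _ _ hi]
    have hmem := (Multiset.mem_sort (· ≤ ·)).1 (List.getElem_mem hi)
    rcases s with _ | s
    · exact (Multiset.mem_singleton.1 hmem).trans_lt Nat.zero_lt_one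
    · exact (Multiset.mem_filter.1 hmem).2
  parent_mono s i j hij h := by
    have hj : j < ((admissible M s).sort).length := by simpa using h
    rw [List.getD_eq_getElem _ _ hj, List.getD_eq_getElem _ _ (hij.trans_lt hj)]
    exact (Multiset.pairwise_sort _ (· ≤ ·)).rel_get_of_le (a := ⟨i, hij.trans_lt hj⟩)
      (b := ⟨j, hj⟩) hij
  parent_out s i h := List.getD_eq_default _ _ (by simpa using h)

theorem parents_ofParents (M : ℕ → Multiset ℕ) (s : ℕ) :
    (ofParents M).parents s = admissible M s := by
  have hlist : (List.range (admissible M s).card).map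
      (fun i => ((admissible M s).sort).getD i 0) = (admissible M s).sort := by
    refine List.ext_getElem (by simp) fun i _ hi => ?_
    rw [List.getElem_map, List.getElem_range, List.getD_eq_getElem _ _ hi]
  calc (ofParents M).parents s = ((List.range (admissible M s).card).map
          (fun i => ((admissible M s).sort).getD i 0) : Multiset ℕ) := rfl
    _ = _ := by rw [hlist, Multiset.sort_eq]

theorem admissible_eq_self {M : ℕ → Multiset ℕ} (h0 : M 0 = {0})
    (h : ∀ s, ∀ x ∈ M (s + 1), x < (M s).card) : admissible M = M := by
  funext s
  induction s with
  | zero => exact h0.symm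
  | succ s ih =>
    rw [admissible, ih, Multiset.filter_eq_self]
    exact h s

instance : Nonempty PlanarTree := ⟨ofParents fun _ => 0⟩

end Parents

section Cylinders

open Finset

variable {S T : PlanarTree} {r s : ℕ}

/-- The set of the trees that agree with `S` up to height `r`. -/
def cyl (S : PlanarTree) (r : ℕ) : Set PlanarTree :=
  {T | ∀ s < r, T.parents s = S.parents s}

theorem mem_cyl_self (S : PlanarTree) (r : ℕ) : S ∈ cyl S r := fun _ _ => rfl

theorem cyl_eq_of_mem (h : T ∈ cyl S r) : cyl T r = cyl S r :=
  Set.ext fun _ => forall₂_congr fun s hs => by rw [h s hs]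

theorem cyl_anti (S : PlanarTree) : Antitone (cyl S) :=
  fun _ _ h _ hT s hs => hT s (hs.trans_le h)

theorem gen_eq_of_mem_cyl (h : T ∈ cyl S r) (hs : s ≤ r) : T.gen s = S.gen s := by
  rcases s with _ | s
  · rw [S.gen_zero, T.gen_zero]
  · rw [← card_parents, ← card_parents, h s hs]

theorem parent_eq_of_mem_cyl (h : T ∈ cyl S r) (hs : s < r) : T.parent s = S.parent s := by
  funext i
  rw [parent_eq_getD, parent_eq_getD, h s hs]

theorem cyl_one (S : PlanarTree) : cyl S 1 = Set.univ :=
  Set.eq_univ_of_forall fun T s hs => by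
    rw [Nat.lt_one_iff.1 hs, parents_zero, parents_zero]

theorem cyl_eq_singleton (h : S.gen r = 0) : cyl S r = {S} := by
  refine Set.eq_singleton_iff_unique_mem.2 ⟨mem_cyl_self S r, fun T hT => ext_parents fun s => ?_⟩
  rcases lt_or_ge s r with hs | hs
  · exact hT s hs
  · have hTr : T.gen r = 0 := (gen_eq_of_mem_cyl hT le_rfl).trans h
    rw [Multiset.card_eq_zero.1 ((T.card_parents s).trans (gen_eq_zero_of_le (by omega) hTr)),
      Multiset.card_eq_zero.1 ((S.card_parents s).trans (gen_eq_zero_of_le (by omega) h))]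

theorem ball_eq_iff_mem_cyl (hr : 1 ≤ r) : T.ball r hr = S.ball r hr ↔ T ∈ cyl S r := by
  rw [ball_eq_iff]
  constructor
  · rintro ⟨hgen, hparent⟩ s hs
    rw [parents, parents, hgen (s + 1) hs]
    exact Multiset.map_congr rfl fun i _ => hparent s hs i
  · exact fun h => ⟨fun s hs => gen_eq_of_mem_cyl h hs,
      fun s hs i => congrFun (parent_eq_of_mem_cyl h hs) i⟩

/-- The tree that agrees with `S` up to height `r` and whose vertices at height `r + 1`, which are
leaves, have the parents `m`. -/
def extend (S : PlanarTree) (r : ℕ) (m : Multiset (Fin (S.gen r))) : PlanarTree :=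
  ofParents fun s => if s < r then S.parents s else if s = r then m.map Fin.val else 0

theorem parents_extend (hr : 1 ≤ r) (m : Multiset (Fin (S.gen r))) (s : ℕ) :
    (S.extend r m).parents s =
      if s < r then S.parents s else if s = r then m.map Fin.val else 0 := by
  rw [extend, parents_ofParents, admissible_eq_self]
  · rw [if_pos (by omega), parents_zero]
  · intro t x hx
    rcases lt_trichotomy (t + 1) r with ht | rfl | ht
    · rw [if_pos ht] at hx
      rw [if_pos (by omega), card_parents]
      exact lt_of_mem_parents hx
    · rw [if_neg (by omega), if_pos rfl] at hx
      rw [if_pos (by omega), card_parents]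
      obtain ⟨i, -, rfl⟩ := Multiset.mem_map.1 hx
      exact i.2
    · rw [if_neg (by omega), if_neg (by omega)] at hx
      exact absurd hx (Multiset.notMem_zero x)

theorem mem_cyl_extend (hr : 1 ≤ r) {m : Multiset (Fin (S.gen r))} :
    T ∈ cyl (S.extend r m) (r + 1) ↔ T ∈ cyl S r ∧ T.parents r = m.map Fin.val := by
  simp only [cyl, Set.mem_ofPred_eq, parents_extend hr, Nat.forall_lt_succ_right, lt_irrefl,
    if_false, if_true]
  exact and_congr_left' (forall₂_congr fun s hs => by rw [if_pos hs])

theorem extend_mem_cyl (hr : 1 ≤ r) (m : Multiset (Fin (S.gen r))) : S.extend r m ∈ cyl S r :=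
  ((mem_cyl_extend hr).1 (mem_cyl_self _ _)).1

theorem parents_extend_self (hr : 1 ≤ r) (m : Multiset (Fin (S.gen r))) :
    (S.extend r m).parents r = m.map Fin.val :=
  ((mem_cyl_extend hr).1 (mem_cyl_self _ _)).2

theorem gen_extend (hr : 1 ≤ r) (m : Multiset (Fin (S.gen r))) :
    (S.extend r m).gen (r + 1) = m.card := by
  rw [← card_parents, parents_extend_self hr, Multiset.card_map]

theorem exists_map_val_eq_parents (T : PlanarTree) (r : ℕ) :
    ∃ m : Multiset (Fin (T.gen r)), m.map Fin.val = T.parents r := by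
  obtain ⟨m, hm⟩ := CanLift.prf (β := Multiset (Fin (T.gen r))) (T.parents r)
    fun _ hx => lt_of_mem_parents hx
  exact ⟨m, hm⟩

theorem cyl_eq_iUnion (S : PlanarTree) (hr : 1 ≤ r) :
    cyl S r = ⋃ m : Multiset (Fin (S.gen r)), cyl (S.extend r m) (r + 1) := by
  ext T
  simp only [Set.mem_iUnion, mem_cyl_extend hr, exists_and_left]
  refine ⟨fun h => ⟨h, ?_⟩, And.left⟩
  rw [← gen_eq_of_mem_cyl h le_rfl]
  obtain ⟨m, hm⟩ := T.exists_map_val_eq_parents r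
  exact ⟨m, hm.symm⟩

theorem pairwise_disjoint_cyl_extend (S : PlanarTree) (hr : 1 ≤ r) :
    Pairwise (Function.onFun Disjoint
      fun m : Multiset (Fin (S.gen r)) => cyl (S.extend r m) (r + 1)) := by
  refine fun m m' hne => Set.disjoint_left.2 fun T h h' => hne ?_
  exact Multiset.map_injective Fin.val_injective
    (((mem_cyl_extend hr).1 h).2.symm.trans ((mem_cyl_extend hr).1 h').2)

end Cylinders

section Topology

open MeasureTheory

variable {r : ℕ}

theorem isOpen_cyl (S : PlanarTree) (r : ℕ) : IsOpen (cyl S r) := by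
  refine Metric.isOpen_iff.2 fun T hT => ⟨1 / ((r + 1 : ℕ) : ℝ), by positivity, fun T' hT' => ?_⟩
  obtain ⟨s, hs, hball, hlt⟩ := exists_ball_eq_of_sInf_lt (Metric.mem_ball.1 hT')
  have hrs : r + 1 < s := by
    exact_mod_cast (one_div_lt_one_div (by exact_mod_cast hs) (by positivity)).1 hlt
  rw [← cyl_eq_of_mem hT]
  exact cyl_anti T (by omega) ((ball_eq_iff_mem_cyl hs).1 hball)

theorem measurableSet_cyl (S : PlanarTree) (r : ℕ) : MeasurableSet (cyl S r) :=
  (isOpen_cyl S r).measurableSet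

theorem isOpen_of_cyl_subset {A : Set PlanarTree} (h : ∀ T ∈ A, cyl T r ⊆ A) : IsOpen A :=
  isOpen_iff_forall_mem_open.2 fun T hT => ⟨cyl T r, h T hT, isOpen_cyl T r, mem_cyl_self T r⟩

theorem measurableSet_of_cyl_subset {A : Set PlanarTree} (h : ∀ T ∈ A, cyl T r ⊆ A) :
    MeasurableSet A :=
  (isOpen_of_cyl_subset h).measurableSet

/-- The union of the cylinders of height `r` contained in `U`. -/
def cylInterior (U : Set PlanarTree) (r : ℕ) : Set PlanarTree := {T | cyl T r ⊆ U}

theorem cylInterior_mono (U : Set PlanarTree) : Monotone (cylInterior U) :=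
  fun _ _ h T hT => (cyl_anti T h).trans hT

theorem iUnion_cylInterior {U : Set PlanarTree} (hU : IsOpen U) : ⋃ r, cylInterior U r = U := by
  refine Set.Subset.antisymm (Set.iUnion_subset fun r T hT => hT (mem_cyl_self T r)) fun T hT => ?_
  obtain ⟨ε, hε, hball⟩ := Metric.isOpen_iff.1 hU T hT
  obtain ⟨n, hn⟩ := exists_nat_one_div_lt hε
  refine Set.mem_iUnion.2 ⟨n + 1, fun T' hT' => hball (Metric.mem_ball.2 ?_)⟩
  exact (sInf_agreeSet_le (r := n + 1) (by omega) ((ball_eq_iff_mem_cyl _).2 hT')).trans_lt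
    (by exact_mod_cast hn)

theorem countable_range_cyl (r : ℕ) : (Set.range fun T => cyl T r).Countable := by
  refine (Set.countable_range fun (l : Fin r → Multiset ℕ) =>
    {T : PlanarTree | ∀ s : Fin r, T.parents s = l s}).mono ?_
  rintro _ ⟨S, rfl⟩
  exact ⟨fun s => S.parents s, Set.ext fun T => Fin.forall_iff⟩

theorem pairwise_disjoint_range_cyl (r : ℕ) : (Set.range fun T => cyl T r).Pairwise Disjoint := by
  rintro _ ⟨S, rfl⟩ _ ⟨S', rfl⟩ hne
  refine Set.disjoint_left.2 fun T hT hT' => hne ?_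
  exact (cyl_eq_of_mem hT).symm.trans (cyl_eq_of_mem hT')

theorem cylInterior_eq_sUnion (U : Set PlanarTree) (r : ℕ) :
    cylInterior U r = ⋃₀ ((fun T => cyl T r) '' cylInterior U r) := by
  refine Set.Subset.antisymm
    (fun T hT => ⟨_, Set.mem_image_of_mem _ hT, mem_cyl_self T r⟩) ?_
  rintro T ⟨_, ⟨S, hS, rfl⟩, hT⟩
  exact (cyl_eq_of_mem hT).trans_subset hS

theorem measurable_of_parents {α : Type*} [MeasurableSpace α] {f : α → PlanarTree}
    (h : ∀ r m, MeasurableSet {a | (f a).parents r = m}) : Measurable f := by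
  refine measurable_of_isOpen fun U hU => ?_
  have hcyl : ∀ S r, MeasurableSet (f ⁻¹' cyl S r) := fun S r => by
    rw [show f ⁻¹' cyl S r = ⋂ s < r, {a | (f a).parents s = S.parents s} by ext; simp [cyl]]
    exact MeasurableSet.iInter fun s => MeasurableSet.iInter fun _ => h s _
  rw [← iUnion_cylInterior hU, Set.preimage_iUnion]
  refine MeasurableSet.iUnion fun r => ?_
  rw [cylInterior_eq_sUnion, Set.preimage_sUnion]
  refine MeasurableSet.biUnion ((countable_range_cyl r).mono (Set.image_subset_range _ _)) ?_
  rintro _ ⟨S, -, rfl⟩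
  exact hcyl S r

variable (ν : Measure PlanarTree)

theorem measure_inter_cyl {A : Set PlanarTree} (hA : MeasurableSet A) (S : PlanarTree)
    (hr : 1 ≤ r) :
    ν (A ∩ cyl S r) = ∑' m : Multiset (Fin (S.gen r)), ν (A ∩ cyl (S.extend r m) (r + 1)) := by
  rw [cyl_eq_iUnion S hr, Set.inter_iUnion]
  exact measure_iUnion (fun m m' h => (pairwise_disjoint_cyl_extend S hr h).mono
    Set.inter_subset_right Set.inter_subset_right) fun m => hA.inter (measurableSet_cyl _ _)

theorem measure_cyl (S : PlanarTree) (hr : 1 ≤ r) :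
    ν (cyl S r) = ∑' m : Multiset (Fin (S.gen r)), ν (cyl (S.extend r m) (r + 1)) := by
  simpa only [Set.univ_inter] using measure_inter_cyl ν MeasurableSet.univ S hr

theorem le_liminf_of_isOpen {νs : ℕ → Measure PlanarTree}
    (h : ∀ S r, Filter.Tendsto (fun N => νs N (cyl S (r + 1))) Filter.atTop
      (nhds (ν (cyl S (r + 1)))))
    {U : Set PlanarTree} (hU : IsOpen U) :
    ν U ≤ Filter.liminf (fun N => νs N U) Filter.atTop := by
  rw [← iUnion_cylInterior hU, (cylInterior_mono U).measure_iUnion, iUnion_cylInterior hU]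
  refine iSup_le fun r => (measure_mono (cylInterior_mono U r.le_succ)).trans ?_
  set C := (fun T => cyl T (r + 1)) '' cylInterior U (r + 1)
  have hrange : C ⊆ Set.range fun T => cyl T (r + 1) := Set.image_subset_range _ _
  have hmeas : ∀ B ∈ C, MeasurableSet B := by
    rintro _ ⟨S, -, rfl⟩
    exact measurableSet_cyl S (r + 1)
  have hdisj := (pairwise_disjoint_range_cyl (r + 1)).mono hrange
  rw [cylInterior_eq_sUnion, measure_sUnion ((countable_range_cyl _).mono hrange) hdisj hmeas,
    ENNReal.tsum_eq_iSup_sum]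
  refine iSup_le fun F => ?_
  have hlim : Filter.Tendsto (fun N => ∑ B ∈ F, νs N B) Filter.atTop (nhds (∑ B ∈ F, ν B)) :=
    tendsto_finsetSum F fun ⟨_, S, _, hS⟩ _ => hS ▸ h S r
  rw [← hlim.liminf_eq]
  refine Filter.liminf_le_liminf (Filter.Eventually.of_forall fun N => ?_)
  rw [← measure_biUnion_finset (fun B _ B' _ hne => hdisj B.2 B'.2 (Subtype.coe_ne_coe.2 hne))
    fun B _ => hmeas B B.2]
  refine measure_mono (Set.iUnion₂_subset ?_)
  rintro ⟨_, S, hS, rfl⟩ -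
  exact hS

end Topology

end PlanarTree

namespace PlanarTree

section Size

open Finset

variable {S T : PlanarTree} {r : ℕ}

/-- The number of edges between vertices at height at most `r`. -/
def sizeUpTo (T : PlanarTree) (r : ℕ) : ℕ := ∑ s ∈ range r, T.gen (s + 1)

theorem sizeUpTo_succ (T : PlanarTree) (r : ℕ) :
    T.sizeUpTo (r + 1) = T.sizeUpTo r + T.gen (r + 1) := sum_range_succ _ _

theorem sizeUpTo_eq_of_mem_cyl (h : T ∈ cyl S r) : T.sizeUpTo r = S.sizeUpTo r :=
  sum_congr rfl fun _ hs => gen_eq_of_mem_cyl h (mem_range.1 hs)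

theorem encard_vertices_le (T : PlanarTree) (r : ℕ) :
    {v ∈ T.vertices | 1 ≤ v.1 ∧ v.1 ≤ r}.encard = T.sizeUpTo r := by
  have hset : {v ∈ T.vertices | 1 ≤ v.1 ∧ v.1 ≤ r} =
      ↑(((range r).sigma fun s => range (T.gen (s + 1))).image
        fun x : (_ : ℕ) × ℕ => (x.1 + 1, x.2)) := by
    ext ⟨s, i⟩
    simp only [vertices, Set.mem_ofPred_eq, coe_image, Set.mem_image, mem_coe, mem_sigma,
      mem_range, Sigma.exists, Prod.mk.injEq]
    constructor
    · rintro ⟨hi, hs, hsr⟩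
      exact ⟨s - 1, i, ⟨by omega, by rwa [Nat.sub_add_cancel hs]⟩, by omega, rfl⟩
    · rintro ⟨s, i, ⟨hs, hi⟩, rfl, rfl⟩
      exact ⟨hi, by omega, by omega⟩
  rw [hset, Set.encard_coe_eq_coe_finsetCard, card_image_of_injective, card_sigma]
  · simp only [card_range, sizeUpTo]
  · rintro ⟨a, b⟩ ⟨c, d⟩ h
    simp only [Prod.mk.injEq, Nat.add_right_cancel_iff] at h
    obtain ⟨rfl, rfl⟩ := h
    rfl

theorem sizeUpTo_le_size (T : PlanarTree) (r : ℕ) : (T.sizeUpTo r : ℕ∞) ≤ T.size := by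
  rw [← encard_vertices_le]
  exact Set.encard_le_encard fun v hv => ⟨hv.1, hv.2.1⟩

theorem size_eq_sizeUpTo (h : T.gen (r + 1) = 0) : T.size = T.sizeUpTo r := by
  rw [← encard_vertices_le, size]
  congr 1
  refine Set.ext fun v => and_congr_right fun hv => (and_iff_left ?_).symm
  by_contra hvr
  exact Nat.not_lt_zero v.2 (gen_eq_zero_of_le (by omega : r + 1 ≤ v.1) h ▸ hv)

theorem size_eq_top_iff (T : PlanarTree) : T.size = ⊤ ↔ ∀ r, T.gen r ≠ 0 := by
  constructor
  · intro h r hr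
    rw [size_eq_sizeUpTo (gen_eq_zero_of_le r.le_succ hr)] at h
    exact ENat.natCast_ne_top _ h
  · refine fun h => ENat.eq_top_iff_forall_ge.2 fun n => le_trans ?_ (T.sizeUpTo_le_size n)
    have hn : n ≤ T.sizeUpTo n := by
      calc n = ∑ _ ∈ range n, 1 := by rw [sum_const, card_range, smul_eq_mul, mul_one]
        _ ≤ _ := sum_le_sum fun s _ => Nat.pos_of_ne_zero (h (s + 1))
    exact_mod_cast hn

theorem height_eq (hr : T.gen r ≠ 0) (h : T.gen (r + 1) = 0) : T.height = r := by
  refine IsGreatest.csSup_eq ⟨hr, fun s hs => ?_⟩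
  by_contra! hrs
  exact hs (gen_eq_zero_of_le hrs h)

end Size

section FiniteSizeMeasure

open Filter Topology Finset MeasureTheory

variable {μ : ℝ} {S T : PlanarTree} {r N : ℕ} {A : Set PlanarTree}

/-- The numerator of `finiteSizeMeasure`: the trees with `N` edges, weighted by `exp (-μ h)`. -/
noncomputable def sizeMeasure (μ : ℝ) (N : ℕ) : Measure PlanarTree :=
  Measure.sum fun T : {T : PlanarTree // T.size = N} =>
    ENNReal.ofReal (Real.exp (-μ * T.1.height)) • Measure.dirac T.1

theorem sizeMeasure_apply (μ : ℝ) (N : ℕ) (hA : MeasurableSet A) :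
    sizeMeasure μ N A = ∑' T : {T : PlanarTree // T.size = N},
      ENNReal.ofReal (Real.exp (-μ * T.1.height)) * A.indicator 1 T.1 := by
  simp only [sizeMeasure, Measure.sum_apply _ hA, Measure.smul_apply, smul_eq_mul,
    Measure.dirac_apply' _ hA]

theorem partitionFunction_eq (μ : ℝ) (N : ℕ) :
    partitionFunction μ N = sizeMeasure μ N Set.univ := by
  simp only [partitionFunction, sizeMeasure_apply _ _ MeasurableSet.univ, Set.indicator_univ,
    Pi.one_apply, mul_one]

theorem finiteSizeMeasure_apply (μ : ℝ) (N : ℕ) (hA : MeasurableSet A) :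
    finiteSizeMeasure μ N A = sizeMeasure μ N A / partitionFunction μ N := by
  rw [finiteSizeMeasure, Measure.sum_apply _ hA, sizeMeasure_apply _ _ hA, div_eq_mul_inv,
    ← ENNReal.tsum_mul_right]
  refine tsum_congr fun T => ?_
  rw [Measure.smul_apply, Measure.dirac_apply' _ hA, smul_eq_mul, div_eq_mul_inv, mul_right_comm]

theorem sizeMeasure_eq_zero (μ : ℝ) (hA : MeasurableSet A) (h : ∀ T ∈ A, T.size ≠ N) :
    sizeMeasure μ N A = 0 := by
  rw [sizeMeasure_apply _ _ hA, ENNReal.tsum_eq_zero]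
  rintro ⟨T, hT⟩
  rw [Set.indicator_of_notMem (fun hA => h T hA hT), mul_zero]

theorem sizeMeasure_singleton (μ : ℝ) (hT : T.size = N) :
    sizeMeasure μ N {T} = ENNReal.ofReal (Real.exp (-μ * T.height)) := by
  rw [sizeMeasure_apply _ _ (MeasurableSet.singleton T), tsum_eq_single ⟨T, hT⟩]
  · simp only [Set.mem_singleton_iff, Set.indicator_of_mem, Pi.one_apply, mul_one]
  · rintro ⟨T', hT'⟩ hne
    rw [Set.indicator_of_notMem (s := {T}) fun h => hne (Subtype.ext h), mul_zero]

theorem sizeMeasure_cyl_of_lt (μ : ℝ) (h : N < S.sizeUpTo r) : sizeMeasure μ N (cyl S r) = 0 := by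
  refine sizeMeasure_eq_zero μ (measurableSet_cyl S r) fun T hT hs => h.not_ge ?_
  have hle := T.sizeUpTo_le_size r
  rw [hs, sizeUpTo_eq_of_mem_cyl hT] at hle
  exact_mod_cast hle

theorem sizeMeasure_cyl_of_gen_eq_zero (μ : ℝ) (hr : S.gen r ≠ 0) (h : S.gen (r + 1) = 0) :
    sizeMeasure μ N (cyl S (r + 1)) =
      if S.sizeUpTo r = N then ENNReal.ofReal (Real.exp (-μ) ^ r) else 0 := by
  have hsize : S.size = N ↔ S.sizeUpTo r = N := by rw [size_eq_sizeUpTo h, Nat.cast_inj]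
  rw [cyl_eq_singleton h]
  split_ifs with hN
  · rw [sizeMeasure_singleton μ (hsize.2 hN), height_eq hr h, ← Real.exp_nat_mul, mul_comm]
  · refine sizeMeasure_eq_zero μ (MeasurableSet.singleton S) fun T hT hTN => hN (hsize.1 ?_)
    rwa [← Set.mem_singleton_iff.1 hT]

theorem sizeUpTo_extend (S : PlanarTree) (hr : 1 ≤ r) (m : Multiset (Fin (S.gen r))) :
    (S.extend r m).sizeUpTo (r + 1) = S.sizeUpTo r + m.card := by
  rw [sizeUpTo_succ, gen_extend hr, sizeUpTo_eq_of_mem_cyl (extend_mem_cyl hr m)]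

theorem tsum_ofReal_forestWeight_card (hμ : 0 < μ) {K : ℕ} (hK : K ≠ 0) (r M : ℕ) :
    ∑' m : Multiset (Fin K), ENNReal.ofReal
        (Real.exp (-μ) ^ (r + 1) * forestWeight (Real.exp (-μ)) m.card M) =
      ENNReal.ofReal (Real.exp (-μ) ^ r * forestWeight (Real.exp (-μ)) K (M + K)) := by
  have hq := exp_neg_mem_Ioo hμ
  have hnonneg : ∀ J, 0 ≤ Real.exp (-μ) ^ (r + 1) * forestWeight (Real.exp (-μ)) J M :=
    fun J => mul_nonneg (pow_nonneg hq.1.le _) (forestWeight_nonneg hq _ _)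
  rw [tsum_multiset_card fun J => ENNReal.ofReal
      (Real.exp (-μ) ^ (r + 1) * forestWeight (Real.exp (-μ)) J M), Fintype.card_fin]
  refine tsum_natCast_mul_ofReal hnonneg ?_
  rw [forestWeight_add_self hq (Nat.one_le_iff_ne_zero.2 hK), ← mul_assoc, ← pow_succ, mul_sum]
  simp only [mul_left_comm]
  refine hasSum_sum_of_ne_finset_zero fun J hJ => ?_
  rw [forestWeight_of_lt _ (by simpa using hJ), mul_zero, mul_zero]

theorem sizeMeasure_cyl (hμ : 0 < μ) (M : ℕ) (S : PlanarTree) (r : ℕ)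
    (hS : S.gen (r + 1) ≠ 0) (hM : S.sizeUpTo (r + 1) + M = N) :
    sizeMeasure μ N (cyl S (r + 1)) = ENNReal.ofReal (Real.exp (-μ) ^ r *
      forestWeight (Real.exp (-μ)) (S.gen (r + 1)) (M + S.gen (r + 1))) := by
  induction M using Nat.strong_induction_on generalizing S r with
  | _ M ih =>
    have hr : 1 ≤ r + 1 := Nat.le_add_left 1 r
    have hextend : ∀ m : Multiset (Fin (S.gen (r + 1))),
        sizeMeasure μ N (cyl (S.extend (r + 1) m) (r + 1 + 1)) =
          ENNReal.ofReal (Real.exp (-μ) ^ (r + 1) * forestWeight (Real.exp (-μ)) m.card M) := by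
      intro m
      have hgen := gen_extend hr m
      have hsize := S.sizeUpTo_extend hr m
      rcases Nat.eq_zero_or_pos m.card with hm | hm
      · have hmem := extend_mem_cyl hr m
        rw [sizeMeasure_cyl_of_gen_eq_zero μ (by rwa [gen_eq_of_mem_cyl hmem le_rfl])
          (hgen.trans hm), sizeUpTo_eq_of_mem_cyl hmem, hm,
          forestWeight_zero_left (exp_neg_mem_Ioo hμ), mul_ite, mul_one, mul_zero, apply_ite
          ENNReal.ofReal, ENNReal.ofReal_zero]
        exact if_congr (by omega) rfl rfl
      · rcases lt_or_ge M m.card with h | h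
        · rw [forestWeight_of_lt _ h, mul_zero, ENNReal.ofReal_zero]
          exact sizeMeasure_cyl_of_lt μ (by omega)
        · rw [ih (M - m.card) (by omega) _ (r + 1) (by omega) (by omega), hgen,
            Nat.sub_add_cancel h]
    rw [measure_cyl _ S hr, tsum_congr hextend, tsum_ofReal_forestWeight_card hμ hS]

theorem partitionFunction_eq_forestWeight (hμ : 0 < μ) (hN : 1 ≤ N) :
    partitionFunction μ N = ENNReal.ofReal (forestWeight (Real.exp (-μ)) 1 N) := by
  obtain ⟨S⟩ := (inferInstance : Nonempty PlanarTree)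
  have hsize : S.sizeUpTo (0 + 1) = 1 := by
    rw [sizeUpTo, zero_add, sum_range_one, zero_add, S.gen_one]
  rw [partitionFunction_eq, ← cyl_one S, sizeMeasure_cyl hμ (N - 1) S 0
    (by rw [zero_add, S.gen_one]; exact one_ne_zero) (by omega), zero_add, S.gen_one, pow_zero,
    one_mul, Nat.sub_add_cancel hN]

theorem isProbabilityMeasure_finiteSizeMeasure (hμ : 0 < μ) (hN : 1 ≤ N) :
    IsProbabilityMeasure (finiteSizeMeasure μ N) := by
  constructor
  rw [finiteSizeMeasure_apply _ _ MeasurableSet.univ, ← partitionFunction_eq,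
    partitionFunction_eq_forestWeight hμ hN]
  refine ENNReal.div_self ?_ ENNReal.ofReal_ne_top
  rw [Ne, ENNReal.ofReal_eq_zero, not_le]
  exact forestWeight_one_pos (exp_neg_mem_Ioo hμ) hN

/-- The limiting mass of the cylinder of height `r + 1` around `S`. -/
noncomputable def cylWeight (μ : ℝ) (S : PlanarTree) (r : ℕ) : ℝ :=
  Real.exp (-μ) ^ r * limitWeight μ (S.gen (r + 1)) / 4 ^ S.sizeUpTo r

theorem tendsto_finiteSizeMeasure_cyl_of_gen_eq_zero (μ : ℝ) (h : S.gen (r + 1) = 0) :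
    Tendsto (fun N => finiteSizeMeasure μ N (cyl S (r + 1))) atTop (𝓝 0) := by
  refine tendsto_const_nhds.congr' ?_
  filter_upwards [eventually_gt_atTop (S.sizeUpTo r)] with N hN
  rw [finiteSizeMeasure_apply _ _ (measurableSet_cyl _ _),
    sizeMeasure_eq_zero μ (measurableSet_cyl _ _), ENNReal.zero_div]
  intro T hT hTN
  rw [cyl_eq_singleton h, Set.mem_singleton_iff] at hT
  rw [hT, size_eq_sizeUpTo h, Nat.cast_inj] at hTN
  exact hN.ne hTN

theorem tendsto_finiteSizeMeasure_cyl (hμ : 0 < μ) (S : PlanarTree) (r : ℕ) :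
    Tendsto (fun N => finiteSizeMeasure μ N (cyl S (r + 1))) atTop
      (𝓝 (ENNReal.ofReal (cylWeight μ S r))) := by
  rcases eq_or_ne (S.gen (r + 1)) 0 with h | h
  · rw [cylWeight, h, limitWeight_zero, mul_zero, zero_div, ENNReal.ofReal_zero]
    exact tendsto_finiteSizeMeasure_cyl_of_gen_eq_zero μ h
  · have hweight : cylWeight μ S r = Real.exp (-μ) ^ r *
        (limitWeight μ (S.gen (r + 1)) * 4 ^ S.gen (r + 1) / 4 ^ S.sizeUpTo (r + 1)) := by
      rw [cylWeight, sizeUpTo_succ, pow_add]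
      field_simp
    rw [hweight, ← tendsto_add_atTop_iff_nat (S.sizeUpTo (r + 1))]
    refine (ENNReal.tendsto_ofReal ((tendsto_forestWeight_div hμ (S.gen (r + 1)) (S.gen (r + 1))
      (S.sizeUpTo (r + 1))).const_mul (Real.exp (-μ) ^ r))).congr fun M => ?_
    have hN : 1 ≤ M + S.sizeUpTo (r + 1) := by
      rw [sizeUpTo_succ]
      omega
    rw [finiteSizeMeasure_apply _ _ (measurableSet_cyl _ _),
      sizeMeasure_cyl hμ M S r h (add_comm _ _), partitionFunction_eq_forestWeight hμ hN,
      ← ENNReal.ofReal_div_of_pos (forestWeight_one_pos (exp_neg_mem_Ioo hμ) hN), mul_div_assoc]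

end FiniteSizeMeasure

end PlanarTree

section MarkovChain

open MeasureTheory ProbabilityTheory Finset

theorem setOf_forall_le_eq_preimage_frestrictLe {α : Type*} (y : ℕ → α) (n : ℕ) :
    {x : ℕ → α | ∀ s ≤ n, x s = y s} =
      Preorder.frestrictLe (π := fun _ => α) n ⁻¹'
        {Preorder.frestrictLe (π := fun _ => α) n y} := by
  ext x
  simp only [Set.mem_ofPred_eq, Set.mem_preimage, Set.mem_singleton_iff, funext_iff,
    Preorder.frestrictLe_apply, Subtype.forall, mem_Iic]

variable {α : Type*} [MeasurableSpace α]

/-- `P` is the law of the Markov chain on a countable state space that starts in `x₀` and has the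
transition probabilities `κ`; the Markov property is stated for trajectories. -/
structure IsMarkovChain (P : Measure (ℕ → α)) (κ : α → Measure α) (x₀ : α) : Prop where
  isProbabilityMeasure : IsProbabilityMeasure P
  ae_zero : ∀ᵐ x ∂P, x 0 = x₀
  measure_succ (n : ℕ) (y : ℕ → α) : P {x | ∀ s ≤ n + 1, x s = y s} =
    P {x | ∀ s ≤ n, x s = y s} * κ (y n) {y (n + 1)}

theorem IsMarkovChain.ae_rel [Countable α] {P : Measure (ℕ → α)} {κ : α → Measure α} {x₀ : α}
    (h : IsMarkovChain P κ x₀) {R : α → α → Prop} (hR : ∀ a b, ¬ R a b → κ a {b} = 0) :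
    ∀ᵐ x ∂P, ∀ n, R (x n) (x (n + 1)) := by
  refine ae_all_iff.2 fun n => ?_
  let ext (y : Iic (n + 1) → α) (s : ℕ) : α :=
    if hs : s ≤ n + 1 then y ⟨s, mem_Iic.2 hs⟩ else x₀
  have hcover : {x : ℕ → α | ¬ R (x n) (x (n + 1))} ⊆
      ⋃ y ∈ {y | ¬ R (ext y n) (ext y (n + 1))}, {x | ∀ s ≤ n + 1, x s = ext y s} := by
    intro x hx
    have hext : ∀ s ≤ n + 1, x s = ext (fun i => x i) s := fun s hs => by
      simp only [ext, hs, dif_pos]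
    refine Set.mem_biUnion (x := fun i : Iic (n + 1) => x i) ?_ hext
    rwa [Set.mem_ofPred_eq, ← hext n n.le_succ, ← hext (n + 1) le_rfl]
  refine measure_mono_null hcover ((measure_biUnion_null_iff (Set.to_countable _)).2 fun y hy => ?_)
  rw [h.measure_succ, hR _ _ hy, mul_zero]

theorem exists_isMarkovChain [Countable α] [DiscreteMeasurableSpace α]
    (κ : α → Measure α) [∀ a, IsProbabilityMeasure (κ a)] (x₀ : α) : ∃ P, IsMarkovChain P κ x₀ := by
  let step (n : ℕ) : Kernel ((i : Iic n) → α) α :=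
    Kernel.ofFunOfCountable fun x => κ (x ⟨n, mem_Iic.2 le_rfl⟩)
  have hstep : ∀ n, IsMarkovKernel (step n) := fun n =>
    ⟨fun x => inferInstanceAs (IsProbabilityMeasure (κ _))⟩
  let x₁ : (i : Iic 0) → α := fun _ => x₀
  refine ⟨Kernel.traj (X := fun _ => α) step 0 x₁, inferInstance, ?_, fun n y => ?_⟩
  · have hmap := Kernel.traj_map_frestrictLe_apply (X := fun _ => α) (κ := step) 0 0 x₁
    rw [Kernel.partialTraj_self, Kernel.id_apply] at hmap
    have hae : ∀ᵐ x ∂((Kernel.traj (X := fun _ => α) step 0 x₁).map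
        (Preorder.frestrictLe (π := fun _ => α) 0)), x ⟨0, mem_Iic.2 le_rfl⟩ = x₀ := by
      rw [hmap, ae_dirac_eq]
      exact rfl
    exact ae_of_ae_map (Preorder.measurable_frestrictLe 0).aemeasurable hae
  · have hcomp := Kernel.partialTraj_compProd_eq_map_traj (X := fun _ => α) (κ := step)
      (Nat.zero_le n) (x₀ := x₁)
    have hset : {x : ℕ → α | ∀ s ≤ n + 1, x s = y s} =
        (fun x => (Preorder.frestrictLe (π := fun _ => α) n x, x (n + 1))) ⁻¹'
          ({Preorder.frestrictLe (π := fun _ => α) n y} ×ˢ {y (n + 1)}) := by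
      rw [Set.mk_preimage_prod, ← setOf_forall_le_eq_preimage_frestrictLe]
      ext x
      simp only [Nat.le_add_one_iff, or_imp, forall_and, forall_eq]
      rfl
    rw [hset, ← Measure.map_apply (by fun_prop) ((MeasurableSet.singleton _).prod
      (MeasurableSet.singleton _)), ← hcomp, Measure.compProd_apply_prod (MeasurableSet.singleton _)
      (MeasurableSet.singleton _), Measure.restrict_singleton, lintegral_smul_measure,
      lintegral_dirac, setOf_forall_le_eq_preimage_frestrictLe,
      ← Kernel.traj_map_frestrictLe_apply,
      Measure.map_apply (Preorder.measurable_frestrictLe n) (.singleton _), smul_eq_mul]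
    rfl

end MarkovChain

namespace PlanarTree

section LimitMeasure

open Filter Topology Finset MeasureTheory

variable {μ : ℝ} {K : ℕ}

scoped instance : MeasurableSpace (Multiset ℕ) := ⊤

scoped instance : DiscreteMeasurableSpace (Multiset ℕ) := ⟨fun _ => trivial⟩

/-- The law, in the limiting random tree, of the multiset of parents of a generation, given that
the preceding generation has `K` vertices. -/
noncomputable def stepMeasure (μ : ℝ) (K : ℕ) : Measure (Multiset ℕ) :=
  if K = 0 then Measure.dirac 0 else
    Measure.sum fun m : Multiset (Fin K) =>
      ENNReal.ofReal (Real.exp (-μ) / (4 ^ K * limitWeight μ K) * limitWeight μ m.card) •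
        Measure.dirac (m.map Fin.val)

theorem isProbabilityMeasure_stepMeasure (hμ : 0 ≤ μ) (K : ℕ) :
    IsProbabilityMeasure (stepMeasure μ K) := by
  rw [stepMeasure]
  split_ifs with hK
  · infer_instance
  · constructor
    have hpos := limitWeight_pos hμ hK
    simp only [Measure.sum_apply _ MeasurableSet.univ, Measure.smul_apply, measure_univ,
      smul_eq_mul, mul_one]
    rw [tsum_multiset_card fun J => ENNReal.ofReal
        (Real.exp (-μ) / (4 ^ K * limitWeight μ K) * limitWeight μ J), Fintype.card_fin,
      ← ENNReal.ofReal_one]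
    refine tsum_natCast_mul_ofReal
      (fun J => mul_nonneg (by positivity) (limitWeight_nonneg hμ J)) ?_
    simp only [mul_left_comm (Nat.cast (R := ℝ) _)]
    have hone : Real.exp (-μ) / (4 ^ K * limitWeight μ K) *
        (Real.exp μ * 4 ^ K * limitWeight μ K) = 1 := by
      rw [Real.exp_neg]
      field_simp
    exact hone ▸ (hasSum_multichoose_mul_limitWeight hμ K).mul_left _

theorem stepMeasure_singleton (μ : ℝ) (hK : K ≠ 0) (m : Multiset (Fin K)) :
    stepMeasure μ K {m.map Fin.val} =
      ENNReal.ofReal (Real.exp (-μ) / (4 ^ K * limitWeight μ K) * limitWeight μ m.card) := by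
  rw [stepMeasure, if_neg hK, Measure.sum_apply _ (MeasurableSet.singleton _), tsum_eq_single m]
  · simp
  · intro m' hne
    simp [(Multiset.map_injective Fin.val_injective).ne hne]

theorem stepMeasure_eq_zero (μ : ℝ) {m : Multiset ℕ} (hm : ¬ ∀ x ∈ m, x < K) :
    stepMeasure μ K {m} = 0 := by
  rw [stepMeasure]
  split_ifs with hK
  · have hne : (0 : Multiset ℕ) ≠ m := by
      rintro rfl
      exact hm fun x hx => absurd hx (Multiset.notMem_zero x)
    simp [hne]
  · rw [Measure.sum_apply _ (MeasurableSet.singleton _), ENNReal.tsum_eq_zero]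
    intro m'
    have hne : m'.map Fin.val ≠ m := by
      rintro rfl
      exact hm fun x hx => by
        obtain ⟨i, -, rfl⟩ := Multiset.mem_map.1 hx
        exact i.2
    simp [hne]

theorem cylWeight_zero (μ : ℝ) (S : PlanarTree) : cylWeight μ S 0 = 1 := by
  simp [cylWeight, S.gen_one, limitWeight_one, sizeUpTo]

theorem cylWeight_nonneg (hμ : 0 ≤ μ) (S : PlanarTree) (r : ℕ) : 0 ≤ cylWeight μ S r :=
  div_nonneg (mul_nonneg (by positivity) (limitWeight_nonneg hμ _)) (by positivity)

theorem cylWeight_mul_stepMeasure (hμ : 0 ≤ μ) (S : PlanarTree) (r : ℕ) :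
    ENNReal.ofReal (cylWeight μ S r) * stepMeasure μ (S.gen (r + 1)) {S.parents (r + 1)} =
      ENNReal.ofReal (cylWeight μ S (r + 1)) := by
  rcases eq_or_ne (S.gen (r + 1)) 0 with hS | hS
  · have hS' : S.gen (r + 1 + 1) = 0 := gen_eq_zero_of_le (r + 1).le_succ hS
    rw [cylWeight, cylWeight, hS, hS', limitWeight_zero]
    simp
  · obtain ⟨m, hm⟩ := S.exists_map_val_eq_parents (r + 1)
    have hcard : m.card = S.gen (r + 1 + 1) := by
      rw [← Multiset.card_map Fin.val m, hm, card_parents]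
    have hpos := limitWeight_pos hμ hS
    rw [← hm, stepMeasure_singleton μ hS, ← ENNReal.ofReal_mul (cylWeight_nonneg hμ S r), hcard,
      cylWeight, cylWeight, sizeUpTo_succ]
    congr 1
    field_simp
    ring

theorem measurable_ofParents : Measurable ofParents := by
  have hadmissible : ∀ s, Measurable fun M : ℕ → Multiset ℕ => admissible M s := by
    intro s
    induction s with
    | zero => exact measurable_const
    | succ s ih =>
      exact (Measurable.of_discrete (f := fun p : Multiset ℕ × Multiset ℕ =>
        p.1.filter (· < p.2.card))).comp ((measurable_pi_apply (s + 1)).prodMk ih)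
  refine measurable_of_parents fun r m => ?_
  simp_rw [parents_ofParents]
  exact hadmissible r (MeasurableSet.singleton m)

theorem measure_forall_le_eq_parents (hμ : 0 ≤ μ) {P : Measure (ℕ → Multiset ℕ)}
    (hP : IsMarkovChain P (fun m => stepMeasure μ m.card) {0}) (S : PlanarTree) (r : ℕ) :
    P {M | ∀ s ≤ r, M s = S.parents s} = ENNReal.ofReal (cylWeight μ S r) := by
  induction r with
  | zero =>
    have := hP.isProbabilityMeasure
    rw [cylWeight_zero, ENNReal.ofReal_one, ← measure_univ (μ := P)]
    refine measure_congr (eventuallyEq_univ.2 ?_)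
    filter_upwards [hP.ae_zero] with M hM s hs
    rw [Nat.le_zero.1 hs, hM, parents_zero]
  | succ r ih => rw [hP.measure_succ, ih, card_parents, cylWeight_mul_stepMeasure hμ]

theorem exists_measure_cyl (hμ : 0 ≤ μ) :
    ∃ ν : Measure PlanarTree, IsProbabilityMeasure ν ∧
      ∀ S r, ν (cyl S (r + 1)) = ENNReal.ofReal (cylWeight μ S r) := by
  have := fun m : Multiset ℕ => isProbabilityMeasure_stepMeasure hμ m.card
  obtain ⟨P, hP⟩ := exists_isMarkovChain (fun m : Multiset ℕ => stepMeasure μ m.card) {0}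
  have := hP.isProbabilityMeasure
  have hadmissible : ∀ᵐ M ∂P, admissible M = M := by
    filter_upwards [hP.ae_zero, hP.ae_rel fun m m' h => stepMeasure_eq_zero μ h] with M h0 h
    exact admissible_eq_self h0 h
  refine ⟨P.map ofParents, Measure.isProbabilityMeasure_map measurable_ofParents.aemeasurable,
    fun S r => ?_⟩
  rw [Measure.map_apply measurable_ofParents (measurableSet_cyl _ _),
    ← measure_forall_le_eq_parents hμ hP S r]
  refine measure_congr ?_
  filter_upwards [hadmissible] with M hM
  refine propext (forall_congr' fun s => ?_)
  rw [parents_ofParents, hM, Nat.lt_succ_iff]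

theorem isLocalLimit_of_cyl (hμ : 0 < μ) {ν : Measure PlanarTree} [IsProbabilityMeasure ν]
    (h : ∀ S r, ν (cyl S (r + 1)) = ENNReal.ofReal (cylWeight μ S r)) : IsLocalLimit μ ν := by
  refine ⟨inferInstance, fun F => ?_⟩
  rw [← tendsto_add_atTop_iff_nat 1]
  let νs (N : ℕ) : ProbabilityMeasure PlanarTree := ⟨finiteSizeMeasure μ (N + 1),
    isProbabilityMeasure_finiteSizeMeasure hμ (Nat.le_add_left 1 N)⟩
  have hlim : Tendsto νs atTop (𝓝 ⟨ν, inferInstance⟩) := by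
    refine tendsto_of_forall_isOpen_le_liminf_nat' fun U hU => ?_
    refine le_liminf_of_isOpen ν (fun S r => ?_) hU
    rw [h]
    exact (tendsto_add_atTop_iff_nat 1).2 (tendsto_finiteSizeMeasure_cyl hμ S r)
  exact ProbabilityMeasure.tendsto_iff_forall_integral_tendsto.1 hlim F

theorem IsLocalLimit.unique {ν ν' : Measure PlanarTree} (h : IsLocalLimit μ ν)
    (h' : IsLocalLimit μ ν') : ν = ν' := by
  have := h.1
  have := h'.1
  exact ext_of_forall_integral_eq_of_IsFiniteMeasure fun F =>
    tendsto_nhds_unique (h.2 F) (h'.2 F)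

theorem existsUnique_isLocalLimit (hμ : 0 < μ) : ∃! ν, IsLocalLimit μ ν := by
  obtain ⟨ν, _, hν⟩ := exists_measure_cyl hμ.le
  exact ⟨ν, isLocalLimit_of_cyl hμ hν, fun ν' h => h.unique (isLocalLimit_of_cyl hμ hν)⟩

theorem IsLocalLimit.measure_cyl (hμ : 0 < μ) {ν : Measure PlanarTree} (h : IsLocalLimit μ ν)
    (S : PlanarTree) (r : ℕ) : ν (cyl S (r + 1)) = ENNReal.ofReal (cylWeight μ S r) := by
  obtain ⟨ν', _, hν'⟩ := exists_measure_cyl hμ.le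
  rw [h.unique (isLocalLimit_of_cyl hμ hν'), hν']

end LimitMeasure

end PlanarTree

namespace PlanarTree

section InfiniteType

open Finset MeasureTheory

variable {S T : PlanarTree} {r n i : ℕ} {I : Finset ℕ}

/-- The vertex `(r, i)` has a descendant at height `r + n`. -/
def Reaches (T : PlanarTree) (r n i : ℕ) : Prop := ∃ j < T.gen (r + n), T.ancestor r n j = i

theorem Reaches.lt (h : T.Reaches r n i) : i < T.gen r := by
  obtain ⟨j, hj, rfl⟩ := h
  exact ancestor_lt T r n j hj

theorem reaches_zero : T.Reaches r 0 i ↔ i < T.gen r :=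
  ⟨Reaches.lt, fun h => ⟨i, h, rfl⟩⟩

theorem reaches_succ : T.Reaches r (n + 1) i ↔ ∃ j, T.Reaches (r + 1) n j ∧ T.parent r j = i := by
  constructor
  · rintro ⟨k, hk, rfl⟩
    exact ⟨_, ⟨k, by rwa [add_assoc, add_comm 1 n], rfl⟩, (ancestor_succ' T r n k).symm⟩
  · rintro ⟨_, ⟨k, hk, rfl⟩, rfl⟩
    exact ⟨k, by rwa [add_assoc, add_comm 1 n] at hk, ancestor_succ' T r n k⟩

theorem Reaches.mono {m : ℕ} (hnm : n ≤ m) (h : T.Reaches r m i) : T.Reaches r n i := by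
  induction m, hnm using Nat.le_induction with
  | base => exact h
  | succ m _ ih =>
    obtain ⟨j, hj, rfl⟩ := h
    exact ih ⟨T.parent (r + m) j, T.parent_lt _ _ hj, rfl⟩

theorem infiniteType_iff_forall_reaches : T.InfiniteType r i ↔ ∀ n, T.Reaches r n i := by
  constructor
  · intro h n
    by_contra hn
    refine h.2 (((Set.finite_Iio n).biUnion fun k _ =>
      (Set.finite_Iio (T.gen (r + k))).image (Prod.mk k)).subset ?_)
    rintro ⟨k, j⟩ ⟨hj, hji⟩
    refine Set.mem_biUnion (x := k) ?_ ⟨j, hj, rfl⟩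
    by_contra hk
    exact hn (Reaches.mono (not_lt.1 hk) ⟨j, hj, hji⟩)
  · intro h
    refine ⟨(h 0).lt, ?_⟩
    choose j hj hij using h
    exact Set.infinite_of_injective_forall_mem (f := fun n => (n, j n))
      (fun a b hab => (Prod.mk.inj hab).1) fun n => ⟨hj n, hij n⟩

theorem exists_forall_reaches_infiniteType (T : PlanarTree) (r : ℕ) :
    ∃ n, ∀ i, T.Reaches r n i → T.InfiniteType r i := by
  have hvertex : ∀ i, ∃ n, T.Reaches r n i → T.InfiniteType r i := by
    intro i
    by_contra! h
    exact (h 0).2 (infiniteType_iff_forall_reaches.2 fun n => (h n).1)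
  choose n hn using hvertex
  refine ⟨(range (T.gen r)).sup n, fun i hi => hn i (hi.mono ?_)⟩
  exact le_sup (f := n) (mem_range.2 hi.lt)

theorem infiniteType_iff_exists_child :
    T.InfiniteType r i ↔ ∃ j, T.InfiniteType (r + 1) j ∧ T.parent r j = i := by
  constructor
  · intro h
    obtain ⟨n, hn⟩ := T.exists_forall_reaches_infiniteType (r + 1)
    obtain ⟨j, hj, rfl⟩ := reaches_succ.1 (infiniteType_iff_forall_reaches.1 h (n + 1))
    exact ⟨j, hn j hj, rfl⟩
  · rintro ⟨j, hj, rfl⟩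
    exact hj.parent

open Classical in
/-- The set of the vertices of infinite type at height `r`. -/
noncomputable def infiniteVertices (T : PlanarTree) (r : ℕ) : Finset ℕ :=
  (range (T.gen r)).filter (T.InfiniteType r)

theorem mem_infiniteVertices : i ∈ T.infiniteVertices r ↔ T.InfiniteType r i := by
  simp only [infiniteVertices, mem_filter, mem_range, and_iff_right_iff_imp]
  exact fun h => h.1

theorem infiniteVertices_subset_range (T : PlanarTree) (r : ℕ) :
    T.infiniteVertices r ⊆ range (T.gen r) := fun _ hi =>
  mem_range.2 (mem_infiniteVertices.1 hi).1

theorem infiniteVertices_eq_image (T : PlanarTree) (r : ℕ) :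
    T.infiniteVertices r = (T.infiniteVertices (r + 1)).image (T.parent r) := by
  ext i
  simp only [mem_infiniteVertices, mem_image]
  exact infiniteType_iff_exists_child

theorem gen_spine (T : InfiniteTree) (r : ℕ) :
    (spine T).gen r = (T.1.infiniteVertices r).card := by
  classical
  change Nat.count _ _ = _
  rw [Nat.count_eq_card_filter_range, infiniteVertices]

/-- The set of the children at height `r + 1` of the vertices in `I` at height `r`. -/
def children (T : PlanarTree) (r : ℕ) (I : Finset ℕ) : Finset ℕ :=
  (range (T.gen (r + 1))).filter fun j => T.parent r j ∈ I

theorem children_subset_range (T : PlanarTree) (r : ℕ) (I : Finset ℕ) :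
    T.children r I ⊆ range (T.gen (r + 1)) := filter_subset _ _

theorem card_children (T : PlanarTree) (r : ℕ) (I : Finset ℕ) :
    (T.children r I).card = (T.parents r).countP (· ∈ I) := by
  rw [parents, Multiset.countP_map]
  rfl

theorem children_eq_of_mem_cyl (h : T ∈ cyl S (r + 1)) (I : Finset ℕ) :
    T.children r I = S.children r I := by
  rw [children, children, gen_eq_of_mem_cyl h le_rfl, parent_eq_of_mem_cyl h r.lt_succ_self]

theorem card_children_extend (S : PlanarTree) (hr : 1 ≤ r) (m : Multiset (Fin (S.gen r)))
    (I : Finset ℕ) : ((S.extend r m).children r I).card = m.countP (·.1 ∈ I) := by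
  rw [card_children, parents_extend_self hr, Multiset.countP_map, Multiset.countP_eq_card_filter]

theorem infiniteVertices_subset_iff :
    T.infiniteVertices r ⊆ I ↔ T.infiniteVertices (r + 1) ⊆ T.children r I := by
  rw [T.infiniteVertices_eq_image r, image_subset_iff]
  refine ⟨fun h j hj => ?_, fun h j hj => (mem_filter.1 (h hj)).2⟩
  exact mem_filter.2 ⟨T.infiniteVertices_subset_range _ hj, h j hj⟩

theorem infiniteVertices_eq_of_mem_cyl (h : T ∈ cyl S r)
    (hr : T.infiniteVertices r = S.infiniteVertices r) {s : ℕ} (hs : s ≤ r) :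
    T.infiniteVertices s = S.infiniteVertices s := by
  induction hs using Nat.decreasingInduction with
  | self => exact hr
  | of_succ s hs ih =>
    rw [T.infiniteVertices_eq_image, S.infiniteVertices_eq_image, ih, parent_eq_of_mem_cyl h hs]

/-- The set of the trees in which every vertex at height `r` with a descendant at height `r + n`
belongs to `I`. -/
def reachSet (r n : ℕ) (I : Finset ℕ) : Set PlanarTree := {T | ∀ i, T.Reaches r n i → i ∈ I}

theorem monotone_reachSet (r : ℕ) (I : Finset ℕ) : Monotone fun n => reachSet r n I :=
  fun _ _ hnm _ hT i hi => hT i (hi.mono hnm)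

theorem mem_reachSet_succ :
    T ∈ reachSet r (n + 1) I ↔ T ∈ reachSet (r + 1) n (T.children r I) := by
  constructor
  · intro h j hj
    exact mem_filter.2 ⟨mem_range.2 hj.lt, h _ (reaches_succ.2 ⟨j, hj, rfl⟩)⟩
  · intro h i hi
    obtain ⟨j, hj, rfl⟩ := reaches_succ.1 hi
    exact (mem_filter.1 (h j hj)).2

theorem iUnion_reachSet (r : ℕ) (I : Finset ℕ) :
    ⋃ n, reachSet r n I = {T | T.infiniteVertices r ⊆ I} := by
  ext T
  simp only [Set.mem_iUnion, Set.mem_ofPred_eq]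
  constructor
  · rintro ⟨n, hn⟩ i hi
    exact hn i (infiniteType_iff_forall_reaches.1 (mem_infiniteVertices.1 hi) n)
  · intro h
    obtain ⟨n, hn⟩ := T.exists_forall_reaches_infiniteType r
    exact ⟨n, fun i hi => h (mem_infiniteVertices.2 (hn i hi))⟩

theorem ancestor_eq_of_mem_cyl (h : T ∈ cyl S (r + n)) (j : ℕ) :
    T.ancestor r n j = S.ancestor r n j := by
  induction n generalizing j with
  | zero => rfl
  | succ n ih =>
    rw [ancestor, ancestor, parent_eq_of_mem_cyl h (by lia)]
    exact ih (fun s hs => h s (by lia)) _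

theorem measurableSet_reaches (r n i : ℕ) : MeasurableSet {T : PlanarTree | T.Reaches r n i} := by
  refine measurableSet_of_cyl_subset (r := r + n) fun T hT T' hT' => ?_
  obtain ⟨j, hj, hji⟩ := hT
  exact ⟨j, by rwa [gen_eq_of_mem_cyl hT' le_rfl], by rwa [ancestor_eq_of_mem_cyl hT']⟩

theorem measurableSet_reachSet (r n : ℕ) (I : Finset ℕ) : MeasurableSet (reachSet r n I) := by
  simp_rw [reachSet, Set.ofPred_forall]
  exact MeasurableSet.iInter fun i => (measurableSet_reaches r n i).imp (.const _)

theorem measurableSet_infiniteType (r i : ℕ) :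
    MeasurableSet {T : PlanarTree | T.InfiniteType r i} := by
  simp_rw [infiniteType_iff_forall_reaches, Set.ofPred_forall]
  exact MeasurableSet.iInter fun n => measurableSet_reaches r n i

scoped instance : MeasurableSpace (Finset ℕ) := ⊤

scoped instance : DiscreteMeasurableSpace (Finset ℕ) := ⟨fun _ => trivial⟩

theorem measurable_infiniteVertices (r : ℕ) :
    Measurable fun T : PlanarTree => T.infiniteVertices r := by
  refine measurable_to_countable' fun I => ?_
  have hpreimage : (fun T : PlanarTree => T.infiniteVertices r) ⁻¹' {I} =
      ⋂ i, {T | T.InfiniteType r i ↔ i ∈ I} := by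
    ext T
    simp only [Set.mem_preimage, Set.mem_singleton_iff, Finset.ext_iff, mem_infiniteVertices,
      Set.mem_iInter, Set.mem_ofPred_eq]
  rw [hpreimage]
  exact MeasurableSet.iInter fun i => (measurableSet_infiniteType r i).iff (.const _)

theorem measurable_card_infiniteVertices (r : ℕ) :
    Measurable fun T : PlanarTree => (T.infiniteVertices r).card :=
  (Measurable.of_discrete (f := Finset.card)).comp (measurable_infiniteVertices r)

end InfiniteType

end PlanarTree

section SumsOverFinsets

open Finset MeasureTheory

theorem card_subtype_fin_mem {K : ℕ} {I : Finset ℕ} (hI : I ⊆ range K) :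
    Fintype.card {x : Fin K // x.1 ∈ I} = I.card := by
  rw [Fintype.card_subtype, ← card_map Fin.valEmbedding]
  congr 1
  ext i
  simp only [Finset.mem_map, mem_filter, mem_univ, true_and, Fin.valEmbedding_apply]
  exact ⟨fun ⟨_, hx, hxi⟩ => hxi ▸ hx, fun hi => ⟨⟨i, mem_range.1 (hI hi)⟩, hi, rfl⟩⟩

theorem card_subtype_fin_notMem {K : ℕ} {I : Finset ℕ} (hI : I ⊆ range K) :
    Fintype.card {x : Fin K // ¬ x.1 ∈ I} = K - I.card := by
  rw [Fintype.card_subtype_compl, card_subtype_fin_mem hI, Fintype.card_fin]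

theorem card_sub_countP {α : Type*} (m : Multiset α) (p : α → Prop) [DecidablePred p] :
    m.card - m.countP p = m.countP fun x => ¬ p x := by
  rw [Multiset.card_eq_countP_add_countP p m, Nat.add_sub_cancel_left]

theorem tsum_multiset_fin_pow_mul {K : ℕ} {I : Finset ℕ} (hI : I ⊆ range K) {c x G : ℝ}
    {g : ℕ → ℝ} (hc : 0 ≤ c) (hx₀ : 0 ≤ x) (hx₁ : x < 1)
    (hG : ∑' j, (I.card.multichoose j : ENNReal) * ENNReal.ofReal (g j) = ENNReal.ofReal G) :
    ∑' m : Multiset (Fin K), ENNReal.ofReal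
        (c * (x ^ (m.countP fun i => ¬ i.1 ∈ I) * g (m.countP fun i => i.1 ∈ I))) =
      ENNReal.ofReal (c * (1 / (1 - x) ^ (K - I.card) * G)) := by
  have hpow : 0 ≤ 1 / (1 - x) ^ (K - I.card) := by
    have : 0 < 1 - x := sub_pos.2 hx₁
    positivity
  rw [tsum_multiset_countP (fun i : Fin K => i.1 ∈ I) fun j k => ENNReal.ofReal (c * (x ^ k * g j)),
    card_subtype_fin_mem hI, card_subtype_fin_notMem hI, ENNReal.ofReal_mul hc,
    ENNReal.ofReal_mul hpow, ← hG, ← tsum_natCast_mul_ofReal (fun k => pow_nonneg hx₀ k)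
      (hasSum_multichoose_mul_pow _ (abs_lt.2 ⟨by linarith, hx₁⟩)),
    ← ENNReal.tsum_mul_left, ← ENNReal.tsum_mul_left]
  refine tsum_congr fun j => ?_
  rw [← ENNReal.tsum_mul_right, ← ENNReal.tsum_mul_left, ← ENNReal.tsum_mul_left]
  refine tsum_congr fun k => ?_
  rw [ENNReal.ofReal_mul hc, ENNReal.ofReal_mul (by positivity)]
  ring

theorem eq_of_sum_powerset_eq {α : Type*} {U : Finset α} {f g : Finset α → ENNReal}
    (hg : ∀ I, g I ≠ ⊤) (h : ∀ I ⊆ U, ∑ J ∈ I.powerset, f J = ∑ J ∈ I.powerset, g J)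
    {I : Finset α} (hI : I ⊆ U) : f I = g I := by
  classical
  induction I using Finset.strongInduction with
  | H I ih =>
    have hsum := h I hI
    have hpowerset : I.powerset = insert I I.ssubsets := by
      ext J
      rw [mem_insert, mem_powerset, mem_ssubsets, subset_iff_ssubset_or_eq, or_comm]
    have hnotMem : I ∉ I.ssubsets := fun hI => (mem_ssubsets.1 hI).ne rfl
    rw [hpowerset, sum_insert hnotMem, sum_insert hnotMem, sum_congr rfl fun J hJ =>
      ih J (mem_ssubsets.1 hJ) ((mem_ssubsets.1 hJ).subset.trans hI)] at hsum
    exact (ENNReal.add_left_inj (ENNReal.sum_ne_top.2 fun J _ => hg J)).1 hsum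

theorem sum_powerset_natCast_choose {α R : Type*} [Semiring R] (I : Finset α) (φ : ℕ → R) :
    ∑ J ∈ I.powerset, φ J.card = ∑ s ∈ range (I.card + 1), (I.card.choose s : R) * φ s := by
  simp only [sum_powerset_apply_card, nsmul_eq_mul]

theorem sum_range_choose_mul_eq_sum_range {R : Type*} [Semiring R] (k : ℕ) {s : ℕ} {φ : ℕ → R}
    (hφ : ∀ i, s < i → φ i = 0) :
    ∑ i ∈ range (k + 1), (k.choose i : R) * φ i = ∑ i ∈ range (s + 1), (k.choose i : R) * φ i := by
  rw [sum_subset (range_mono (le_max_left (k + 1) (s + 1))),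
    sum_subset (range_mono (le_max_right (k + 1) (s + 1)))]
  · exact fun i _ hi => by rw [hφ i (by simpa using hi), mul_zero]
  · exact fun i _ hi => by
      rw [Nat.choose_eq_zero_of_lt (by simpa using hi), Nat.cast_zero, zero_mul]

theorem measure_subset_inter_eq_sum_powerset {Ω α : Type*} [MeasurableSpace Ω] (ν : Measure Ω)
    {X : Ω → Finset α} (hX : ∀ J, MeasurableSet {ω | X ω = J}) (I : Finset α) (A : Set Ω) :
    ν ({ω | X ω ⊆ I} ∩ A) = ∑ J ∈ I.powerset, ν ({ω | X ω = J} ∩ A) := by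
  have hpreimage : {ω | X ω ⊆ I} = X ⁻¹' ↑I.powerset := by
    ext ω
    simp
  have hmeas : MeasurableSet {ω | X ω ⊆ I} := by
    have hunion : {ω | X ω ⊆ I} = ⋃ J ∈ I.powerset, {ω | X ω = J} := by
      ext ω
      simp
    exact hunion ▸ I.powerset.measurableSet_biUnion fun J _ => hX J
  rw [← Measure.restrict_apply hmeas, hpreimage, ← sum_measure_preimage_singleton _ fun J _ => hX J]
  exact sum_congr rfl fun J _ => Measure.restrict_apply (hX J)

theorem half_pow_sub {k K : ℕ} (h : k ≤ K) : ((1 : ℝ) / 2) ^ (K - k) = 2 ^ k / 2 ^ K := by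
  rw [one_div, inv_pow, inv_eq_iff_eq_inv, inv_div, pow_sub₀ _ two_ne_zero h, div_eq_mul_inv]

end SumsOverFinsets

section Extinction

open Filter Topology

/-- The sum of `4⁻¹ ^ (number of vertices)` over the rooted plane trees of height less than `n`: the
total weight of the possible descendants of a vertex that has none `n` generations later. -/
noncomputable def extinction (n : ℕ) : ℝ := n / (2 * (n + 1))

theorem extinction_zero : extinction 0 = 0 := by
  rw [extinction, Nat.cast_zero, zero_div]

theorem extinction_nonneg (n : ℕ) : 0 ≤ extinction n := by
  rw [extinction]
  positivity

theorem extinction_lt_one (n : ℕ) : extinction n < 1 := by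
  rw [extinction, div_lt_one (by positivity)]
  linarith [(n.cast_nonneg : (0 : ℝ) ≤ n)]

theorem extinction_succ (n : ℕ) : extinction (n + 1) = 1 / (1 - extinction n) / 4 := by
  have hcompl : 1 - extinction n = (n + 2) / (2 * (n + 1)) := by
    rw [extinction]
    field_simp
    ring
  rw [hcompl, extinction]
  push_cast
  field_simp
  ring

theorem tendsto_extinction : Tendsto extinction atTop (𝓝 (1 / 2)) := by
  refine ((tendsto_natCast_div_add_atTop (1 : ℝ)).div_const 2).congr fun n => ?_
  rw [extinction]
  field_simp

end Extinction

namespace PlanarTree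

section JointLaw

open Filter Topology Finset MeasureTheory

variable {μ : ℝ} {ν : Measure PlanarTree}

/-- The part of `cylWeight μ S r` that depends on the generations of `S` below height `r + 1`
only through their shape: a factor `exp (-μ)` per generation and `1 / 4` per edge. -/
noncomputable def historyWeight (μ : ℝ) (S : PlanarTree) (r : ℕ) : ℝ :=
  Real.exp (-μ) ^ r / 4 ^ S.sizeUpTo r

theorem historyWeight_nonneg (μ : ℝ) (S : PlanarTree) (r : ℕ) : 0 ≤ historyWeight μ S r := by
  rw [historyWeight]
  positivity

theorem cylWeight_eq_historyWeight_mul (μ : ℝ) (S : PlanarTree) (r : ℕ) :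
    cylWeight μ S r = historyWeight μ S r * limitWeight μ (S.gen (r + 1)) := by
  rw [cylWeight, historyWeight]
  ring

theorem historyWeight_extend (μ : ℝ) (S : PlanarTree) (r : ℕ)
    (m : Multiset (Fin (S.gen (r + 1)))) :
    historyWeight μ (S.extend (r + 1) m) (r + 1) =
      historyWeight μ S r * (Real.exp (-μ) / 4 ^ S.gen (r + 1)) := by
  rw [historyWeight, sizeUpTo_eq_of_mem_cyl (extend_mem_cyl (Nat.le_add_left 1 r) m),
    sizeUpTo_succ, historyWeight, pow_succ, pow_add]
  field_simp

theorem measure_inter_cyl_eq_tsum {A : Set PlanarTree} (hA : MeasurableSet A) (S : PlanarTree)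
    (r : ℕ) (B : Multiset (Fin (S.gen (r + 1))) → Set PlanarTree)
    (hB : ∀ m, ∀ T ∈ cyl (S.extend (r + 1) m) (r + 2), T ∈ A ↔ T ∈ B m) :
    ν (A ∩ cyl S (r + 1)) = ∑' m, ν (B m ∩ cyl (S.extend (r + 1) m) (r + 2)) := by
  rw [measure_inter_cyl ν hA S (Nat.le_add_left 1 r)]
  exact tsum_congr fun m => congrArg ν (Set.ext fun T => and_congr_left (hB m T))

theorem measure_reachSet_zero_inter_cyl
    (hν : ∀ S r, ν (cyl S (r + 1)) = ENNReal.ofReal (cylWeight μ S r)) (S : PlanarTree)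
    (r : ℕ) {I : Finset ℕ} (hI : I ⊆ range (S.gen (r + 1))) :
    ν (reachSet (r + 1) 0 I ∩ cyl S (r + 1)) = ENNReal.ofReal (historyWeight μ S r *
      (0 ^ (S.gen (r + 1) - I.card) * limitWeight μ I.card)) := by
  rcases hI.eq_or_ssubset with rfl | hlt
  · have hinter : reachSet (r + 1) 0 (range (S.gen (r + 1))) ∩ cyl S (r + 1) = cyl S (r + 1) := by
      refine Set.inter_eq_right.2 fun T hT i hi => ?_
      rw [mem_range, ← gen_eq_of_mem_cyl hT le_rfl]
      exact hi.lt
    rw [hinter, hν, cylWeight_eq_historyWeight_mul, card_range, Nat.sub_self, pow_zero, one_mul]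
  · have hcard : I.card < S.gen (r + 1) := by simpa only [card_range] using card_lt_card hlt
    have hinter : reachSet (r + 1) 0 I ∩ cyl S (r + 1) = ∅ := by
      refine Set.eq_empty_of_forall_notMem fun T hT => ?_
      obtain ⟨i, hi, hiI⟩ := exists_of_ssubset hlt
      refine hiI (hT.1 i (reaches_zero.2 ?_))
      rwa [gen_eq_of_mem_cyl hT.2 le_rfl, ← mem_range]
    rw [hinter, measure_empty, zero_pow (Nat.sub_ne_zero_of_lt hcard), zero_mul, mul_zero,
      ENNReal.ofReal_zero]

theorem measure_reachSet_inter_cyl (hμ : 0 ≤ μ)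
    (hν : ∀ S r, ν (cyl S (r + 1)) = ENNReal.ofReal (cylWeight μ S r)) (n : ℕ) (S : PlanarTree)
    (r : ℕ) {I : Finset ℕ} (hI : I ⊆ range (S.gen (r + 1))) :
    ν (reachSet (r + 1) n I ∩ cyl S (r + 1)) = ENNReal.ofReal (historyWeight μ S r *
      (extinction n ^ (S.gen (r + 1) - I.card) * limitWeight μ I.card)) := by
  induction n generalizing S r I with
  | zero => rw [extinction_zero, measure_reachSet_zero_inter_cyl hν S r hI]
  | succ n ih =>
    rw [measure_inter_cyl_eq_tsum (measurableSet_reachSet _ _ _) S r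
      (fun m => reachSet (r + 2) n ((S.extend (r + 1) m).children (r + 1) I))
      fun m T hT => by rw [mem_reachSet_succ, children_eq_of_mem_cyl hT]]
    have hextend (m) : ν (reachSet (r + 2) n ((S.extend (r + 1) m).children (r + 1) I) ∩
        cyl (S.extend (r + 1) m) (r + 2)) =
        ENNReal.ofReal (historyWeight μ S r * (Real.exp (-μ) / 4 ^ S.gen (r + 1)) *
          (extinction n ^ (m.countP fun i => ¬ i.1 ∈ I) *
            limitWeight μ (m.countP fun i => i.1 ∈ I))) := by
      rw [ih _ _ (children_subset_range _ _ _), historyWeight_extend,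
        card_children_extend S (Nat.le_add_left 1 r), gen_extend (Nat.le_add_left 1 r),
        card_sub_countP]
    simp_rw [hextend]
    rw [tsum_multiset_fin_pow_mul hI (mul_nonneg (historyWeight_nonneg μ S r) (by positivity))
      (extinction_nonneg n) (extinction_lt_one n) (tsum_multichoose_mul_limitWeight hμ I.card),
      extinction_succ, Real.exp_neg]
    congr 1
    have hle : I.card ≤ S.gen (r + 1) := by simpa only [card_range] using card_le_card hI
    obtain ⟨d, hd⟩ := Nat.exists_eq_add_of_le hle
    rw [hd, Nat.add_sub_cancel_left, pow_add, div_pow, div_pow, one_pow]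
    field_simp

theorem measure_infiniteVertices_subset (hμ : 0 ≤ μ)
    (hν : ∀ S r, ν (cyl S (r + 1)) = ENNReal.ofReal (cylWeight μ S r)) (S : PlanarTree)
    (r : ℕ) {I : Finset ℕ} (hI : I ⊆ range (S.gen (r + 1))) :
    ν ({T | T.infiniteVertices (r + 1) ⊆ I} ∩ cyl S (r + 1)) =
      ENNReal.ofReal (historyWeight μ S r *
        ((1 / 2) ^ (S.gen (r + 1) - I.card) * limitWeight μ I.card)) := by
  have hlim : Tendsto (fun n => ν (reachSet (r + 1) n I ∩ cyl S (r + 1))) atTop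
      (𝓝 (ν ({T | T.infiniteVertices (r + 1) ⊆ I} ∩ cyl S (r + 1)))) := by
    rw [← iUnion_reachSet, Set.iUnion_inter]
    exact tendsto_measure_iUnion_atTop fun n m hnm =>
      Set.inter_subset_inter_left _ (monotone_reachSet (r + 1) I hnm)
  refine tendsto_nhds_unique hlim ?_
  simp_rw [measure_reachSet_inter_cyl hμ hν _ S r hI]
  exact ENNReal.tendsto_ofReal (((tendsto_extinction.pow _).mul_const _).const_mul _)

theorem measurableSet_infiniteVertices_eq (r : ℕ) (J : Finset ℕ) :
    MeasurableSet {T : PlanarTree | T.infiniteVertices r = J} :=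
  measurable_infiniteVertices r (.singleton J)

/-- The probability that a tree agrees with `S` up to height `r + 1` and that its set of vertices of
infinite type at that height is a prescribed set of `s` vertices of `S`. -/
noncomputable def spineWeight (μ : ℝ) (S : PlanarTree) (r s : ℕ) : ℝ :=
  historyWeight μ S r * (2 ^ s / 2 ^ S.gen (r + 1) * infiniteWeight μ s)

theorem spineWeight_nonneg (hμ : 0 ≤ μ) (S : PlanarTree) (r s : ℕ) : 0 ≤ spineWeight μ S r s :=
  mul_nonneg (historyWeight_nonneg μ S r)
    (mul_nonneg (by positivity) (infiniteWeight_nonneg hμ s))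

theorem measure_infiniteVertices_eq (hμ : 0 ≤ μ)
    (hν : ∀ S r, ν (cyl S (r + 1)) = ENNReal.ofReal (cylWeight μ S r)) (S : PlanarTree)
    (r : ℕ) {I : Finset ℕ} (hI : I ⊆ range (S.gen (r + 1))) :
    ν ({T | T.infiniteVertices (r + 1) = I} ∩ cyl S (r + 1)) =
      ENNReal.ofReal (spineWeight μ S r I.card) := by
  refine eq_of_sum_powerset_eq (f := fun I =>
    ν ({T | T.infiniteVertices (r + 1) = I} ∩ cyl S (r + 1)))
    (g := fun I => ENNReal.ofReal (spineWeight μ S r I.card))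
    (fun _ => ENNReal.ofReal_ne_top) (fun I hI => ?_) hI
  have hle : I.card ≤ S.gen (r + 1) := by simpa only [card_range] using card_le_card hI
  rw [← measure_subset_inter_eq_sum_powerset ν (measurableSet_infiniteVertices_eq (r + 1)),
    measure_infiniteVertices_subset hμ hν S r hI, half_pow_sub hle,
    ← ENNReal.ofReal_sum_of_nonneg fun J _ => spineWeight_nonneg hμ S r J.card,
    sum_powerset_natCast_choose I (spineWeight μ S r)]
  congr 1
  rw [limitWeight, mul_sum, mul_sum]
  refine sum_congr rfl fun s _ => ?_
  rw [spineWeight]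
  field_simp

theorem measure_infiniteVertices_subset_inter_card (hμ : 0 ≤ μ)
    (hν : ∀ S r, ν (cyl S (r + 1)) = ENNReal.ofReal (cylWeight μ S r)) (S : PlanarTree)
    (r s : ℕ) {I : Finset ℕ} (hI : I ⊆ range (S.gen (r + 1))) :
    ν ({T | T.infiniteVertices (r + 1) ⊆ I ∧ (T.infiniteVertices (r + 1)).card = s} ∩
      cyl S (r + 1)) = ENNReal.ofReal (I.card.choose s * spineWeight μ S r s) := by
  have hset : {T : PlanarTree | T.infiniteVertices (r + 1) ⊆ I ∧
      (T.infiniteVertices (r + 1)).card = s} =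
      ⋃ J ∈ powersetCard s I, {T | T.infiniteVertices (r + 1) = J} := by
    ext T
    simp
  rw [hset, Set.iUnion₂_inter, measure_biUnion_finset
    (fun J _ J' _ hne => Set.disjoint_left.2 fun T hT hT' => hne (hT.1.symm.trans hT'.1))
    fun J _ => (measurableSet_infiniteVertices_eq (r + 1) J).inter (measurableSet_cyl _ _),
    sum_congr rfl fun J hJ => ?_, sum_const, card_powersetCard, nsmul_eq_mul,
    ENNReal.ofReal_mul (Nat.cast_nonneg _), ENNReal.ofReal_natCast]
  rw [measure_infiniteVertices_eq hμ hν S r ((mem_powersetCard.1 hJ).1.trans hI),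
    (mem_powersetCard.1 hJ).2]

theorem measure_infiniteVertices_subset_inter_card_succ (hμ : 0 ≤ μ)
    (hν : ∀ S r, ν (cyl S (r + 1)) = ENNReal.ofReal (cylWeight μ S r)) (S : PlanarTree)
    (r s : ℕ) {I : Finset ℕ} (hI : I ⊆ range (S.gen (r + 1))) :
    ν ({T | T.infiniteVertices (r + 1) ⊆ I ∧ (T.infiniteVertices (r + 2)).card = s} ∩
      cyl S (r + 1)) =
      ENNReal.ofReal (historyWeight μ S r * (Real.exp (-μ) / 4 ^ S.gen (r + 1)) *
        (2 ^ (S.gen (r + 1) - I.card) *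
          (I.card.multichoose s * 2 ^ (I.card + s) * infiniteWeight μ s))) := by
  have hmeas : MeasurableSet {T : PlanarTree | T.infiniteVertices (r + 1) ⊆ I ∧
      (T.infiniteVertices (r + 2)).card = s} := by
    rw [Set.ofPred_and]
    exact (measurable_infiniteVertices (r + 1) (.of_discrete (s := {J | J ⊆ I}))).inter
      (measurable_card_infiniteVertices (r + 2) (.singleton s))
  rw [measure_inter_cyl_eq_tsum hmeas S r
    (fun m => {T | T.infiniteVertices (r + 2) ⊆ (S.extend (r + 1) m).children (r + 1) I ∧
      (T.infiniteVertices (r + 2)).card = s})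
    fun m T hT => and_congr_left fun _ => by
      rw [infiniteVertices_subset_iff, children_eq_of_mem_cyl hT]]
  have hextend (m) : ν ({T | T.infiniteVertices (r + 2) ⊆
      (S.extend (r + 1) m).children (r + 1) I ∧ (T.infiniteVertices (r + 2)).card = s} ∩
      cyl (S.extend (r + 1) m) (r + 2)) =
      ENNReal.ofReal (historyWeight μ S r * (Real.exp (-μ) / 4 ^ S.gen (r + 1)) *
        ((1 / 2) ^ (m.countP fun i => ¬ i.1 ∈ I) *
          ((m.countP fun i => i.1 ∈ I).choose s * 2 ^ s / 2 ^ (m.countP fun i => i.1 ∈ I) *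
            infiniteWeight μ s))) := by
    rw [measure_infiniteVertices_subset_inter_card hμ hν _ _ s (children_subset_range _ _ _),
      card_children_extend S (Nat.le_add_left 1 r), spineWeight, historyWeight_extend,
      gen_extend (Nat.le_add_left 1 r), ← card_sub_countP,
      half_pow_sub (Multiset.countP_le_card _ _)]
    congr 1
    field_simp
  simp_rw [hextend]
  rw [tsum_multiset_fin_pow_mul hI (mul_nonneg (historyWeight_nonneg μ S r) (by positivity))
    (by norm_num) (by norm_num)
    (g := fun j => (j.choose s * 2 ^ s / 2 ^ j * infiniteWeight μ s))
    (tsum_multichoose_mul_choose hμ I.card s), sub_half, one_div_pow, one_div_one_div]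

/-- The probability that `s` vertices at some height are of infinite type, given that `i` vertices
one generation earlier are. -/
noncomputable def spineTransition (μ : ℝ) (i s : ℕ) : ℝ :=
  if i ≤ s then Real.exp (-μ) * (μ ^ (s - i) / (s - i).factorial) else 0

theorem spineTransition_nonneg (hμ : 0 ≤ μ) (i s : ℕ) : 0 ≤ spineTransition μ i s := by
  rw [spineTransition]
  split_ifs <;> positivity

theorem measure_infiniteVertices_eq_inter_card_succ (hμ : 0 ≤ μ)
    (hν : ∀ S r, ν (cyl S (r + 1)) = ENNReal.ofReal (cylWeight μ S r)) (S : PlanarTree)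
    (r s : ℕ) {I : Finset ℕ} (hI : I ⊆ range (S.gen (r + 1))) :
    ν ({T | T.infiniteVertices (r + 1) = I} ∩
      ({T | (T.infiniteVertices (r + 2)).card = s} ∩ cyl S (r + 1))) =
      ENNReal.ofReal (spineWeight μ S r I.card * spineTransition μ I.card s) := by
  refine eq_of_sum_powerset_eq (f := fun I => ν ({T | T.infiniteVertices (r + 1) = I} ∩
      ({T | (T.infiniteVertices (r + 2)).card = s} ∩ cyl S (r + 1))))
    (g := fun I => ENNReal.ofReal (spineWeight μ S r I.card * spineTransition μ I.card s))
    (fun _ => ENNReal.ofReal_ne_top) (fun I hI => ?_) hI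
  rw [← measure_subset_inter_eq_sum_powerset ν (measurableSet_infiniteVertices_eq (r + 1)),
    ← Set.inter_assoc, ← ENNReal.ofReal_sum_of_nonneg fun J _ =>
      mul_nonneg (spineWeight_nonneg hμ S r J.card) (spineTransition_nonneg hμ J.card s),
    sum_powerset_natCast_choose I fun i => spineWeight μ S r i * spineTransition μ i s,
    sum_range_choose_mul_eq_sum_range _ fun i hi => by
      rw [spineTransition, if_neg (not_le.2 hi), mul_zero]]
  refine (measure_infiniteVertices_subset_inter_card_succ hμ hν S r s hI).trans ?_
  rw [multichoose_mul_infiniteWeight, mul_sum, mul_sum, mul_sum]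
  congr 1
  refine sum_congr rfl fun i hi => ?_
  rw [spineTransition, if_pos (Nat.lt_succ_iff.1 (mem_range.1 hi)), spineWeight]
  have hle : I.card ≤ S.gen (r + 1) := by simpa only [card_range] using card_le_card hI
  obtain ⟨d, hd⟩ := Nat.exists_eq_add_of_le hle
  have hfour (n : ℕ) : (4 : ℝ) ^ n = 2 ^ n * 2 ^ n := by rw [← mul_pow]; norm_num
  rw [hd, Nat.add_sub_cancel_left, hfour, hfour, pow_add]
  field_simp

end JointLaw

end PlanarTree

section Independence

open MeasureTheory ProbabilityTheory

theorem preimage_image_eq_of_forall_mem {α β : Type*} {X : α → β} {A : Set α}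
    (h : ∀ a b, X a = X b → a ∈ A → b ∈ A) : X ⁻¹' (X '' A) = A :=
  (Set.subset_preimage_image X A).antisymm' fun _ ⟨a, ha, hab⟩ => h a _ hab ha

theorem measurable_of_factorsThrough {α β γ : Type*} [MeasurableSpace α] [MeasurableSpace β]
    [MeasurableSpace γ] [DiscreteMeasurableSpace γ] {X : α → γ} {f : α → β} (hX : Measurable X)
    (hf : f.FactorsThrough X) : Measurable f := fun B _ => by
  rw [← preimage_image_eq_of_forall_mem (X := X) (A := f ⁻¹' B) fun a b hab ha => by
    rwa [Set.mem_preimage, ← hf hab]]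
  exact hX .of_discrete

variable {Ω : Type*} [MeasurableSpace Ω] {P : Measure Ω}

theorem hasLaw_and_indepFun_of_measure_inter_singleton {α β : Type*} [MeasurableSpace α]
    [MeasurableSpace β] [Countable α] [Countable β] [MeasurableSingletonClass α]
    [MeasurableSingletonClass β] [IsProbabilityMeasure P] {X : Ω → α} {Y : Ω → β} {κ : Measure β}
    (hX : Measurable X) (hY : Measurable Y)
    (h : ∀ x y, P (X ⁻¹' {x} ∩ Y ⁻¹' {y}) = P (X ⁻¹' {x}) * κ {y}) :
    HasLaw Y κ P ∧ IndepFun X Y P := by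
  have : IsProbabilityMeasure (P.map X) := Measure.isProbabilityMeasure_map hX.aemeasurable
  have hpair : P.map (fun ω => (X ω, Y ω)) = (P.map X).prod κ := by
    refine Measure.ext_of_singleton fun ⟨x, y⟩ => ?_
    rw [Measure.map_apply (hX.prodMk hY) (.singleton _), ← Set.singleton_prod_singleton,
      Measure.prod_prod, Measure.map_apply hX (.singleton x), Set.mk_preimage_prod, h]
  have hlaw : HasLaw Y κ P := by
    refine ⟨hY.aemeasurable, ?_⟩
    rw [← Measure.snd_map_prodMk hX, hpair, Measure.snd_prod]
  exact ⟨hlaw, (indepFun_iff_hasLaw_prodMk_prod ⟨hX.aemeasurable, rfl⟩ hlaw).2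
    ⟨(hX.prodMk hY).aemeasurable, hpair⟩⟩

theorem iIndepFun_of_indepFun_history {ι : Type*} [LinearOrder ι] {α β : ι → Type*}
    [∀ i, MeasurableSpace (α i)] [∀ i, DiscreteMeasurableSpace (α i)]
    [∀ i, MeasurableSpace (β i)] [IsProbabilityMeasure P] {X : ∀ i, Ω → α i} {Y : ∀ i, Ω → β i}
    (hXY : ∀ i, IndepFun (X i) (Y i) P)
    (hhistory : ∀ i j, j < i → (Y j).FactorsThrough (X i)) : iIndepFun Y P := by
  rw [iIndepFun_iff_measure_inter_preimage_eq_mul]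
  intro J B hB
  induction J using Finset.induction_on_max with
  | empty => simp only [Finset.notMem_empty, Set.iInter_of_empty, Set.iInter_univ, measure_univ,
      Finset.prod_empty]
  | insert i J hJ ih =>
    have hi : i ∉ J := fun hi => (hJ i hi).false
    have hpast : X i ⁻¹' (X i '' ⋂ j ∈ J, Y j ⁻¹' B j) = ⋂ j ∈ J, Y j ⁻¹' B j := by
      refine preimage_image_eq_of_forall_mem fun ω ω' hω hmem => ?_
      simp only [Set.mem_iInter, Set.mem_preimage] at hmem ⊢
      exact fun j hj => hhistory i j (hJ j hj) hω ▸ hmem j hj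
    rw [Finset.prod_insert hi, ← ih fun j hj => hB j (Finset.mem_insert_of_mem hj),
      Finset.set_biInter_insert, Set.inter_comm, ← hpast,
      (hXY i).measure_inter_preimage_eq_mul _ _ .of_discrete (hB i (Finset.mem_insert_self i J)),
      mul_comm]

end Independence

namespace PlanarTree

section SpineMap

open Finset MeasureTheory

theorem measurable_parents (r : ℕ) : Measurable fun T : PlanarTree => T.parents r :=
  fun _ _ => measurableSet_of_cyl_subset (r := r + 1) fun T hT T' hT' => by
    rwa [Set.mem_preimage, hT' r (Nat.lt_succ_self r)]

theorem measurable_gen (r : ℕ) : Measurable fun T : PlanarTree => T.gen r :=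
  fun _ _ => measurableSet_of_cyl_subset (r := r) fun T hT T' hT' => by
    rwa [Set.mem_preimage, gen_eq_of_mem_cyl hT' le_rfl]

theorem measurableSet_size_eq_top : MeasurableSet {T : PlanarTree | T.size = ⊤} := by
  simp_rw [size_eq_top_iff, Set.ofPred_forall]
  exact MeasurableSet.iInter fun r => (measurable_gen r (.singleton 0)).compl

theorem spine_parents_factorsThrough (r : ℕ) :
    (fun T : InfiniteTree => (spine T).parents r).FactorsThrough fun T =>
      (T.1.parents r, T.1.infiniteVertices r, T.1.infiniteVertices (r + 1)) := by
  classical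
  intro S T h
  obtain ⟨hparents, hr, hr_succ⟩ : S.1.parents r = T.1.parents r ∧
      S.1.infiniteVertices r = T.1.infiniteVertices r ∧
      S.1.infiniteVertices (r + 1) = T.1.infiniteVertices (r + 1) := by
    simpa only [Prod.mk.injEq] using h
  have hparent : S.1.parent r = T.1.parent r := by
    funext i
    rw [parent_eq_getD, parent_eq_getD, hparents]
  have hgen : S.1.gen (r + 1) = T.1.gen (r + 1) := by rw [← card_parents, ← card_parents, hparents]
  have htype (s) (hs : S.1.infiniteVertices s = T.1.infiniteVertices s) :
      S.1.InfiniteType s = T.1.InfiniteType s := by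
    funext i
    rw [← mem_infiniteVertices, ← mem_infiniteVertices, hs]
  simp only [parents, gen_spine, hr_succ]
  refine Multiset.map_congr rfl fun i _ => ?_
  simp only [spine, htype r hr, htype (r + 1) hr_succ, hparent, hgen]

theorem measurable_spine : Measurable spine :=
  measurable_of_parents fun r m => measurable_of_factorsThrough
    (((measurable_parents r).comp measurable_subtype_coe).prodMk
      (((measurable_infiniteVertices r).comp measurable_subtype_coe).prodMk
        ((measurable_infiniteVertices (r + 1)).comp measurable_subtype_coe)))
    (spine_parents_factorsThrough r) (.singleton m)

theorem measurable_increment (r : ℕ) : Measurable (increment r) :=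
  have hgen (s) : Measurable fun T : SpineTree => (T.1.gen s : ℤ) :=
    Measurable.of_discrete.comp ((measurable_gen s).comp measurable_subtype_coe)
  (hgen (r + 1)).sub (hgen r)

theorem card_infiniteVertices_le_succ (T : PlanarTree) (r : ℕ) :
    (T.infiniteVertices r).card ≤ (T.infiniteVertices (r + 1)).card := by
  rw [infiniteVertices_eq_image]
  exact card_image_le

/-- The increment of the number of vertices of infinite type from height `r` to height `r + 1`. The
subtraction does not truncate, by `card_infiniteVertices_le_succ`. -/
noncomputable def infiniteIncrement (r : ℕ) (T : PlanarTree) : ℕ :=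
  (T.infiniteVertices (r + 1)).card - (T.infiniteVertices r).card

theorem card_infiniteVertices_add_infiniteIncrement (r : ℕ) (T : PlanarTree) :
    (T.infiniteVertices r).card + infiniteIncrement r T = (T.infiniteVertices (r + 1)).card :=
  Nat.add_sub_cancel' (T.card_infiniteVertices_le_succ r)

theorem measurable_infiniteIncrement (r : ℕ) : Measurable (infiniteIncrement r) :=
  (measurable_card_infiniteVertices (r + 1)).sub (measurable_card_infiniteVertices r)

theorem increment_rangeFactorization_spine (r : ℕ) (T : InfiniteTree) :
    increment r (Set.rangeFactorization spine T) = (infiniteIncrement r T.1 : ℤ) := by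
  rw [infiniteIncrement, Nat.cast_sub (T.1.card_infiniteVertices_le_succ r), increment,
    ← gen_spine, ← gen_spine]
  rfl

/-- The first generations of a tree, up to height `r`, together with its set of vertices of infinite
type at height `r`. -/
noncomputable def spineHistory (r : ℕ) (T : PlanarTree) : (Fin r → Multiset ℕ) × Finset ℕ :=
  (fun s => T.parents s, T.infiniteVertices r)

theorem measurable_spineHistory (r : ℕ) : Measurable (spineHistory r) :=
  (measurable_pi_lambda _ fun s : Fin r => measurable_parents s.1).prodMk
    (measurable_infiniteVertices r)

theorem spineHistory_eq_iff {S T : PlanarTree} {r : ℕ} : spineHistory r T = spineHistory r S ↔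
    T.infiniteVertices r = S.infiniteVertices r ∧ T ∈ cyl S r := by
  simp only [spineHistory, Prod.mk.injEq, funext_iff, Fin.forall_iff]
  exact and_comm

theorem infiniteIncrement_factorsThrough {r s : ℕ} (hs : s < r) :
    (infiniteIncrement s).FactorsThrough (spineHistory r) := by
  intro S T h
  obtain ⟨hr, hcyl⟩ := spineHistory_eq_iff.1 h
  rw [infiniteIncrement, infiniteIncrement, infiniteVertices_eq_of_mem_cyl hcyl hr hs,
    infiniteVertices_eq_of_mem_cyl hcyl hr hs.le]

end SpineMap

section SpineMeasure

open Finset MeasureTheory ProbabilityTheory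

variable {μ : ℝ} {ν : Measure PlanarTree}

theorem ae_infiniteVertices_one (hμ : 0 < μ) (h : IsLocalLimit μ ν) :
    ∀ᵐ T ∂ν, T.infiniteVertices 1 = {0} := by
  have := h.1
  obtain ⟨S⟩ := (inferInstance : Nonempty PlanarTree)
  have hmeasure := measure_infiniteVertices_eq hμ.le (h.measure_cyl hμ) S 0 (I := {0})
    (by rw [zero_add, S.gen_one, range_one])
  rw [cyl_one, Set.inter_univ] at hmeasure
  refine (prob_compl_eq_zero_iff (measurableSet_infiniteVertices_eq 1 {0})).2 (hmeasure.trans ?_)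
  simp [spineWeight, historyWeight, S.gen_one, infiniteWeight, sizeUpTo]

theorem ae_infiniteVertices_card_pos (hμ : 0 < μ) (h : IsLocalLimit μ ν) (r : ℕ) :
    ∀ᵐ T ∂ν, 0 < (T.infiniteVertices (r + 1)).card := by
  filter_upwards [ae_infiniteVertices_one hμ h] with T hT
  induction r with
  | zero => rw [hT, card_singleton]; exact one_pos
  | succ r ih => exact ih.trans_le (T.card_infiniteVertices_le_succ (r + 1))

theorem ae_size_eq_top (hμ : 0 < μ) (h : IsLocalLimit μ ν) : ∀ᵐ T ∂ν, T.size = ⊤ := by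
  filter_upwards [ae_infiniteVertices_one hμ h] with T hT
  rw [size_eq_top_iff]
  have htype : T.InfiniteType 1 0 := by
    rw [← mem_infiniteVertices, hT]
    exact mem_singleton_self 0
  rintro (_ | r)
  · rw [T.gen_zero]
    exact one_ne_zero
  · obtain ⟨j, hj, -⟩ := infiniteType_iff_forall_reaches.1 htype r
    rw [add_comm 1 r] at hj
    exact Nat.ne_zero_of_lt hj

theorem spineMeasure_apply (hμ : 0 < μ) (h : IsLocalLimit μ ν) {B : Set SpineTree}
    (hB : MeasurableSet B) {A : Set PlanarTree}
    (hAB : ∀ T : InfiniteTree, Set.rangeFactorization spine T ∈ B ↔ T.1 ∈ A) :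
    spineMeasure ν B = ν A := by
  have hspine : Measurable (Set.rangeFactorization spine) := measurable_spine.subtype_mk
  have hcoe : MeasurableEmbedding (Subtype.val : InfiniteTree → PlanarTree) :=
    .subtype_coe measurableSet_size_eq_top
  rw [spineMeasure, Measure.map_apply hspine hB, hcoe.comap_apply]
  refine measure_congr ?_
  filter_upwards [ae_size_eq_top hμ h] with T hT
  refine propext ⟨?_, fun hA => ⟨⟨T, hT⟩, (hAB _).2 hA, rfl⟩⟩
  rintro ⟨T, hTB, rfl⟩
  exact (hAB T).1 hTB

theorem isProbabilityMeasure_spineMeasure (hμ : 0 < μ) (h : IsLocalLimit μ ν) :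
    IsProbabilityMeasure (spineMeasure ν) := by
  have := h.1
  constructor
  rw [spineMeasure_apply hμ h .univ (A := Set.univ) fun _ => Iff.rfl, measure_univ]

theorem spineTransition_add (hμ : 0 ≤ μ) (k n : ℕ) :
    ENNReal.ofReal (spineTransition μ k (k + n)) = poissonMeasure μ.toNNReal {n} := by
  rw [spineTransition, if_pos (Nat.le_add_right k n), Nat.add_sub_cancel_left,
    poissonMeasure_singleton, Real.coe_toNNReal μ hμ, mul_div_assoc]

theorem measure_spineHistory_inter_infiniteIncrement (hμ : 0 < μ) (h : IsLocalLimit μ ν) (r : ℕ)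
    (x : (Fin (r + 1) → Multiset ℕ) × Finset ℕ) (n : ℕ) :
    ν (spineHistory (r + 1) ⁻¹' {x} ∩ infiniteIncrement (r + 1) ⁻¹' {n}) =
      ν (spineHistory (r + 1) ⁻¹' {x}) * poissonMeasure μ.toNNReal {n} := by
  rcases Set.eq_empty_or_nonempty (spineHistory (r + 1) ⁻¹' {x}) with hempty | ⟨S, rfl⟩
  · rw [hempty, Set.empty_inter, measure_empty, zero_mul]
  have hfibre : spineHistory (r + 1) ⁻¹' {spineHistory (r + 1) S} =
      {T | T.infiniteVertices (r + 1) = S.infiniteVertices (r + 1)} ∩ cyl S (r + 1) :=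
    Set.ext fun T => spineHistory_eq_iff
  have hinter : spineHistory (r + 1) ⁻¹' {spineHistory (r + 1) S} ∩
      infiniteIncrement (r + 1) ⁻¹' {n} =
      {T | T.infiniteVertices (r + 1) = S.infiniteVertices (r + 1)} ∩
        ({T | (T.infiniteVertices (r + 2)).card = (S.infiniteVertices (r + 1)).card + n} ∩
          cyl S (r + 1)) := by
    rw [hfibre, Set.inter_right_comm, Set.inter_assoc]
    refine Set.ext fun T => and_congr_right fun hT => and_congr_left fun _ => ?_
    rw [Set.mem_ofPred_eq, ← card_infiniteVertices_add_infiniteIncrement, hT, add_right_inj]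
    rfl
  have hrange := S.infiniteVertices_subset_range (r + 1)
  rw [hinter, measure_infiniteVertices_eq_inter_card_succ hμ.le (h.measure_cyl hμ) S r _ hrange,
    hfibre, measure_infiniteVertices_eq hμ.le (h.measure_cyl hμ) S r hrange,
    ENNReal.ofReal_mul (spineWeight_nonneg hμ.le S r _), spineTransition_add hμ.le]

theorem hasLaw_infiniteIncrement_and_indepFun (hμ : 0 < μ) (h : IsLocalLimit μ ν) (r : ℕ) :
    HasLaw (infiniteIncrement (r + 1)) (poissonMeasure μ.toNNReal) ν ∧
      IndepFun (spineHistory (r + 1)) (infiniteIncrement (r + 1)) ν :=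
  have := h.1
  hasLaw_and_indepFun_of_measure_inter_singleton (measurable_spineHistory _)
    (measurable_infiniteIncrement _) (measure_spineHistory_inter_infiniteIncrement hμ h r)

theorem iIndepFun_infiniteIncrement (hμ : 0 < μ) (h : IsLocalLimit μ ν) :
    iIndepFun (fun r : {r : ℕ // 1 ≤ r} => infiniteIncrement r.1) ν := by
  have := h.1
  refine iIndepFun_of_indepFun_history (X := fun r => spineHistory r.1) (fun r => ?_)
    fun _ _ => infiniteIncrement_factorsThrough
  obtain ⟨r, hr⟩ := Nat.exists_eq_add_of_le' r.2
  rw [hr]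
  exact (hasLaw_infiniteIncrement_and_indepFun hμ h r).2

theorem iIndepFun_increment (hμ : 0 < μ) (h : IsLocalLimit μ ν) :
    iIndepFun (fun r : {r : ℕ // 1 ≤ r} => increment r.1) (spineMeasure ν) := by
  have hindep := (iIndepFun_infiniteIncrement hμ h).comp (fun _ n => (n : ℤ)) fun _ => .of_discrete
  rw [iIndepFun_iff_measure_inter_preimage_eq_mul] at hindep ⊢
  intro J B hB
  have hmeas (i) (hi : i ∈ J) : MeasurableSet (increment i.1 ⁻¹' B i) :=
    measurable_increment i.1 (hB i hi)
  refine (spineMeasure_apply hμ h (J.measurableSet_biInter hmeas) fun T => ?_).trans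
    ((hindep J hB).trans (prod_congr rfl fun i hi =>
      (spineMeasure_apply hμ h (hmeas i hi) fun T => ?_).symm))
  · simp only [Set.mem_iInter, Set.mem_preimage, increment_rangeFactorization_spine,
      Function.comp_apply]
  · rw [Set.mem_preimage, Set.mem_preimage, increment_rangeFactorization_spine,
      Function.comp_apply]

theorem spineMeasure_increment (hμ : 0 < μ) (h : IsLocalLimit μ ν) {r : ℕ} (hr : 1 ≤ r) (n : ℕ) :
    spineMeasure ν {T | increment r T = (n : ℤ)} =
      ENNReal.ofReal (Real.exp (-μ) * (μ ^ n / (n.factorial : ℝ))) := by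
  obtain ⟨r, rfl⟩ := Nat.exists_eq_add_of_le' hr
  have hlift (T : InfiniteTree) :
      increment (r + 1) (Set.rangeFactorization spine T) = (n : ℤ) ↔
        infiniteIncrement (r + 1) T.1 = n := by
    rw [increment_rangeFactorization_spine, Nat.cast_inj]
  have hlaw := (hasLaw_infiniteIncrement_and_indepFun hμ h r).1
  refine (spineMeasure_apply hμ h (measurable_increment (r + 1) (.singleton (n : ℤ)))
    (A := {T | infiniteIncrement (r + 1) T = n}) hlift).trans
    ((hlaw.measure_eq (p := (· = n)) (.singleton n)).trans
      ((poissonMeasure_singleton _ n).trans ?_))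
  rw [Real.coe_toNNReal μ hμ.le, mul_div_assoc]

theorem hasLaw_card_infiniteVertices_sub_one (hμ : 0 < μ) (h : IsLocalLimit μ ν) (r : ℕ) :
    HasLaw (fun T : PlanarTree => (T.infiniteVertices (r + 1)).card - 1)
      (poissonMeasure (r * μ.toNNReal)) ν := by
  have := h.1
  induction r with
  | zero =>
    have hdirac : poissonMeasure ((0 : ℕ) * μ.toNNReal) = Measure.dirac 0 := by
      refine Measure.ext_of_singleton fun n => ?_
      rw [poissonMeasure_singleton]
      rcases n with _ | n <;> simp
    rw [hdirac]
    refine hasLaw_dirac_of_ae_eq ?_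
    filter_upwards [ae_infiniteVertices_one hμ h] with T hT
    rw [hT, card_singleton]
  | succ r ih =>
    obtain ⟨hlaw, hindep⟩ := hasLaw_infiniteIncrement_and_indepFun hμ h r
    have hindep_card : IndepFun (fun T : PlanarTree => (T.infiniteVertices (r + 1)).card - 1)
        (infiniteIncrement (r + 1)) ν :=
      hindep.comp (φ := fun x : (Fin (r + 1) → Multiset ℕ) × Finset ℕ => x.2.card - 1) (ψ := id)
        .of_discrete measurable_id
    rw [Nat.cast_succ, add_one_mul]
    refine (hindep_card.hasLaw_add_poissonMeasure ih hlaw).congr ?_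
    filter_upwards [ae_infiniteVertices_card_pos hμ h r] with T hT
    rw [Pi.add_apply, ← card_infiniteVertices_add_infiniteIncrement,
      Nat.sub_add_comm (Nat.one_le_iff_ne_zero.2 hT.ne')]

theorem spineMeasure_gen (hμ : 0 < μ) (h : IsLocalLimit μ ν) {r : ℕ} (hr : 1 ≤ r) {n : ℕ}
    (hn : 1 ≤ n) : spineMeasure ν {T | T.1.gen r = n} =
      ENNReal.ofReal (Real.exp (-(((r : ℝ) - 1) * μ)) *
        ((((r : ℝ) - 1) * μ) ^ (n - 1) / ((n - 1).factorial : ℝ))) := by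
  obtain ⟨r, rfl⟩ := Nat.exists_eq_add_of_le' hr
  have hmeas : MeasurableSet {T : SpineTree | T.1.gen (r + 1) = n} :=
    ((measurable_gen (r + 1)).comp measurable_subtype_coe) (.singleton n)
  have hcard : {T : PlanarTree | (T.infiniteVertices (r + 1)).card = n} =ᵐ[ν]
      {T | (T.infiniteVertices (r + 1)).card - 1 = n - 1} := by
    filter_upwards [ae_infiniteVertices_card_pos hμ h r] with T hT
    refine propext ?_
    change (T.infiniteVertices (r + 1)).card = n ↔ (T.infiniteVertices (r + 1)).card - 1 = n - 1
    lia
  have hlift (T : InfiniteTree) :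
      (spine T).gen (r + 1) = n ↔ (T.1.infiniteVertices (r + 1)).card = n := by
    rw [← gen_spine]
  have hlaw := hasLaw_card_infiniteVertices_sub_one hμ h r
  refine (spineMeasure_apply hμ h hmeas
      (A := {T | (T.infiniteVertices (r + 1)).card = n}) hlift).trans ((measure_congr hcard).trans
    ((hlaw.measure_eq (p := (· = n - 1)) (.singleton _)).trans
      ((poissonMeasure_singleton _ _).trans ?_)))
  rw [NNReal.coe_mul, NNReal.coe_natCast, Real.coe_toNNReal μ hμ.le, mul_div_assoc, Nat.cast_succ,
    add_sub_cancel_right]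

end SpineMeasure

end PlanarTree

theorem mainTheorem7 (μ : ℝ) (hμ : 0 < μ) :
    (∃! ν : MeasureTheory.Measure PlanarTree, PlanarTree.IsLocalLimit μ ν) ∧
    ∀ ν : MeasureTheory.Measure PlanarTree, PlanarTree.IsLocalLimit μ ν →
      MeasureTheory.IsProbabilityMeasure (PlanarTree.spineMeasure ν) ∧
      (∀ r : ℕ, 1 ≤ r → Measurable (PlanarTree.increment r)) ∧
      ProbabilityTheory.iIndepFun
        (fun r : {r : ℕ // 1 ≤ r} => PlanarTree.increment r.1) (PlanarTree.spineMeasure ν) ∧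
      (∀ r : ℕ, 1 ≤ r → ∀ n : ℕ,
        PlanarTree.spineMeasure ν {T | PlanarTree.increment r T = (n : ℤ)} =
          ENNReal.ofReal (Real.exp (-μ) * (μ ^ n / (n.factorial : ℝ)))) ∧
      (∀ r : ℕ, 2 ≤ r → ∀ R : ℕ, 1 ≤ R →
        PlanarTree.spineMeasure ν {T | T.1.gen r = R} =
          ENNReal.ofReal (Real.exp (-(((r : ℝ) - 1) * μ)) *
            ((((r : ℝ) - 1) * μ) ^ (R - 1) / ((R - 1).factorial : ℝ)))) :=
  ⟨PlanarTree.existsUnique_isLocalLimit hμ, fun _ h =>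
    ⟨PlanarTree.isProbabilityMeasure_spineMeasure hμ h,
      fun r _ => PlanarTree.measurable_increment r, PlanarTree.iIndepFun_increment hμ h,
      fun _ hr n => PlanarTree.spineMeasure_increment hμ h hr n,
      fun _ hr _ hR => PlanarTree.spineMeasure_gen hμ h (by omega) hR⟩⟩
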